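/- Let $G=(V,E)$ be a finite connected simple graph and let $Q=(q(e,f))_{e,f\in E}$ be a real symmetric matrix. For a spanning tree $T$ of $G$ (identified with its edge set) and $C=(c(e))_{e\in E}\in\mathbb{R}^E$ put $$Q(T)=\sum_{e\in T}\sum_{f\in T}q(e,f),\qquad C(T)=\sum_{e\in T}c(e).$$ The matrix $Q$ is called linearizable if there is a $C\in\mathbb{R}^E$, called a linearization of $Q$, with $Q(T)=C(T)$ for every spanning tree $T$ of $G$. A matrix $H=(h(i,j))$ is a sum matrix if there are real vectors $a,b$ with $h(i,j)=a(i)+b(j)$ for all $i,j$; a square matrix is a weak sum matrix if this holds for all $i\neq j$. A graph is biconnected if it is connected and remains connected after the deletion of any one vertex (in particular, a single edge is biconnected); a biconnected component of $G$ is a maximal biconnected subgraph. For biconnected components $I,J$ let $Q_{IJ}$ be the submatrix of $Q$ whose rows are indexed by the edges of $I$ and whose columns are indexed by the edges of $J$. Suppose that every biconnected component of $G$ is a clique, a cycle, or a biclique (complete bipartite graph) with both parts of size at least $3$. Then $Q$ is linearizable if and only if (a) for all biconnected components $I\neq J$ of $G$, $Q_{IJ}$ is a sum matrix, and (b) for every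 biconnected component $B$ of $G$ that is a clique or a biclique with both parts of size at least $3$, $Q_{BB}$ is a symmetric weak sum matrix. Furthermore, if $Q$ is linearizable, a linearization can be computed in $O(|E|^2)$ time: there are a single program for the real RAM (unit-cost addition, truncated subtraction and comparison of natural numbers, unit-cost field operations and comparison of real numbers, rational constants, unit-cost indexed access to arrays) and a constant $K$ such that, for every such $G$ and every linearizable symmetric $Q$, given $|V|$, $|E|$, the list of the edges of $G$ (as pairs of end vertices, with vertices and edges numbered arbitrarily) and the entries of $Q$, the program halts after at most $K(|E|^2+1)$ steps and outputs a linearization of $Q$. -/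

import Mathlib

namespace QMSTP

section Matrices

variable {ι κ : Type*}

/-- `H` is a sum matrix: `H i j = a i + b j` for some vectors `a`, `b`. -/
def IsSumMatrix (H : Matrix ι κ ℝ) : Prop :=
  ∃ (a : ι → ℝ) (b : κ → ℝ), ∀ i j, H i j = a i + b j

/-- `H` is a weak sum matrix: `H i j = a i + b j` for some vectors `a`, `b`, off the diagonal. -/
def IsWeakSumMatrix (H : Matrix ι ι ℝ) : Prop :=
  ∃ a b : ι → ℝ, ∀ i j, i ≠ j → H i j = a i + b j

/-- `H` is a symmetric weak sum matrix. -/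
def IsSymmWeakSumMatrix (H : Matrix ι ι ℝ) : Prop :=
  H.IsSymm ∧ IsWeakSumMatrix H

end Matrices

section Blocks

variable {V : Type*} {G : SimpleGraph V}

/-- A subgraph is biconnected if it is connected and stays connected when any one of its
vertices is deleted. (A single edge is biconnected, so bridges are components of their own.) -/
def IsBiconnected (H : G.Subgraph) : Prop :=
  H.coe.Connected ∧ ∀ v ∈ H.verts, (H.deleteVerts {v}).coe.Preconnected

/-- A biconnected component is a maximal biconnected subgraph. -/
def IsBiconnectedComponent (B : G.Subgraph) : Prop :=
  Maximal IsBiconnected B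

/-- The subgraph `B` is a clique. -/
def IsCliqueSubgraph (B : G.Subgraph) : Prop :=
  B.coe = ⊤

/-- The subgraph `B` is a cycle. -/
def IsCycleSubgraph (B : G.Subgraph) : Prop :=
  ∃ k : ℕ, 3 ≤ k ∧ Nonempty (B.coe ≃g SimpleGraph.cycleGraph k)

/-- The subgraph `B` is a biclique with both parts of size at least three. -/
def IsBigBicliqueSubgraph (B : G.Subgraph) : Prop :=
  ∃ p q : ℕ, 3 ≤ p ∧ 3 ≤ q ∧ Nonempty (B.coe ≃g completeBipartiteGraph (Fin p) (Fin q))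

/-- Every biconnected component of `G` is a clique, a cycle, or a biclique with both parts of
size at least three. -/
def HasNiceComponents (G : SimpleGraph V) : Prop :=
  ∀ B : G.Subgraph, IsBiconnectedComponent B →
    IsCliqueSubgraph B ∨ IsCycleSubgraph B ∨ IsBigBicliqueSubgraph B

/-- The submatrix of `Q` with rows the edges of `I` and columns the edges of `J`. -/
def subMatrix (Q : Matrix G.edgeSet G.edgeSet ℝ) (I J : G.Subgraph) :
    Matrix I.edgeSet J.edgeSet ℝ :=
  Q.submatrix (Set.inclusion I.edgeSet_subset) (Set.inclusion J.edgeSet_subset)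

end Blocks

section Costs

variable {V : Type*} [Fintype V] {G : SimpleGraph V}

/-- `T` is a spanning tree of `G` (`T` has the same vertex set as `G`). -/
def IsSpanningTree (G T : SimpleGraph V) : Prop :=
  T ≤ G ∧ T.IsTree

open Classical in
/-- The quadratic cost `Q(T)`, the sum of `Q e f` over all ordered pairs of edges of `T`. -/
noncomputable def quadCost (Q : Matrix G.edgeSet G.edgeSet ℝ) (T : SimpleGraph V) : ℝ :=
  ∑ e ∈ Finset.univ.filter (fun e : G.edgeSet => (e : Sym2 V) ∈ T.edgeSet),
    ∑ f ∈ Finset.univ.filter (fun f : G.edgeSet => (f : Sym2 V) ∈ T.edgeSet), Q e f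

open Classical in
/-- The linear cost `C(T)`, the sum of `C e` over all edges of `T`. -/
noncomputable def linCost (C : G.edgeSet → ℝ) (T : SimpleGraph V) : ℝ :=
  ∑ e ∈ Finset.univ.filter (fun e : G.edgeSet => (e : Sym2 V) ∈ T.edgeSet), C e

/-- `C` is a linearization of `Q`: both costs agree on every spanning tree of `G`. -/
def IsLinearization (Q : Matrix G.edgeSet G.edgeSet ℝ) (C : G.edgeSet → ℝ) : Prop :=
  ∀ T : SimpleGraph V, IsSpanningTree G T → quadCost Q T = linCost C T

/-- `Q` is linearizable. -/
def IsLinearizable (Q : Matrix G.edgeSet G.edgeSet ℝ) : Prop :=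
  ∃ C : G.edgeSet → ℝ, IsLinearization Q C

end Costs

/-! A real RAM at unit cost, programmed in a structured imperative language. Addresses and
counters are natural numbers, with addition, truncated subtraction and comparison; data are
real numbers, with the four field operations and comparison. There is no passage from reals to
natural numbers other than branching on a comparison. -/

namespace RealRAM

/-- Memory: natural-number variables, real variables, arrays of natural numbers and arrays of
reals. A program mentions only finitely many variables and array names. -/
structure Memory where
  /-- natural-number variables -/
  nvar : ℕ → ℕ
  /-- real variables -/
  rvar : ℕ → ℝ
  /-- `narr a i` is the `i`-th entry of the natural-number array `a` -/
  narr : ℕ → ℕ → ℕ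
  /-- `rarr a i` is the `i`-th entry of the real array `a` -/
  rarr : ℕ → ℕ → ℝ

/-- Natural-number expressions. -/
inductive NExp where
  | lit (k : ℕ)
  | var (x : ℕ)
  | get (a : ℕ) (i : NExp)
  | add (u v : NExp)
  | sub (u v : NExp)

/-- Real expressions; the literals are rational. -/
inductive RExp where
  | lit (q : ℚ)
  | var (x : ℕ)
  | get (a : ℕ) (i : NExp)
  | add (u v : RExp)
  | sub (u v : RExp)
  | mul (u v : RExp)
  | div (u v : RExp)

/-- Tests. -/
inductive Test where
  | nlt (u v : NExp)
  | neq (u v : NExp)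
  | rlt (u v : RExp)
  | req (u v : RExp)
  | not (b : Test)
  | and (b c : Test)

/-- Programs. -/
inductive Prog where
  | skip
  | nset (x : ℕ) (u : NExp)
  | rset (x : ℕ) (u : RExp)
  | nput (a : ℕ) (i u : NExp)
  | rput (a : ℕ) (i : NExp) (u : RExp)
  | seq (p q : Prog)
  | ite (b : Test) (p q : Prog)
  | while (b : Test) (p : Prog)

/-- The value of a natural-number expression. -/
def NExp.eval (s : Memory) : NExp → ℕ
  | .lit k => k
  | .var x => s.nvar x
  | .get a i => s.narr a (i.eval s)
  | .add u v => u.eval s + v.eval s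
  | .sub u v => u.eval s - v.eval s

/-- The value of a real expression. -/
noncomputable def RExp.eval (s : Memory) : RExp → ℝ
  | .lit q => (q : ℝ)
  | .var x => s.rvar x
  | .get a i => s.rarr a (i.eval s)
  | .add u v => u.eval s + v.eval s
  | .sub u v => u.eval s - v.eval s
  | .mul u v => u.eval s * v.eval s
  | .div u v => u.eval s / v.eval s

/-- The test `b` succeeds in memory `s`. -/
def Test.Holds (s : Memory) : Test → Prop
  | .nlt u v => u.eval s < v.eval s
  | .neq u v => u.eval s = v.eval s
  | .rlt u v => u.eval s < v.eval s
  | .req u v => u.eval s = v.eval s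
  | .not b => ¬ b.Holds s
  | .and b c => b.Holds s ∧ c.Holds s

/-- The number of steps for evaluating a natural-number expression: one per literal, memory
access and operation. -/
def NExp.cost : NExp → ℕ
  | .lit _ => 1
  | .var _ => 1
  | .get _ i => i.cost + 1
  | .add u v => u.cost + v.cost + 1
  | .sub u v => u.cost + v.cost + 1

/-- The number of steps for evaluating a real expression. -/
def RExp.cost : RExp → ℕ
  | .lit _ => 1
  | .var _ => 1
  | .get _ i => i.cost + 1
  | .add u v => u.cost + v.cost + 1
  | .sub u v => u.cost + v.cost + 1
  | .mul u v => u.cost + v.cost + 1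
  | .div u v => u.cost + v.cost + 1

/-- The number of steps for evaluating a test. -/
def Test.cost : Test → ℕ
  | .nlt u v => u.cost + v.cost + 1
  | .neq u v => u.cost + v.cost + 1
  | .rlt u v => u.cost + v.cost + 1
  | .req u v => u.cost + v.cost + 1
  | .not b => b.cost + 1
  | .and b c => b.cost + c.cost + 1

/-- `Exec p s s' t`: started in memory `s`, the program `p` halts in memory `s'` after exactly
`t` steps. -/
inductive Exec : Prog → Memory → Memory → ℕ → Prop where
  | skip (s : Memory) : Exec .skip s s 1
  | nset (s : Memory) (x : ℕ) (u : NExp) :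
      Exec (.nset x u) s { s with nvar := Function.update s.nvar x (u.eval s) } (u.cost + 1)
  | rset (s : Memory) (x : ℕ) (u : RExp) :
      Exec (.rset x u) s { s with rvar := Function.update s.rvar x (u.eval s) } (u.cost + 1)
  | nput (s : Memory) (a : ℕ) (i u : NExp) :
      Exec (.nput a i u) s
        { s with narr :=
            Function.update s.narr a (Function.update (s.narr a) (i.eval s) (u.eval s)) }
        (i.cost + u.cost + 1)
  | rput (s : Memory) (a : ℕ) (i : NExp) (u : RExp) :
      Exec (.rput a i u) s
        { s with rarr :=
            Function.update s.rarr a (Function.update (s.rarr a) (i.eval s) (u.eval s)) }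
        (i.cost + u.cost + 1)
  | seq {p q : Prog} {s s' s'' : Memory} {t t' : ℕ} :
      Exec p s s' t → Exec q s' s'' t' → Exec (.seq p q) s s'' (t + t')
  | ite_true {b : Test} {p q : Prog} {s s' : Memory} {t : ℕ} :
      b.Holds s → Exec p s s' t → Exec (.ite b p q) s s' (b.cost + 1 + t)
  | ite_false {b : Test} {p q : Prog} {s s' : Memory} {t : ℕ} :
      ¬ b.Holds s → Exec q s s' t → Exec (.ite b p q) s s' (b.cost + 1 + t)
  | while_true {b : Test} {p : Prog} {s s' s'' : Memory} {t t' : ℕ} :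
      b.Holds s → Exec p s s' t → Exec (.while b p) s' s'' t' →
        Exec (.while b p) s s'' (b.cost + 1 + t + t')
  | while_false {b : Test} {p : Prog} {s : Memory} :
      ¬ b.Holds s → Exec (.while b p) s s (b.cost + 1)

/-- The initial memory for a graph with vertices `0, …, n - 1` and edges `0, …, m - 1`, edge `i`
joining `x i` and `y i`, and the cost matrix `Q`: the variables `0` and `1` hold `n` and `m`, the
natural-number arrays `0` and `1` hold `x` and `y`, the real array `0` holds `Q` row by row
(the entry `Q i j` at position `i * m + j`), and everything else is zero. -/
noncomputable def input {n m : ℕ} (x y : Fin m → Fin n) (Q : Matrix (Fin m) (Fin m) ℝ) :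
    Memory where
  nvar v := if v = 0 then n else if v = 1 then m else 0
  rvar _ := 0
  narr a k :=
    if h : k < m then
      if a = 0 then (x ⟨k, h⟩ : ℕ) else if a = 1 then (y ⟨k, h⟩ : ℕ) else 0
    else 0
  rarr a k :=
    if h : k < m * m then
      if a = 0 then Q (Fin.divNat ⟨k, h⟩) (Fin.modNat ⟨k, h⟩) else 0
    else 0

end RealRAM

end QMSTP

set_option linter.unusedSectionVars false

/-! Necessity. If `S + e + f`, `S + e' + f`, `S + e + f'`, `S + e' + f'` are all spanning trees, the
alternating sum of their costs is zero for a linear cost, and for the quadratic cost it is twice the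
cross difference `Q(e,f) - Q(e,f') - Q(e',f) + Q(e',f')`. So this cross difference vanishes for
linearizable `Q`. Such an `S` exists as soon as `e`, `e'` are parallel after contracting a subgraph
`R`, and `f`, `f'` are parallel after contracting `R + e` (`crossDiff_eq_zero_of_reachable`). For
two blocks `I ≠ J`, edges of `I` at a vertex `v` become parallel on contracting `I - v`,
independently of `J`; connectedness of the blocks then gives all cross differences, hence (a).
Inside a clique or biclique, `R` comes from a colouring of the vertices with connected classes `1`,
`2`, `3` (`crossDiff_eq_zero_of_colour`), and the remaining cross differences are telescoping sums
of those obtained in this way. A symmetric matrix with vanishing off-diagonal cross differences is a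
weak sum matrix.

Sufficiency. A spanning tree has exactly `|B| - 1` edges in each block `B`
(`ncard_tree_inter_block`). With these cardinalities fixed, a sum matrix contributes linearly, and
so does the diagonal. In a cycle the tree omits just one edge, and every function of the omitted
edge is linear. This is `exists_linear_of_fibers`.

Algorithm. Fix a spanning tree `T`. In every linearization `C` the difference `C e - C f`, for `f`
on the fundamental cycle of `e`, is determined by exchanging `f` for `e` in `T`
(`IsLinearization.sub_eq`). Conversely, a vector with these differences that is also correct on `T`
is a linearization, because a vector constant on fundamental cycles has the same cost on all
spanning trees (`IsCutSystem.linCost_eq`). The program grows `T` together with functions that detect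
fundamental cycles in constant time, finds values with the required differences by merging classes
of tree edges, one cycle after the other, and finally adds a constant. Each of the `O(|E|)` rounds
takes time `O(|E|)`. -/

namespace QMSTP

open SimpleGraph

/-! ### Reachability and edge exchange in trees. -/

section Trees

variable {V : Type*}

theorem reachable_of_forall_adj {H K : SimpleGraph V}
    (h : ∀ u v, H.Adj u v → K.Reachable u v) {u v : V} (huv : H.Reachable u v) :
    K.Reachable u v := by
  obtain ⟨p⟩ := huv
  induction p with
  | nil => exact Reachable.refl _
  | cons hadj _ ih => exact (h _ _ hadj).trans ih

theorem eq_of_reachable {α : Type*} {H : SimpleGraph V} (φ : V → α)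
    (h : ∀ u v, H.Adj u v → φ u = φ v) {u v : V} (huv : H.Reachable u v) : φ u = φ v := by
  obtain ⟨p⟩ := huv
  induction p with
  | nil => rfl
  | cons hadj _ ih => exact (h _ _ hadj).trans ih

theorem reachable_sup_edge (H : SimpleGraph V) (x y : V) : (H ⊔ edge x y).Reachable x y := by
  by_cases h : x = y
  · subst h; exact Reachable.refl _
  · exact Adj.reachable (by simp [edge_adj, h])

theorem reachable_sup_edge_of_reachable {H : SimpleGraph V} {x y x' y' : V}
    (hx : H.Reachable x x') (hy : H.Reachable y y') {u v : V}
    (huv : (H ⊔ edge x y).Reachable u v) : (H ⊔ edge x' y').Reachable u v := by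
  have hle : H ≤ H ⊔ edge x' y' := le_sup_left
  have hxy : (H ⊔ edge x' y').Reachable x y :=
    ((hx.mono hle).trans (reachable_sup_edge H x' y')).trans (hy.mono hle).symm
  refine reachable_of_forall_adj (fun a b hab => ?_) huv
  rcases hab with hab | hab
  · exact (Adj.reachable hab).mono hle
  · rw [edge_adj] at hab
    rcases hab.1 with ⟨rfl, rfl⟩ | ⟨rfl, rfl⟩
    exacts [hxy, hxy.symm]

/-- A tree edge may be replaced by an edge joining the same two components. -/
theorem isTree_sup_edge_swap {S : SimpleGraph V} {x y x' y' : V} (hT : (S ⊔ edge x y).IsTree)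
    (hn : ¬ S.Reachable x y) (hx : S.Reachable x x') (hy : S.Reachable y y') :
    (S ⊔ edge x' y').IsTree := by
  have hacy : S.IsAcyclic := hT.isAcyclic.anti le_sup_left
  have hn' : ¬ S.Reachable x' y' := fun h => hn ((hx.trans h).trans hy.symm)
  have := hT.connected.nonempty
  exact ⟨⟨fun u v => reachable_sup_edge_of_reachable hx hy (hT.connected.preconnected u v)⟩,
    hacy.sup_edge_of_not_reachable hn'⟩

theorem deleteEdges_sup_edge {T : SimpleGraph V} {a b : V} (h : T.Adj a b) :
    T.deleteEdges {s(a, b)} ⊔ edge a b = T := by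
  ext u v
  simp only [sup_adj, deleteEdges_adj, edge_adj, Set.mem_singleton_iff, Sym2.eq_iff]
  constructor
  · rintro (h' | ⟨⟨rfl, rfl⟩ | ⟨rfl, rfl⟩, -⟩)
    exacts [h'.1, h, h.symm]
  · intro h'
    have := h'.ne
    tauto

theorem not_reachable_deleteEdges {T : SimpleGraph V} (hT : T.IsAcyclic) {a b : V}
    (h : T.Adj a b) : ¬ (T.deleteEdges {s(a, b)}).Reachable a b :=
  isBridge_iff.1 (isAcyclic_iff_forall_adj_isBridge.1 hT h)

theorem not_reachable_of_isAcyclic_sup_edge {H : SimpleGraph V} {a b : V}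
    (hT : (H ⊔ edge a b).IsAcyclic) (hab : a ≠ b) (h : ¬ H.Adj a b) : ¬ H.Reachable a b := by
  intro hr
  refine not_reachable_deleteEdges hT (Or.inr (by simp [edge_adj, hab])) (hr.mono ?_)
  intro u v huv
  refine deleteEdges_adj.2 ⟨Or.inl huv, ?_⟩
  rw [Set.mem_singleton_iff, Sym2.eq_iff]
  rintro (⟨rfl, rfl⟩ | ⟨rfl, rfl⟩)
  exacts [h huv, h huv.symm]

theorem edge_le_of_adj {G : SimpleGraph V} {a b : V} (h : G.Adj a b) : edge a b ≤ G := by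
  intro u v huv
  rw [edge_adj] at huv
  rcases huv.1 with ⟨rfl, rfl⟩ | ⟨rfl, rfl⟩
  exacts [h, h.symm]

end Trees

/-! ### Costs as quadratic and linear forms, and cross differences. -/

section Costs

variable {V : Type*} [Fintype V] {G : SimpleGraph V}

/-- The incidence vector of the edges of `T`. -/
noncomputable def indVec (G T : SimpleGraph V) : G.edgeSet → ℝ :=
  T.edgeSet.indicator 1 ∘ Subtype.val

open Classical in
theorem quadCost_eq_dotProduct (Q : Matrix G.edgeSet G.edgeSet ℝ) (T : SimpleGraph V) :
    quadCost Q T = indVec G T ⬝ᵥ (Q.mulVec (indVec G T)) := by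
  simp only [quadCost, indVec, dotProduct, Matrix.mulVec, Finset.sum_filter, Function.comp,
    Set.indicator, Pi.one_apply]
  refine Finset.sum_congr rfl fun e _ => ?_
  split_ifs <;> simp

open Classical in
theorem linCost_eq_dotProduct (C : G.edgeSet → ℝ) (T : SimpleGraph V) :
    linCost C T = indVec G T ⬝ᵥ C := by
  simp only [linCost, indVec, dotProduct, Finset.sum_filter, Function.comp,
    Set.indicator, Pi.one_apply]
  refine Finset.sum_congr rfl fun e _ => ?_
  split_ifs <;> simp

open Classical in
theorem indVec_sup_edge {S : SimpleGraph V} {x y : V} (hG : G.Adj x y) (hS : ¬ S.Adj x y) :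
    indVec G (S ⊔ edge x y) = indVec G S + Pi.single ⟨s(x, y), hG⟩ 1 := by
  funext ⟨e, he⟩
  by_cases h : e = s(x, y)
  · subst h
    simp [indVec, hS, edgeSet_edge_of_ne hG.ne]
  · have h' : (⟨e, he⟩ : G.edgeSet) ≠ ⟨s(x, y), hG⟩ := fun h' => h (congrArg Subtype.val h')
    simp [indVec, Set.indicator, edgeSet_edge_of_ne hG.ne, h, Pi.single_eq_of_ne h']

/-- The entry of `Q` at two edges given as unordered pairs, zero if one is not an edge. -/
noncomputable def entry (Q : Matrix G.edgeSet G.edgeSet ℝ) (a b : Sym2 V) : ℝ :=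
  open Classical in if h : a ∈ G.edgeSet ∧ b ∈ G.edgeSet then Q ⟨a, h.1⟩ ⟨b, h.2⟩ else 0

theorem entry_eq (Q : Matrix G.edgeSet G.edgeSet ℝ) {a b : Sym2 V} (ha : a ∈ G.edgeSet)
    (hb : b ∈ G.edgeSet) : entry Q a b = Q ⟨a, ha⟩ ⟨b, hb⟩ := by
  simp [entry, ha, hb]

theorem entry_comm {Q : Matrix G.edgeSet G.edgeSet ℝ} (hQ : Q.IsSymm) (a b : Sym2 V) :
    entry Q a b = entry Q b a := by
  by_cases h : a ∈ G.edgeSet ∧ b ∈ G.edgeSet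
  · simp only [entry, h, and_self, dif_pos]
    exact hQ.apply _ _
  · rw [entry, entry, dif_neg h, dif_neg (by tauto)]

/-- The difference of `Q` over the rows `a`, `a'` and the columns `b`, `b'`. -/
noncomputable def crossDiff (Q : Matrix G.edgeSet G.edgeSet ℝ) (a a' b b' : Sym2 V) : ℝ :=
  entry Q a b - entry Q a b' - entry Q a' b + entry Q a' b'

theorem crossDiff_swap {Q : Matrix G.edgeSet G.edgeSet ℝ} (hQ : Q.IsSymm) (a a' b b' : Sym2 V) :
    crossDiff Q a a' b b' = crossDiff Q b b' a a' := by
  simp only [crossDiff, entry_comm hQ a, entry_comm hQ a']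
  ring

-- In the alternating sum of the four tree costs the linear costs cancel, and so do all quadratic
-- terms except the interactions between the two exchanged pairs; by symmetry each of these occurs
-- twice.
open Classical in
theorem crossDiff_eq_zero_of_isTree {Q : Matrix G.edgeSet G.edgeSet ℝ} (hQ : Q.IsSymm)
    (hlin : IsLinearizable Q) {S : SimpleGraph V} (hS : S ≤ G) {x y x' y' z w z' w' : V}
    (hxy : G.Adj x y) (hxy' : G.Adj x' y') (hzw : G.Adj z w) (hzw' : G.Adj z' w')
    (h1 : ¬ S.Adj x y) (h2 : ¬ S.Adj x' y')
    (h3 : ¬ (S ⊔ edge x y).Adj z w) (h4 : ¬ (S ⊔ edge x' y').Adj z w)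
    (h5 : ¬ (S ⊔ edge x y).Adj z' w') (h6 : ¬ (S ⊔ edge x' y').Adj z' w')
    (t1 : (S ⊔ edge x y ⊔ edge z w).IsTree) (t2 : (S ⊔ edge x' y' ⊔ edge z w).IsTree)
    (t3 : (S ⊔ edge x y ⊔ edge z' w').IsTree) (t4 : (S ⊔ edge x' y' ⊔ edge z' w').IsTree) :
    crossDiff Q s(x, y) s(x', y') s(z, w) s(z', w') = 0 := by
  obtain ⟨C, hC⟩ := hlin
  have e1 := hC _ ⟨sup_le (sup_le hS (edge_le_of_adj hxy)) (edge_le_of_adj hzw), t1⟩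
  have e2 := hC _ ⟨sup_le (sup_le hS (edge_le_of_adj hxy')) (edge_le_of_adj hzw), t2⟩
  have e3 := hC _ ⟨sup_le (sup_le hS (edge_le_of_adj hxy)) (edge_le_of_adj hzw'), t3⟩
  have e4 := hC _ ⟨sup_le (sup_le hS (edge_le_of_adj hxy')) (edge_le_of_adj hzw'), t4⟩
  rw [quadCost_eq_dotProduct, linCost_eq_dotProduct] at e1 e2 e3 e4
  rw [indVec_sup_edge hzw h3, indVec_sup_edge hxy h1] at e1
  rw [indVec_sup_edge hzw h4, indVec_sup_edge hxy' h2] at e2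
  rw [indVec_sup_edge hzw' h5, indVec_sup_edge hxy h1] at e3
  rw [indVec_sup_edge hzw' h6, indVec_sup_edge hxy' h2] at e4
  simp only [Matrix.mulVec_add, dotProduct_add, add_dotProduct, single_dotProduct,
    Matrix.mulVec_single_one, one_mul, Matrix.col_apply] at e1 e2 e3 e4
  have s1 := hQ.apply ⟨s(x, y), hxy⟩ ⟨s(z, w), hzw⟩
  have s2 := hQ.apply ⟨s(x', y'), hxy'⟩ ⟨s(z, w), hzw⟩
  have s3 := hQ.apply ⟨s(x, y), hxy⟩ ⟨s(z', w'), hzw'⟩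
  have s4 := hQ.apply ⟨s(x', y'), hxy'⟩ ⟨s(z', w'), hzw'⟩
  rw [crossDiff, entry_eq Q hxy hzw, entry_eq Q hxy hzw', entry_eq Q hxy' hzw,
    entry_eq Q hxy' hzw']
  linarith

/-- If `xy` and `x'y'` are parallel over `R`, and `zw` and `z'w'` are parallel over `R + xy`, then
the corresponding cross difference of a linearizable matrix vanishes. -/
theorem crossDiff_eq_zero_of_reachable (hG : G.Connected) {Q : Matrix G.edgeSet G.edgeSet ℝ}
    (hQ : Q.IsSymm) (hlin : IsLinearizable Q) {R : SimpleGraph V} (hR : R ≤ G)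
    {x y x' y' z w z' w' : V}
    (hxy : G.Adj x y) (hxy' : G.Adj x' y') (hzw : G.Adj z w) (hzw' : G.Adj z' w')
    (h1 : ¬ R.Reachable x y) (hx : R.Reachable x x') (hy : R.Reachable y y')
    (h2 : ¬ (R ⊔ edge x y).Reachable z w) (hz : (R ⊔ edge x y).Reachable z z')
    (hw : (R ⊔ edge x y).Reachable w w') :
    crossDiff Q s(x, y) s(x', y') s(z, w) s(z', w') = 0 := by
  -- A spanning forest `R₀` of `R` has the same components, and `R₀ + xy + zw` is acyclic, so it
  -- extends to a spanning tree `T`. Removing `xy` and `zw` from `T` leaves the common part `S` of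
  -- the four trees.
  obtain ⟨R₀, hR₀, hacy, hreach⟩ := exists_isAcyclic_reachable_eq_le (G := R)
  have up : ∀ {u v}, (R ⊔ edge x y).Reachable u v → (R₀ ⊔ edge x y).Reachable u v := by
    intro u v h
    refine reachable_of_forall_adj (fun a b hab => ?_) h
    rcases hab with hab | hab
    · have : R₀.Reachable a b := by rw [hreach]; exact hab.reachable
      exact this.mono le_sup_left
    · exact Adj.reachable (Or.inr hab)
  have a1 : (R₀ ⊔ edge x y).IsAcyclic :=
    hacy.sup_edge_of_not_reachable (fun h => h1 (h.mono hR₀))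
  have a2 : (R₀ ⊔ edge x y ⊔ edge z w).IsAcyclic :=
    a1.sup_edge_of_not_reachable (fun h => h2 (h.mono (sup_le_sup_right hR₀ _)))
  obtain ⟨T, hle1, hle2, hT⟩ := hG.exists_isTree_le_of_le_of_isAcyclic
    (sup_le (sup_le (hR₀.trans hR) (edge_le_of_adj hxy)) (edge_le_of_adj hzw)) a2
  have hexy : (edge x y).Adj x y := by simp [edge_adj, hxy.ne]
  have hTxy : T.Adj x y := hle1 (Or.inl (Or.inr hexy))
  have hTzw : T.Adj z w := hle1 (Or.inr (by simp [edge_adj, hzw.ne]))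
  have hne : s(x, y) ≠ s(z, w) := by
    intro h
    apply h2
    rcases Sym2.eq_iff.1 h with ⟨rfl, rfl⟩ | ⟨rfl, rfl⟩
    exacts [reachable_sup_edge _ _ _, (reachable_sup_edge _ _ _).symm]
  obtain ⟨S₁, hS₁⟩ : ∃ S₁, S₁ = T.deleteEdges {s(z, w)} := ⟨_, rfl⟩
  have hS₁T : S₁ ⊔ edge z w = T := hS₁ ▸ deleteEdges_sup_edge hTzw
  have hS₁le : S₁ ≤ T := hS₁ ▸ deleteEdges_le _
  have hzwS₁ : ¬ S₁.Reachable z w := hS₁ ▸ not_reachable_deleteEdges hT.isAcyclic hTzw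
  have hS₁xy : S₁.Adj x y := by
    rw [hS₁, deleteEdges_adj]; exact ⟨hTxy, hne⟩
  obtain ⟨S, hS⟩ : ∃ S, S = S₁.deleteEdges {s(x, y)} := ⟨_, rfl⟩
  have hSS₁ : S ⊔ edge x y = S₁ := hS ▸ deleteEdges_sup_edge hS₁xy
  have hSle : S ≤ S₁ := hS ▸ deleteEdges_le _
  have hxyS : ¬ S.Reachable x y :=
    hS ▸ not_reachable_deleteEdges (hT.isAcyclic.anti hS₁le) hS₁xy
  -- Neither `xy` nor `zw` joins vertices of one component of `R`, so neither was an edge of `R₀`.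
  have hR₀S : R₀ ≤ S := by
    intro u v huv
    have hr : R.Reachable u v := (hR₀ huv).reachable
    rw [hS, deleteEdges_adj, hS₁, deleteEdges_adj, Set.mem_singleton_iff, Set.mem_singleton_iff]
    refine ⟨⟨hle1 (Or.inl (Or.inl huv)), fun h => h2 (Reachable.mono le_sup_left ?_)⟩,
      fun h => h1 ?_⟩ <;>
    · rcases Sym2.eq_iff.1 h with ⟨rfl, rfl⟩ | ⟨rfl, rfl⟩
      exacts [hr, hr.symm]
  have hxS : S.Reachable x x' := Reachable.mono hR₀S (by rw [hreach]; exact hx)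
  have hyS : S.Reachable y y' := Reachable.mono hR₀S (by rw [hreach]; exact hy)
  have hR₁ : R₀ ⊔ edge x y ≤ S₁ := hSS₁ ▸ sup_le_sup_right hR₀S _
  have hzS : S₁.Reachable z z' := (up hz).mono hR₁
  have hwS : S₁.Reachable w w' := (up hw).mono hR₁
  have hzwS₁' : ¬ S₁.Reachable z' w' := fun h => hzwS₁ ((hzS.trans h).trans hwS.symm)
  have hxyS' : ¬ S.Reachable x' y' := fun h => hxyS ((hxS.trans h).trans hyS.symm)
  have down : ∀ {u v}, (S ⊔ edge x' y').Reachable u v → S₁.Reachable u v := fun h =>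
    hSS₁ ▸ reachable_sup_edge_of_reachable hxS.symm hyS.symm h
  have t1 : (S ⊔ edge x y ⊔ edge z w).IsTree := by rwa [hSS₁, hS₁T]
  have t3 : (S ⊔ edge x y ⊔ edge z' w').IsTree := by
    rw [hSS₁]
    exact isTree_sup_edge_swap (hS₁T.symm ▸ hT) hzwS₁ hzS hwS
  have swap : ∀ {a b}, ¬ S₁.Reachable a b → (S ⊔ edge x y ⊔ edge a b).IsTree →
      (S ⊔ edge x' y' ⊔ edge a b).IsTree := by
    intro a b hab ht
    rw [sup_right_comm] at ht ⊢
    refine isTree_sup_edge_swap ht (not_reachable_of_isAcyclic_sup_edge ht.isAcyclic hxy.ne ?_)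
      (hxS.mono le_sup_left) (hyS.mono le_sup_left)
    rintro (h | h)
    · exact hxyS h.reachable
    · rw [edge_adj] at h
      rcases h.1 with ⟨rfl, rfl⟩ | ⟨rfl, rfl⟩
      exacts [hab hS₁xy.reachable, hab hS₁xy.symm.reachable]
  exact crossDiff_eq_zero_of_isTree hQ hlin (hSle.trans (hS₁le.trans hle2)) hxy hxy' hzw hzw'
    (fun h => hxyS h.reachable) (fun h => hxyS' h.reachable)
    (fun h => hzwS₁ (hSS₁ ▸ h.reachable)) (fun h => hzwS₁ (down h.reachable))
    (fun h => hzwS₁' (hSS₁ ▸ h.reachable)) (fun h => hzwS₁' (down h.reachable))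
    t1 (swap hzwS₁ t1) t3 (swap hzwS₁' t3)

end Costs

/-! ### Biconnected subgraphs and blocks. -/

section Biconnected

variable {V : Type*} {G : SimpleGraph V}

theorem reachable_map {W : Type*} {H : SimpleGraph V} {K : SimpleGraph W} (φ : V → W)
    (h : ∀ u v, H.Adj u v → K.Reachable (φ u) (φ v)) {u v : V} (huv : H.Reachable u v) :
    K.Reachable (φ u) (φ v) := by
  obtain ⟨p⟩ := huv
  induction p with
  | nil => exact Reachable.refl _
  | cons hadj _ ih => exact (h _ _ hadj).trans ih

/-- The edges of `H` that avoid the vertex `v`, as a graph on all vertices. -/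
def avoid (H : G.Subgraph) (v : V) : SimpleGraph V where
  Adj a b := H.Adj a b ∧ a ≠ v ∧ b ≠ v
  symm := ⟨fun _ _ h => ⟨h.1.symm, h.2.2, h.2.1⟩⟩
  loopless := ⟨fun _ h => h.1.ne rfl⟩

theorem avoid_le_spanningCoe (H : G.Subgraph) (v : V) : avoid H v ≤ H.spanningCoe :=
  fun _ _ h => h.1

theorem avoid_mono {H K : G.Subgraph} (h : H ≤ K) (v : V) : avoid H v ≤ avoid K v :=
  fun _ _ h' => ⟨h.2 h'.1, h'.2⟩

theorem coe_reachable_iff {H : G.Subgraph} (a b : H.verts) :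
    H.coe.Reachable a b ↔ H.spanningCoe.Reachable (a : V) b := by
  constructor
  · exact reachable_map Subtype.val fun u v huv => Adj.reachable (by simpa using huv)
  · rintro ⟨p⟩
    obtain ⟨b, hb⟩ := b
    obtain ⟨a, ha⟩ := a
    simp only at p
    induction p with
    | nil => exact Reachable.refl _
    | @cons u v w hadj q ih =>
      have hv : v ∈ H.verts := H.edge_vert (Subgraph.Adj.symm hadj)
      exact (Adj.reachable (show H.coe.Adj ⟨u, ha⟩ ⟨v, hv⟩ from hadj)).trans (ih hb hv)

theorem deleteVerts_spanningCoe (H : G.Subgraph) (v : V) :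
    (H.deleteVerts {v}).spanningCoe = avoid H v := by
  ext a b
  simp only [Subgraph.spanningCoe_adj, Subgraph.deleteVerts_adj, Set.mem_singleton_iff, avoid]
  constructor
  · rintro ⟨-, h1, -, h2, h3⟩
    exact ⟨h3, h1, h2⟩
  · rintro ⟨h, h1, h2⟩
    exact ⟨H.edge_vert h, h1, H.edge_vert h.symm, h2, h⟩

/-- This form lives on the ambient vertex type, where subgraphs can be compared without coercions.
The deleted vertex may be arbitrary, as deleting a vertex outside `H` changes nothing. -/
theorem isBiconnected_iff {H : G.Subgraph} :
    IsBiconnected H ↔ H.verts.Nonempty ∧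
      (∀ a ∈ H.verts, ∀ b ∈ H.verts, H.spanningCoe.Reachable a b) ∧
      ∀ v, ∀ a ∈ H.verts, ∀ b ∈ H.verts, a ≠ v → b ≠ v → (avoid H v).Reachable a b := by
  constructor
  · rintro ⟨h1, h2⟩
    have h3 : ∀ a ∈ H.verts, ∀ b ∈ H.verts, H.spanningCoe.Reachable a b := fun a ha b hb =>
      (coe_reachable_iff ⟨a, ha⟩ ⟨b, hb⟩).1 (h1.preconnected _ _)
    refine ⟨Set.nonempty_coe_sort.1 h1.nonempty, h3, fun v a ha b hb hav hbv => ?_⟩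
    by_cases hv : v ∈ H.verts
    · have := (coe_reachable_iff ⟨a, show a ∈ (H.deleteVerts {v}).verts from ⟨ha, hav⟩⟩
        ⟨b, show b ∈ (H.deleteVerts {v}).verts from ⟨hb, hbv⟩⟩).1 (h2 v hv _ _)
      rwa [deleteVerts_spanningCoe] at this
    · refine (h3 a ha b hb).mono fun c d hcd => ⟨hcd, ?_, ?_⟩
      · rintro rfl; exact hv (H.edge_vert hcd)
      · rintro rfl; exact hv (H.edge_vert (Subgraph.Adj.symm hcd))
  · rintro ⟨h1, h2, h3⟩
    have := h1.to_subtype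
    refine ⟨⟨fun a b => (coe_reachable_iff a b).2 (h2 _ a.2 _ b.2)⟩, fun v _ a b => ?_⟩
    rw [coe_reachable_iff, deleteVerts_spanningCoe]
    exact h3 v a a.2.1 b b.2.1 a.2.2 b.2.2

/-- Whichever vertex is deleted, one of the two common vertices survives, and everything on either
side is still connected to it. -/
theorem IsBiconnected.sup {H K : G.Subgraph} (hH : IsBiconnected H) (hK : IsBiconnected K)
    {a b : V} (hab : a ≠ b) (haH : a ∈ H.verts) (haK : a ∈ K.verts) (hbH : b ∈ H.verts)
    (hbK : b ∈ K.verts) : IsBiconnected (H ⊔ K) := by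
  rw [isBiconnected_iff] at *
  obtain ⟨h1, h2, h3⟩ := hH
  obtain ⟨k1, k2, k3⟩ := hK
  have key : ∀ v c, c ≠ v → c ∈ H.verts → c ∈ K.verts → ∀ x ∈ (H ⊔ K).verts, x ≠ v →
      (avoid (H ⊔ K) v).Reachable x c := by
    rintro v c hcv hcH hcK x (hx | hx) hxv
    · exact (h3 v x hx c hcH hxv hcv).mono (avoid_mono le_sup_left v)
    · exact (k3 v x hx c hcK hxv hcv).mono (avoid_mono le_sup_right v)
  have key' : ∀ x ∈ (H ⊔ K).verts, (H ⊔ K).spanningCoe.Reachable x a := by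
    rintro x (hx | hx)
    · exact (h2 x hx a haH).mono fun _ _ h => Or.inl h
    · exact (k2 x hx a haK).mono fun _ _ h => Or.inr h
  refine ⟨⟨a, Or.inl haH⟩, fun x hx y hy => (key' x hx).trans (key' y hy).symm,
    fun v x hx y hy hxv hyv => ?_⟩
  obtain ⟨c, hcv, hcH, hcK⟩ : ∃ c, c ≠ v ∧ c ∈ H.verts ∧ c ∈ K.verts := by
    by_cases h : a = v
    · exact ⟨b, fun h' => hab (h.trans h'.symm), hbH, hbK⟩
    · exact ⟨a, h, haH, haK⟩
  exact (key v c hcv hcH hcK x hx hxv).trans (key v c hcv hcH hcK y hy hyv).symm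

/-- Distinct blocks share at most one vertex: otherwise their union would be biconnected, against
maximality. -/
theorem IsBiconnectedComponent.eq_of_mem {I J : G.Subgraph} (hI : IsBiconnectedComponent I)
    (hJ : IsBiconnectedComponent J) {a b : V} (hab : a ≠ b) (haI : a ∈ I.verts)
    (haJ : a ∈ J.verts) (hbI : b ∈ I.verts) (hbJ : b ∈ J.verts) : I = J := by
  have h := hI.1.sup hJ.1 hab haI haJ hbI hbJ
  exact (hI.eq_of_le h le_sup_left).trans (hJ.eq_of_le h le_sup_right).symm

theorem isBiconnected_subgraphOfAdj {u w : V} (h : G.Adj u w) :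
    IsBiconnected (G.subgraphOfAdj h) := by
  have hmem : ∀ x, x ∈ (G.subgraphOfAdj h).verts ↔ x = u ∨ x = w := fun x => by simp
  have hadj : ∀ a b, a ∈ (G.subgraphOfAdj h).verts → b ∈ (G.subgraphOfAdj h).verts → a ≠ b →
      (G.subgraphOfAdj h).Adj a b := by
    intro a b ha hb hab
    rw [hmem] at ha hb
    rcases ha with rfl | rfl <;> rcases hb with rfl | rfl <;> simp_all [Sym2.eq_swap]
  rw [isBiconnected_iff]
  refine ⟨⟨u, by simp⟩, fun a ha b hb => ?_, fun v a ha b hb hav hbv => ?_⟩ <;>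
    by_cases hab : a = b
  · rw [hab]
  · exact Adj.reachable (hadj a b ha hb hab)
  · rw [hab]
  · exact Adj.reachable ⟨hadj a b ha hb hab, hav, hbv⟩

theorem exists_isBiconnectedComponent_adj [Finite V] {u w : V} (h : G.Adj u w) :
    ∃ B : G.Subgraph, IsBiconnectedComponent B ∧ B.Adj u w := by
  obtain ⟨B, hle, hB⟩ := Set.toFinite {H : G.Subgraph | IsBiconnected H} |>.exists_le_maximal
    (isBiconnected_subgraphOfAdj h)
  exact ⟨B, hB, hle.2 (by simp)⟩

theorem avoid_reachable_of_walk {H : G.Subgraph} {v a b : V} (p : G.Walk a b)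
    (hp : ∀ e ∈ p.edges, e ∈ H.edgeSet) (hv : v ∉ p.support) : (avoid H v).Reachable a b := by
  induction p with
  | nil => exact Reachable.refl _
  | @cons u x w hadj q ih =>
    rw [Walk.edges_cons] at hp
    rw [Walk.support_cons, List.mem_cons, not_or] at hv
    refine Reachable.trans (Adj.reachable ⟨hp _ List.mem_cons_self, Ne.symm hv.1, ?_⟩)
      (ih (fun e he => hp e (List.mem_cons_of_mem _ he)) hv.2)
    rintro rfl
    exact hv.2 q.start_mem_support

/-- A path between two vertices of a block is an ear; attaching it keeps the block biconnected, so
by maximality it was already inside. -/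
theorem IsBiconnectedComponent.adj_of_isPath {B : G.Subgraph} (hB : IsBiconnectedComponent B)
    {x y : V} (hx : x ∈ B.verts) (hy : y ∈ B.verts) {p : G.Walk x y} (hp : p.IsPath)
    {c d : V} (hcd : s(c, d) ∈ p.edges) : B.Adj c d := by
  classical
  by_cases hxy : x = y
  · subst hxy
    rw [Walk.eq_nil_iff_nil.2 (Walk.isPath_iff_nil.1 hp)] at hcd
    simp at hcd
  have hbi : IsBiconnected (B ⊔ p.toSubgraph) := by
    have hpe : ∀ e ∈ p.edges, e ∈ (B ⊔ p.toSubgraph).edgeSet := fun e he => by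
      simp [Subgraph.edgeSet_sup, he]
    obtain ⟨h1, h2, h3⟩ := isBiconnected_iff.1 hB.1
    have toB : ∀ v, ∀ t ∈ (B ⊔ p.toSubgraph).verts, t ≠ v → ∃ c ∈ B.verts, c ≠ v ∧
        (avoid (B ⊔ p.toSubgraph) v).Reachable t c := by
      rintro v t (ht | ht) htv
      · exact ⟨t, ht, htv, Reachable.refl _⟩
      · rw [Walk.mem_verts_toSubgraph] at ht
        -- The path is simple, so the deleted vertex `v ≠ t` cannot lie on both sides of `t`; the
        -- part that avoids `v` leads to an end of the path in `B`.
        by_cases hv : v ∈ (p.takeUntil t ht).support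
        · have hv' : v ∉ (p.dropUntil t ht).support := by
            intro hv'
            have hnd := hp.support_nodup
            rw [← p.take_spec ht, Walk.support_append, List.nodup_append] at hnd
            rw [Walk.mem_support_iff] at hv'
            rcases hv' with hv' | hv'
            · exact htv hv'.symm
            · exact hnd.2.2 v hv v hv' rfl
          refine ⟨y, hy, ?_, avoid_reachable_of_walk (p.dropUntil t ht)
            (fun e he => hpe e (p.edges_dropUntil_subset_edges ht he)) hv'⟩
          rintro rfl
          exact hv' (Walk.end_mem_support _)
        · refine ⟨x, hx, ?_, (avoid_reachable_of_walk (p.takeUntil t ht)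
            (fun e he => hpe e (p.edges_takeUntil_subset_edges ht he)) hv).symm⟩
          rintro rfl
          exact hv (Walk.start_mem_support _)
    have reach : ∀ v, ∀ a ∈ (B ⊔ p.toSubgraph).verts, ∀ b ∈ (B ⊔ p.toSubgraph).verts, a ≠ v →
        b ≠ v → (avoid (B ⊔ p.toSubgraph) v).Reachable a b := by
      intro v a ha b hb hav hbv
      obtain ⟨a', ha', hav', hra⟩ := toB v a ha hav
      obtain ⟨b', hb', hbv', hrb⟩ := toB v b hb hbv
      exact (hra.trans ((h3 v a' ha' b' hb' hav' hbv').mono (avoid_mono le_sup_left v))).trans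
        hrb.symm
    have hcon : ∀ t ∈ (B ⊔ p.toSubgraph).verts,
        (B ⊔ p.toSubgraph).spanningCoe.Reachable t x := by
      rintro t (ht | ht)
      · exact (h2 t ht x hx).mono fun _ _ h => Or.inl h
      · rw [Walk.mem_verts_toSubgraph] at ht
        refine Reachable.mono (fun _ _ h => Or.inr h) ((coe_reachable_iff (H := p.toSubgraph)
          ⟨t, by simpa using ht⟩ ⟨x, by simp⟩).1 ?_)
        exact p.toSubgraph_connected.preconnected _ _
    exact isBiconnected_iff.2 ⟨⟨x, Or.inl hx⟩,
      fun a ha b hb => (hcon a ha).trans (hcon b hb).symm, reach⟩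
  have hle : B ⊔ p.toSubgraph ≤ B := hB.2 hbi le_sup_left
  exact hle.2 (Or.inr (p.adj_toSubgraph_iff_mem_edges.2 hcd))

/-- What happens in one block does not affect connections in another. Mapping all vertices outside
`J` to the only possible common vertex `z` collapses the edges of `H` and fixes those of `K`. -/
theorem IsBiconnectedComponent.reachable_of_sup {I J : G.Subgraph}
    (hI : IsBiconnectedComponent I) (hJ : IsBiconnectedComponent J) (hIJ : I ≠ J)
    {H K : SimpleGraph V} (hH : H ≤ I.spanningCoe) (hK : K ≤ J.spanningCoe) {a b : V}
    (ha : a ∈ J.verts) (hb : b ∈ J.verts) (h : (H ⊔ K).Reachable a b) : K.Reachable a b := by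
  classical
  obtain ⟨z, hz⟩ : ∃ z, ∀ t ∈ I.verts, t ∈ J.verts → t = z := by
    by_cases hex : ∃ z, z ∈ I.verts ∧ z ∈ J.verts
    · obtain ⟨z, hzI, hzJ⟩ := hex
      refine ⟨z, fun t htI htJ => ?_⟩
      by_contra htz
      exact hIJ (hI.eq_of_mem hJ htz htI htJ hzI hzJ)
    -- For disjoint blocks any vertex of `J` can serve as `z`.
    · exact ⟨a, fun t htI htJ => (hex ⟨t, htI, htJ⟩).elim⟩
  have hφI : ∀ t ∈ I.verts, (if t ∈ J.verts then t else z) = z := fun t ht => by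
    split_ifs with h
    exacts [hz t ht h, rfl]
  have := reachable_map (K := K) (fun t => if t ∈ J.verts then t else z) (fun u v huv => ?_) h
  · simpa only [if_pos ha, if_pos hb] using this
  · rcases huv with huv | huv
    · simp only [hφI u (I.edge_vert (hH huv)),
        hφI v (I.edge_vert (Subgraph.Adj.symm (hH huv)))]
      exact Reachable.refl _
    · simp only [if_pos (J.edge_vert (hK huv)),
        if_pos (J.edge_vert (Subgraph.Adj.symm (hK huv)))]
      exact huv.reachable

theorem not_avoid_reachable {H : G.Subgraph} {v u : V} (h : v ≠ u) :
    ¬ (avoid H v).Reachable v u := fun hr =>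
  h ((eq_of_reachable (fun t => t = v) (fun a b hab => by simp [hab.2.1, hab.2.2]) hr).mp
    rfl).symm

/-- Any two edges of a connected subgraph are linked by a chain of consecutively adjacent edges, so
only pairs with a common end need to be treated. -/
theorem eq_of_adjacent_edges {H : G.Subgraph}
    (hH : ∀ a ∈ H.verts, ∀ b ∈ H.verts, H.spanningCoe.Reachable a b) {α : Type*}
    (h : Sym2 V → α) (hadj : ∀ v u w, H.Adj v u → H.Adj v w → h s(v, u) = h s(v, w))
    {e e' : Sym2 V} (he : e ∈ H.edgeSet) (he' : e' ∈ H.edgeSet) : h e = h e' := by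
  induction e with | _ u v =>
  induction e' with | _ u' v' =>
  rw [Subgraph.mem_edgeSet] at he he'
  obtain ⟨p⟩ := hH u (H.edge_vert he) u' (H.edge_vert he')
  induction p generalizing v with
  | nil => exact hadj _ _ _ he he'
  | @cons a b c hab q ih =>
    rw [hadj _ _ _ he hab, Sym2.eq_swap]
    exact ih _ (Subgraph.Adj.symm hab) he'

end Biconnected

/-! ### Cross differences between two blocks, and tree edges inside a block. -/

section Blocks

variable {V : Type*} [Fintype V] {G : SimpleGraph V}

/-- For edges at `v` in `I` and at `v'` in `J` take `R = (I - v) ∪ (J - v')`: since `I - v` and `J -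
v'` are connected, each pair becomes parallel, and `reachable_of_sup` excludes a detour through the
other block. `eq_of_adjacent_edges`, applied in each block, extends this to all edges. -/
theorem crossDiff_eq_zero_of_blocks (hG : G.Connected) {Q : Matrix G.edgeSet G.edgeSet ℝ}
    (hQ : Q.IsSymm) (hlin : IsLinearizable Q) {I J : G.Subgraph}
    (hI : IsBiconnectedComponent I) (hJ : IsBiconnectedComponent J) (hIJ : I ≠ J)
    {e e' f f' : Sym2 V} (he : e ∈ I.edgeSet) (he' : e' ∈ I.edgeSet) (hf : f ∈ J.edgeSet)
    (hf' : f' ∈ J.edgeSet) : crossDiff Q e e' f f' = 0 := by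
  have key : ∀ v u w, I.Adj v u → I.Adj v w → ∀ v' u' w', J.Adj v' u' → J.Adj v' w' →
      crossDiff Q s(v, u) s(v, w) s(v', u') s(v', w') = 0 := by
    intro v u w hu hw v' u' w' hu' hw'
    have hI3 := (isBiconnected_iff.1 hI.1).2.2
    have hJ3 := (isBiconnected_iff.1 hJ.1).2.2
    have hIe := I.edge_vert hu
    have hJe := J.edge_vert hu'
    refine crossDiff_eq_zero_of_reachable hG hQ hlin (R := avoid I v ⊔ avoid J v')
      (sup_le ((avoid_le_spanningCoe _ _).trans I.spanningCoe_le)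
        ((avoid_le_spanningCoe _ _).trans J.spanningCoe_le))
      (I.adj_sub hu) (I.adj_sub hw) (J.adj_sub hu') (J.adj_sub hw') ?_ (Reachable.refl _) ?_ ?_
      (Reachable.refl _) ?_
    · intro h
      rw [sup_comm] at h
      exact not_avoid_reachable hu.ne (hJ.reachable_of_sup hI hIJ.symm
        (avoid_le_spanningCoe _ _) (avoid_le_spanningCoe _ _) hIe (I.edge_vert hu.symm) h)
    · exact (hI3 v u (I.edge_vert hu.symm) w (I.edge_vert hw.symm) hu.ne.symm hw.ne.symm).mono
        le_sup_left
    · intro h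
      rw [sup_right_comm] at h
      exact not_avoid_reachable hu'.ne (hI.reachable_of_sup hJ hIJ
        (sup_le (avoid_le_spanningCoe _ _) (edge_le_of_adj hu)) (avoid_le_spanningCoe _ _) hJe
        (J.edge_vert hu'.symm) h)
    · exact (hJ3 v' u' (J.edge_vert hu'.symm) w' (J.edge_vert hw'.symm) hu'.ne.symm
        hw'.ne.symm).mono (le_sup_right.trans le_sup_left)
  have hIc := (isBiconnected_iff.1 hI.1).2.1
  have hJc := (isBiconnected_iff.1 hJ.1).2.1
  have step : ∀ v u w, I.Adj v u → I.Adj v w → entry Q s(v, u) f - entry Q s(v, w) f =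
      entry Q s(v, u) f' - entry Q s(v, w) f' := by
    intro v u w hu hw
    refine eq_of_adjacent_edges hJc (fun f => entry Q s(v, u) f - entry Q s(v, w) f)
      (fun v' u' w' hu' hw' => ?_) hf hf'
    have := key v u w hu hw v' u' w' hu' hw'
    simp only [crossDiff] at this ⊢
    linarith
  have := eq_of_adjacent_edges hIc (fun e => entry Q e f - entry Q e f')
    (fun v u w hu hw => by have := step v u w hu hw; linarith) he he'
  simp only [crossDiff] at this ⊢
  linarith

theorem isSumMatrix_of_isLinearizable (hG : G.Connected) {Q : Matrix G.edgeSet G.edgeSet ℝ}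
    (hQ : Q.IsSymm) (hlin : IsLinearizable Q) {I J : G.Subgraph}
    (hI : IsBiconnectedComponent I) (hJ : IsBiconnectedComponent J) (hIJ : I ≠ J) :
    IsSumMatrix (subMatrix Q I J) := by
  have hsub : ∀ (e : I.edgeSet) (f : J.edgeSet), subMatrix Q I J e f = entry Q e f := fun e f =>
    (entry_eq Q (I.edgeSet_subset e.2) (J.edgeSet_subset f.2)).symm
  by_cases h : Nonempty I.edgeSet ∧ Nonempty J.edgeSet
  · obtain ⟨⟨e₀⟩, ⟨f₀⟩⟩ := h
    refine ⟨fun e => entry Q e f₀, fun f => entry Q e₀ f - entry Q e₀ f₀, fun e f => ?_⟩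
    have := crossDiff_eq_zero_of_blocks hG hQ hlin hI hJ hIJ e.2 e₀.2 f.2 f₀.2
    rw [crossDiff] at this
    rw [hsub]
    linarith
  · exact ⟨0, 0, fun e f => (h ⟨⟨e⟩, ⟨f⟩⟩).elim⟩

/-- A spanning tree contains `|B| - 1` edges of the block `B`. -/
theorem ncard_tree_inter_block {T : SimpleGraph V} (hT : IsSpanningTree G T) {B : G.Subgraph}
    (hB : IsBiconnectedComponent B) : (T.edgeSet ∩ B.edgeSet).ncard + 1 = B.verts.ncard := by
  obtain ⟨hle, hT⟩ := hT
  -- The part of `T` in `B` is itself a tree: the path of `T` between two vertices of `B` stays in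
  -- `B` by `adj_of_isPath`.
  obtain ⟨T', hT'⟩ : ∃ T' : SimpleGraph B.verts, T' = T.comap Subtype.val ⊓ B.coe := ⟨_, rfl⟩
  have hadj : ∀ a b : B.verts, T'.Adj a b ↔ T.Adj a b ∧ B.Adj a b := fun a b => by
    rw [hT']; rfl
  have htree : T'.IsTree := by
    have := (isBiconnected_iff.1 hB.1).1.to_subtype
    refine ⟨⟨fun a b => ?_⟩, ?_⟩
    · obtain ⟨p, hp⟩ := (hT.connected.preconnected (a : V) b).exists_isPath
      have hpB : ∀ c d, s(c, d) ∈ p.edges → B.Adj c d := fun c d hcd =>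
        hB.adj_of_isPath a.2 b.2 (p := p.mapLe hle) (by simpa using hp)
          (by simpa using hcd)
      obtain ⟨a, ha⟩ := a
      obtain ⟨b, hb⟩ := b
      simp only at p
      clear hp
      induction p with
      | nil => exact Reachable.refl _
      | @cons u x w hux q ih =>
        have hB' : B.Adj u x := hpB u x (by simp)
        exact (Adj.reachable ((hadj ⟨u, ha⟩ ⟨x, B.edge_vert hB'.symm⟩).2 ⟨hux, hB'⟩)).trans
          (ih _ hb (fun c d hcd => hpB c d (by simp [hcd])))
    · exact (hT.isAcyclic.comap (G := T.comap Subtype.val) ⟨Subtype.val, fun h => h⟩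
        Subtype.val_injective).anti (hT' ▸ inf_le_left)
  have hcard := (isTree_iff_connected_and_card.1 htree).2
  rw [Nat.card_coe_set_eq, Nat.card_coe_set_eq] at hcard
  rw [← hcard, ← Set.ncard_image_of_injective _ (Sym2.map.injective Subtype.val_injective)]
  congr 2
  ext e
  induction e with | _ u v =>
  constructor
  · rintro ⟨h1, h2⟩
    rw [Subgraph.mem_edgeSet] at h2
    exact ⟨s(⟨u, B.edge_vert h2⟩, ⟨v, B.edge_vert h2.symm⟩), (hadj _ _).2 ⟨h1, h2⟩, rfl⟩
  · rintro ⟨e, he, h⟩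
    induction e with | _ a b =>
    rw [← h]
    exact (hadj a b).1 he

end Blocks

/-! ### Quadratic forms on sets that meet each fibre in a prescribed number of elements. -/

section Fibers

open Finset

variable {E ι : Type*} [Fintype E] [Fintype ι] [DecidableEq E] [DecidableEq ι]

/-- Summing `a e + b f` over the pairs counts each `a e` exactly `N j` times and each `b f` exactly
`N i` times. -/
theorem exists_sum_filter_eq {Q : E → E → ℝ} {blk : E → ι} {N : ι → ℕ} {i j : ι}
    {a b : E → ℝ} (h : ∀ e f, blk e = i → blk f = j → Q e f = a e + b f) :
    ∃ c : E → ℝ, ∀ T : Finset E, (∀ k, #{e ∈ T | blk e = k} = N k) →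
      ∑ e ∈ T with blk e = i, ∑ f ∈ T with blk f = j, Q e f = ∑ e ∈ T, c e := by
  refine ⟨fun e => (if blk e = i then N j * a e else 0) + (if blk e = j then N i * b e else 0),
    fun T hT => ?_⟩
  rw [sum_add_distrib, ← sum_filter, ← sum_filter, ← mul_sum, ← mul_sum]
  have : ∑ e ∈ T with blk e = i, ∑ f ∈ T with blk f = j, Q e f =
      ∑ e ∈ T with blk e = i, ∑ f ∈ T with blk f = j, (a e + b f) :=
    sum_congr rfl fun e he => sum_congr rfl fun f hf =>
      h e f (mem_filter.1 he).2 (mem_filter.1 hf).2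
  rw [this]
  simp only [sum_add_distrib, sum_const, hT, nsmul_eq_mul, mul_sum]

/-- The pair `(e, e)` is used exactly when `e` is, so the deviation from a sum matrix on the
diagonal is a linear cost. -/
theorem exists_sum_filter_eq_of_weak {Q : E → E → ℝ} {blk : E → ι} {N : ι → ℕ} {i : ι}
    {a b : E → ℝ} (h : ∀ e f, blk e = i → blk f = i → e ≠ f → Q e f = a e + b f) :
    ∃ c : E → ℝ, ∀ T : Finset E, (∀ k, #{e ∈ T | blk e = k} = N k) →
      ∑ e ∈ T with blk e = i, ∑ f ∈ T with blk f = i, Q e f = ∑ e ∈ T, c e := by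
  obtain ⟨c, hc⟩ := exists_sum_filter_eq (Q := fun e f => a e + b f) (blk := blk) (N := N)
    (i := i) (j := i) (a := a) (b := b) (fun _ _ _ _ => rfl)
  refine ⟨fun e => c e + if blk e = i then Q e e - a e - b e else 0, fun T hT => ?_⟩
  rw [sum_add_distrib, ← hc T hT, ← sum_filter, ← sum_add_distrib]
  refine sum_congr rfl fun e he => ?_
  have h1 : ∑ f ∈ T with blk f = i, Q e f = ∑ f ∈ T with blk f = i,
      ((a e + b f) + if e = f then Q e e - a e - b e else 0) := by
    refine sum_congr rfl fun f hf => ?_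
    split_ifs with hef
    · subst hef; ring
    · rw [h e f (mem_filter.1 he).2 (mem_filter.1 hf).2 hef, add_zero]
  rw [h1, sum_add_distrib, sum_ite_eq, if_pos he]

/-- The set `T` contains all elements of the fibre but one, say `g`, so the quadratic sum depends on
`g` only. -/
theorem exists_sum_filter_eq_of_card {Q : E → E → ℝ} {blk : E → ι} {N : ι → ℕ} {i : ι}
    (h0 : N i ≠ 0) (h1 : N i + 1 = #{e | blk e = i}) :
    ∃ c : E → ℝ, ∀ T : Finset E, (∀ k, #{e ∈ T | blk e = k} = N k) →
      ∑ e ∈ T with blk e = i, ∑ f ∈ T with blk f = i, Q e f = ∑ e ∈ T, c e := by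
  obtain ⟨B, hB⟩ : ∃ B : Finset E, B = univ.filter fun e => blk e = i := ⟨_, rfl⟩
  obtain ⟨F, hF⟩ : ∃ F : E → ℝ, ∀ g, F g = ∑ e ∈ B.erase g, ∑ f ∈ B.erase g, Q e f :=
    ⟨_, fun _ => rfl⟩
  -- On `B` without `g`, which has `N i` elements, these costs add up to `∑ F - (∑ F - F g) = F g`.
  refine ⟨fun e => if blk e = i then (∑ g ∈ B, F g) / N i - F e else 0, fun T hT => ?_⟩
  rw [← sum_filter]
  have hsub : T.filter (fun e => blk e = i) ⊆ B := hB ▸ filter_subset_filter _ (subset_univ _)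
  have hcard : #(B \ T.filter fun e => blk e = i) = 1 := by
    rw [card_sdiff_of_subset hsub, hT, hB, ← h1]; omega
  obtain ⟨g, hg⟩ := card_eq_one.1 hcard
  have hgB : g ∈ B := (mem_sdiff.1 (hg ▸ mem_singleton_self g)).1
  have hTg : T.filter (fun e => blk e = i) = B.erase g := by
    rw [erase_eq, ← hg, Finset.sdiff_sdiff_eq_self hsub]
  rw [hTg, ← hF, sum_sub_distrib, sum_const, card_erase_of_mem hgB, hB, ← h1, ← hB,
    sum_erase_eq_sub hgB, Nat.add_sub_cancel, nsmul_eq_mul]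
  field_simp
  ring

/-- If every admissible set has a prescribed number of elements in each fibre, and each block of
`Q` is a sum matrix off the diagonal or belongs to a fibre of which all elements but one are
used, then `Q` is linear on admissible sets. -/
theorem exists_linear_of_fibers {Q : E → E → ℝ} {blk : E → ι} {N : ι → ℕ}
    (h1 : ∀ i j, i ≠ j → ∃ a b : E → ℝ, ∀ e f, blk e = i → blk f = j → Q e f = a e + b f)
    (h2 : ∀ i, (∃ a b : E → ℝ, ∀ e f, blk e = i → blk f = i → e ≠ f → Q e f = a e + b f) ∨
      (N i ≠ 0 ∧ N i + 1 = #{e | blk e = i})) :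
    ∃ c : E → ℝ, ∀ T : Finset E, (∀ k, #{e ∈ T | blk e = k} = N k) →
      ∑ e ∈ T, ∑ f ∈ T, Q e f = ∑ e ∈ T, c e := by
  have key : ∀ p : ι × ι, ∃ c : E → ℝ, ∀ T : Finset E, (∀ k, #{e ∈ T | blk e = k} = N k) →
      ∑ e ∈ T with blk e = p.1, ∑ f ∈ T with blk f = p.2, Q e f = ∑ e ∈ T, c e := by
    rintro ⟨i, j⟩
    by_cases hij : i = j
    · subst hij
      rcases h2 i with ⟨a, b, h⟩ | ⟨h, h'⟩
      exacts [exists_sum_filter_eq_of_weak h, exists_sum_filter_eq_of_card h h']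
    · obtain ⟨a, b, h⟩ := h1 i j hij
      exact exists_sum_filter_eq h
  choose c hc using key
  refine ⟨fun e => ∑ p, c p e, fun T hT => ?_⟩
  have hcomm : ∑ e ∈ T, ∑ p, c p e = ∑ p, ∑ e ∈ T, c p e := sum_comm
  rw [hcomm, Fintype.sum_prod_type]
  simp only [← hc _ T hT]
  rw [← sum_fiberwise T blk]
  refine sum_congr rfl fun i _ => ?_
  exact (sum_congr rfl fun e _ => (sum_fiberwise T blk (Q e)).symm).trans sum_comm

end Fibers

/-! ### Sufficiency of the conditions (a) and (b). -/

section Converse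

variable {V : Type*} [Fintype V] {G : SimpleGraph V}

theorem ncard_edgeSet_eq (B : G.Subgraph) : B.edgeSet.ncard = Nat.card B.coe.edgeSet := by
  rw [← Subgraph.image_coe_edgeSet_coe,
    Set.ncard_image_of_injective _ (Sym2.map.injective Subtype.val_injective),
    Nat.card_coe_set_eq]

theorem IsCycleSubgraph.ncard_eq {B : G.Subgraph} (hB : IsCycleSubgraph B) :
    3 ≤ B.verts.ncard ∧ B.edgeSet.ncard = B.verts.ncard := by
  obtain ⟨k, hk, ⟨φ⟩⟩ := hB
  have h1 : B.verts.ncard = k := by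
    rw [← Nat.card_coe_set_eq, Nat.card_congr φ.toEquiv, Nat.card_fin]
  have h2 : B.edgeSet.ncard = k := by
    rw [ncard_edgeSet_eq, Nat.card_congr φ.mapEdgeSet]
    obtain ⟨n, rfl⟩ := Nat.exists_eq_add_of_le' hk
    have h := (cycleGraph (n + 3)).sum_degrees_eq_twice_card_edges
    simp only [cycleGraph_degree_three_le, Finset.sum_const, Finset.card_univ, Fintype.card_fin,
      smul_eq_mul] at h
    rw [Nat.card_eq_fintype_card, ← edgeFinset_card]
    omega
  exact ⟨h1 ▸ hk, h2.trans h1.symm⟩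

/-- Every edge lies in exactly one block, so the blocks are the fibres of a map `blk` on the edges,
and a spanning tree has `|B| - 1` edges in the fibre of `B`. Cycles have as many edges as vertices,
which is the case of all elements but one. -/
theorem isLinearizable_of_blocks (hnice : HasNiceComponents G)
    {Q : Matrix G.edgeSet G.edgeSet ℝ}
    (ha : ∀ I J : G.Subgraph, IsBiconnectedComponent I → IsBiconnectedComponent J → I ≠ J →
      IsSumMatrix (subMatrix Q I J))
    (hb : ∀ B : G.Subgraph, IsBiconnectedComponent B →
      (IsCliqueSubgraph B ∨ IsBigBicliqueSubgraph B) → IsSymmWeakSumMatrix (subMatrix Q B B)) :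
    IsLinearizable Q := by
  classical
  have hex : ∀ e : G.edgeSet, ∃ B : {B : G.Subgraph // IsBiconnectedComponent B},
      (e : Sym2 V) ∈ B.1.edgeSet := by
    rintro ⟨e, he⟩
    induction e with | _ u v =>
    obtain ⟨B, hB, hB'⟩ := exists_isBiconnectedComponent_adj he
    exact ⟨⟨B, hB⟩, hB'⟩
  choose blk hblk using hex
  have hiff : ∀ (e : G.edgeSet) (B : {B : G.Subgraph // IsBiconnectedComponent B}),
      blk e = B ↔ (e : Sym2 V) ∈ B.1.edgeSet := by
    intro e B
    constructor
    · rintro rfl; exact hblk e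
    · intro h
      have h' := hblk e
      obtain ⟨e, he⟩ := e
      induction e with | _ u v =>
      exact Subtype.ext ((blk _).2.eq_of_mem B.2 (G.ne_of_adj he) (Subgraph.edge_vert _ h')
        (Subgraph.edge_vert _ h) (Subgraph.edge_vert _ (Subgraph.Adj.symm h'))
        (Subgraph.edge_vert _ (Subgraph.Adj.symm h)))
  have hcard : ∀ (A : Set (Sym2 V)) (B : {B : G.Subgraph // IsBiconnectedComponent B})
      (F : Finset G.edgeSet), (∀ e, e ∈ F ↔ (e : Sym2 V) ∈ A) →
      (F.filter fun e => blk e = B).card = (A ∩ B.1.edgeSet).ncard := by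
    intro A B F hF
    rw [← Set.ncard_coe_finset, ← Set.ncard_image_of_injective _ Subtype.val_injective]
    congr 1
    ext e
    simp only [Finset.coe_filter, Set.mem_image, Set.mem_ofPred_eq, hiff, hF,
      Set.mem_inter_iff, Subtype.exists, exists_and_right, exists_eq_right]
    exact ⟨fun h => ⟨h.1.2, h.2⟩, fun h => ⟨⟨B.1.edgeSet_subset h.2, h.1⟩, h.2⟩⟩
  suffices h : ∃ c : G.edgeSet → ℝ, ∀ T : Finset G.edgeSet,
      (∀ B : {B : G.Subgraph // IsBiconnectedComponent B},
        (T.filter fun e => blk e = B).card = B.1.verts.ncard - 1) →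
      ∑ e ∈ T, ∑ f ∈ T, Q e f = ∑ e ∈ T, c e by
    obtain ⟨c, hc⟩ := h
    refine ⟨c, fun T hT => hc _ fun B => ?_⟩
    have := ncard_tree_inter_block hT B.2
    rw [hcard T.edgeSet B _ (by simp)]
    omega
  refine exists_linear_of_fibers (fun I J hIJ => ?_) (fun B => ?_)
  · obtain ⟨a, b, h⟩ := ha I.1 J.1 I.2 J.2 fun h => hIJ (Subtype.ext h)
    refine ⟨fun e => if he : (e : Sym2 V) ∈ I.1.edgeSet then a ⟨e, he⟩ else 0,
      fun e => if he : (e : Sym2 V) ∈ J.1.edgeSet then b ⟨e, he⟩ else 0, fun e f he hf => ?_⟩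
    rw [hiff] at he hf
    simp only [he, hf, dif_pos]
    exact h ⟨e, he⟩ ⟨f, hf⟩
  · have weak : (IsCliqueSubgraph B.1 ∨ IsBigBicliqueSubgraph B.1) →
        ∃ a b : G.edgeSet → ℝ, ∀ e f, blk e = B → blk f = B → e ≠ f → Q e f = a e + b f := by
      intro hB
      obtain ⟨-, a, b, h⟩ := hb B.1 B.2 hB
      refine ⟨fun e => if he : (e : Sym2 V) ∈ B.1.edgeSet then a ⟨e, he⟩ else 0,
        fun e => if he : (e : Sym2 V) ∈ B.1.edgeSet then b ⟨e, he⟩ else 0,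
        fun e f he hf hef => ?_⟩
      rw [hiff] at he hf
      simp only [he, hf, dif_pos]
      exact h ⟨e, he⟩ ⟨f, hf⟩ fun h => hef (Subtype.ext (Subtype.mk.inj h))
    rcases hnice B.1 B.2 with h | h | h
    · exact Or.inl (weak (Or.inl h))
    · obtain ⟨h1, h2⟩ := h.ncard_eq
      refine Or.inr ⟨by omega, ?_⟩
      have := hcard Set.univ B Finset.univ (by simp)
      rw [Set.univ_inter] at this
      rw [this]
      omega
    · exact Or.inl (weak (Or.inr h))

end Converse

/-! ### Weak sum matrices from cross differences. -/

section WeakSum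

/-- A symmetric matrix all of whose cross differences off the diagonal vanish is a weak sum
matrix. -/
theorem isWeakSumMatrix_of_crossDiff {ι : Type*} {H : Matrix ι ι ℝ} (hH : H.IsSymm)
    (h : ∀ e e' f f', e ≠ e' → f ≠ f' → e ≠ f → e ≠ f' → e' ≠ f → e' ≠ f' →
      H e f - H e f' - H e' f + H e' f' = 0) : IsWeakSumMatrix H := by
  by_cases h3 : ∃ p q r : ι, p ≠ q ∧ p ≠ r ∧ q ≠ r
  · have hother : ∀ e : ι, ∃ f g, e ≠ f ∧ e ≠ g ∧ f ≠ g := by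
      intro e
      obtain ⟨p, q, r, hpq, hpr, hqr⟩ := h3
      by_cases hp : e = p
      · exact ⟨q, r, hp ▸ hpq, hp ▸ hpr, hqr⟩
      · by_cases hq : e = q
        · exact ⟨p, r, hp, hq ▸ hqr, hpr⟩
        · exact ⟨p, q, hp, hq, hpq⟩
    choose s t hs ht hst using hother
    -- If `H i j = a i + a j` off the diagonal, then `H e f + H e g - H f g = 2 * a e`. This
    -- expression is shown to be independent of `f` and `g`, one argument at a time, and half of it
    -- is the required vector.
    have one : ∀ e f g g', e ≠ f → e ≠ g → e ≠ g' → f ≠ g → f ≠ g' →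
        H e f + H e g - H f g = H e f + H e g' - H f g' := by
      intro e f g g' h1 h2 h3 h4 h5
      by_cases hg : g = g'
      · rw [hg]
      · have := h e f g g' h1 hg h2 h3 h4 h5
        linarith
    have flip : ∀ e f g, H e f + H e g - H f g = H e g + H e f - H g f := fun e f g => by
      rw [hH.apply f g]; ring
    have well : ∀ e f g f' g', e ≠ f → e ≠ g → f ≠ g → e ≠ f' → e ≠ g' → f' ≠ g' →
        H e f + H e g - H f g = H e f' + H e g' - H f' g' := by
      intro e f g f' g' h1 h2 h3 h4 h5 h6
      -- Replacing `f` by `f'` before replacing `g` passes through the pair `f'`, `g`, which must be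
      -- distinct; if they coincide, a single replacement suffices.
      by_cases hgf : g = f'
      · subst hgf
        rw [flip e f g]
        exact one e g f g' h2 h1 h5 h3.symm h6
      · rw [flip e f g, one e g f f' h2 h1 h4 h3.symm hgf, flip e g f']
        exact one e f' g g' h4 h2 h5 (Ne.symm hgf) h6
    refine ⟨fun e => (H e (s e) + H e (t e) - H (s e) (t e)) / 2,
      fun e => (H e (s e) + H e (t e) - H (s e) (t e)) / 2, fun e f hef => ?_⟩
    obtain ⟨g, hge, hgf⟩ : ∃ g, e ≠ g ∧ f ≠ g := by
      by_cases hf : f = s e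
      · exact ⟨t e, ht e, hf ▸ hst e⟩
      · exact ⟨s e, hs e, hf⟩
    simp only
    rw [well e (s e) (t e) f g (hs e) (ht e) (hst e) hef hge hgf,
      well f (s f) (t f) e g (hs f) (ht f) (hst f) hef.symm hgf hge, hH.apply e f]
    ring
  · by_cases h2 : ∃ p q : ι, p ≠ q
    · obtain ⟨p, q, hpq⟩ := h2
      refine ⟨fun _ => H p q, 0, fun i j hij => ?_⟩
      have hcov : ∀ i, i = p ∨ i = q := by
        intro i
        by_contra hi
        push Not at hi
        exact h3 ⟨p, q, i, hpq, hi.1.symm, hi.2.symm⟩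
      rcases hcov i with rfl | rfl <;> rcases hcov j with rfl | rfl
      · exact (hij rfl).elim
      · simp
      · simp [hH.apply i j]
      · exact (hij rfl).elim
    · exact ⟨0, 0, fun i j hij => (h2 ⟨i, j, hij⟩).elim⟩

end WeakSum

/-! ### Cross differences from colourings with connected classes. -/

section Colours

variable {V : Type*} [Fintype V] {G : SimpleGraph V} {Q : Matrix G.edgeSet G.edgeSet ℝ}

theorem crossDiff_trans_left {a b c d d' : Sym2 V} (h : crossDiff Q a b d d' = 0)
    (h' : crossDiff Q b c d d' = 0) : crossDiff Q a c d d' = 0 := by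
  simp only [crossDiff] at *
  linarith

theorem crossDiff_trans_right {a b c d d' : Sym2 V} (h : crossDiff Q d d' a b = 0)
    (h' : crossDiff Q d d' b c = 0) : crossDiff Q d d' a c = 0 := by
  simp only [crossDiff] at *
  linarith

theorem crossDiff_symm_left {a b d d' : Sym2 V} (h : crossDiff Q a b d d' = 0) :
    crossDiff Q b a d d' = 0 := by
  simp only [crossDiff] at *
  linarith

/-- The edges of `G` whose ends have the same colour. -/
def mono (G : SimpleGraph V) (c : V → ℕ) : SimpleGraph V where
  Adj a b := G.Adj a b ∧ c a = c b
  symm := ⟨fun _ _ h => ⟨h.1.symm, h.2.symm⟩⟩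
  loopless := ⟨fun _ h => h.1.ne rfl⟩

/-- If the colour classes `1`, `2`, `3` are connected, cross differences between a pair of edges
joining the classes `1` and `2` and a pair of edges joining them to the class `3` vanish. -/
theorem crossDiff_eq_zero_of_colour (hG : G.Connected) (hQ : Q.IsSymm) (hlin : IsLinearizable Q)
    (c : V → ℕ) (hc : ∀ u v, c u = c v → c u ≠ 0 → (mono G c).Reachable u v)
    {x y x' y' z w z' w' : V} (hxy : G.Adj x y) (hxy' : G.Adj x' y') (hzw : G.Adj z w)
    (hzw' : G.Adj z' w') (hx : c x = 1) (hy : c y = 2) (hx' : c x' = 1) (hy' : c y' = 2)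
    (hz : c z = 1 ∨ c z = 2) (hz' : c z' = 1 ∨ c z' = 2) (hw : c w = 3) (hw' : c w' = 3) :
    crossDiff Q s(x, y) s(x', y') s(z, w) s(z', w') = 0 := by
  -- Adding `xy` merges the classes `1` and `2`, after which `zw` and `z'w'` both join this
  -- component to the class `3`. The colour `0` is for the other vertices, of which no connectedness
  -- is required.
  have toX : ∀ t, c t = 1 ∨ c t = 2 → (mono G c ⊔ edge x y).Reachable t x := by
    rintro t (ht | ht)
    · exact (hc t x (by omega) (by omega)).mono le_sup_left
    · exact ((hc t y (by omega) (by omega)).mono le_sup_left).trans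
        (reachable_sup_edge _ _ _).symm
  refine crossDiff_eq_zero_of_reachable hG hQ hlin (R := mono G c) (fun _ _ h => h.1) hxy hxy'
    hzw hzw' (fun h => ?_) (hc _ _ (by omega) (by omega)) (hc _ _ (by omega) (by omega))
    (fun h => ?_) ((toX z hz).trans (toX z' hz').symm)
    ((hc _ _ (by omega) (by omega)).mono le_sup_left)
  · have := eq_of_reachable (H := mono G c) c (fun _ _ h => h.2) h
    omega
  · have := eq_of_reachable (fun t => decide (c t = 3)) (fun a b hab => ?_) h
    · rw [decide_eq_decide] at this; omega
    · rcases hab with hab | hab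
      · rw [hab.2]
      · rw [edge_adj] at hab
        rcases hab.1 with ⟨rfl, rfl⟩ | ⟨rfl, rfl⟩ <;> simp [hx, hy]

end Colours

/-! ### Cross differences in a clique. -/

section Clique

variable {V : Type*} [Fintype V] {G : SimpleGraph V} {Q : Matrix G.edgeSet G.edgeSet ℝ}

theorem sym2_eq_of_mem_triple {a b c u v : V} (huv : u ≠ v) (hu : u = a ∨ u = b ∨ u = c)
    (hv : v = a ∨ v = b ∨ v = c) (h1 : s(u, v) ≠ s(a, b)) (h2 : s(u, v) ≠ s(a, c)) :
    s(u, v) = s(b, c) := by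
  simp only [ne_eq, Sym2.eq_iff] at h1 h2 ⊢
  grind

-- All edges other than `ab`, `ac` are compared with one edge `ax`, where `x` is a fourth vertex.
-- The colouring depends on how many ends of `uv` lie in the triangle `abc`.
open Classical in
theorem crossDiff_clique_pivot (hG : G.Connected) (hQ : Q.IsSymm) (hlin : IsLinearizable Q)
    {S : Set V} (hS : ∀ u ∈ S, ∀ v ∈ S, u ≠ v → G.Adj u v) {a b c x : V} (ha : a ∈ S)
    (hb : b ∈ S) (hcS : c ∈ S) (hx : x ∈ S) (hab : a ≠ b) (hac : a ≠ c) (hbc : b ≠ c)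
    (hxa : x ≠ a) (hxb : x ≠ b) (hxc : x ≠ c) {u v : V} (hu : u ∈ S) (hv : v ∈ S) (huv : u ≠ v)
    (h1 : s(u, v) ≠ s(a, b)) (h2 : s(u, v) ≠ s(a, c)) :
    crossDiff Q s(u, v) s(a, x) s(a, b) s(a, c) = 0 := by
  have conn : ∀ k : V → ℕ, (∀ t, k t ≠ 0 → t ∈ S) →
      ∀ u v, k u = k v → k u ≠ 0 → (mono G k).Reachable u v := by
    intro k hk u v huv hu
    by_cases h : u = v
    · rw [h]
    · exact Adj.reachable ⟨hS u (hk u hu) v (hk v (huv ▸ hu)) h, huv⟩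
  -- One end in the triangle: the classes are `{a}`, `{b, c}` and the rest of the clique.
  have out : ∀ p ∈ S, ∀ y ∈ S, (p = a ∨ p = b ∨ p = c) → y ≠ a → y ≠ b → y ≠ c →
      crossDiff Q s(p, y) s(a, x) s(a, b) s(a, c) = 0 := by
    intro p hp y hy hpc hya hyb hyc
    rw [crossDiff_swap hQ]
    refine crossDiff_eq_zero_of_colour hG hQ hlin
      (fun t => if t = a then 1 else if t = b ∨ t = c then 2 else if t ∈ S then 3 else 0)
      (conn _ ?_) (hS a ha b hb hab) (hS a ha c hcS hac) (hS p hp y hy ?_)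
      (hS a ha x hx hxa.symm) ?_ ?_ ?_ ?_ ?_ ?_ ?_ ?_
    · intro t ht
      by_contra hts
      simp only [hts] at ht
      grind
    all_goals grind
  -- No end in the triangle: `yz` is compared with `az`, with `z` alone in class `3` and `{b, c}` as
  -- class `2`.
  have inner : ∀ y ∈ S, ∀ z ∈ S, y ≠ z → y ≠ a → y ≠ b → y ≠ c → z ≠ a → z ≠ b → z ≠ c →
      crossDiff Q s(y, z) s(a, x) s(a, b) s(a, c) = 0 := by
    intro y hy z hz hyz hya hyb hyc hza hzb hzc
    refine crossDiff_trans_left (b := s(a, z)) ?_ (out a ha z hz (Or.inl rfl) hza hzb hzc)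
    rw [crossDiff_swap hQ]
    refine crossDiff_eq_zero_of_colour hG hQ hlin
      (fun t => if t = z then 3 else if t = b ∨ t = c then 2 else if t ∈ S then 1 else 0)
      (conn _ ?_) (hS a ha b hb hab) (hS a ha c hcS hac) (hS y hy z hz hyz)
      (hS a ha z hz hza.symm) ?_ ?_ ?_ ?_ ?_ ?_ ?_ ?_
    · intro t ht
      by_contra hts
      simp only [hts] at ht
      grind
    all_goals grind
  -- The third edge of the triangle: `bc` and `xc` join the class `2`, which is `{c}`, to the class
  -- `1`, while `ba` and `ca` lead to the class `{a}`.
  have base : crossDiff Q s(b, c) s(a, x) s(a, b) s(a, c) = 0 := by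
    refine crossDiff_trans_left (b := s(x, c)) ?_ ?_
    · rw [Sym2.eq_swap (a := a) (b := b), Sym2.eq_swap (a := a) (b := c)]
      refine crossDiff_eq_zero_of_colour hG hQ hlin
        (fun t => if t = a then 3 else if t = c then 2 else if t ∈ S then 1 else 0)
        (conn _ ?_) (hS b hb c hcS hbc) (hS x hx c hcS hxc) (hS b hb a ha hab.symm)
        (hS c hcS a ha hac.symm) ?_ ?_ ?_ ?_ ?_ ?_ ?_ ?_
      · intro t ht
        by_contra hts
        simp only [hts] at ht
        grind
      all_goals grind
    · rw [Sym2.eq_swap]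
      exact out c hcS x hx (Or.inr (Or.inr rfl)) hxa hxb hxc
  by_cases hu' : u = a ∨ u = b ∨ u = c
  · by_cases hv' : v = a ∨ v = b ∨ v = c
    · rw [sym2_eq_of_mem_triple huv hu' hv' h1 h2]
      exact base
    · push Not at hv'
      exact out u hu v hv hu' hv'.1 hv'.2.1 hv'.2.2
  · push Not at hu'
    by_cases hv' : v = a ∨ v = b ∨ v = c
    · rw [Sym2.eq_swap]
      exact out v hv u hu hv' hu'.1 hu'.2.1 hu'.2.2
    · push Not at hv'
      exact inner u hu v hv huv hu'.1 hu'.2.1 hu'.2.2 hv'.1 hv'.2.1 hv'.2.2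

theorem crossDiff_clique_adjacent (hG : G.Connected) (hQ : Q.IsSymm) (hlin : IsLinearizable Q)
    {S : Set V} (hS : ∀ u ∈ S, ∀ v ∈ S, u ≠ v → G.Adj u v) {a b c : V} (ha : a ∈ S)
    (hb : b ∈ S) (hcS : c ∈ S) (hab : a ≠ b) (hac : a ≠ c) {u v u' v' : V}
    (hu : u ∈ S) (hv : v ∈ S) (hu' : u' ∈ S) (hv' : v' ∈ S) (huv : u ≠ v) (huv' : u' ≠ v')
    (h1 : s(u, v) ≠ s(a, b)) (h2 : s(u, v) ≠ s(a, c)) (h3 : s(u', v') ≠ s(a, b))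
    (h4 : s(u', v') ≠ s(a, c)) : crossDiff Q s(u, v) s(u', v') s(a, b) s(a, c) = 0 := by
  by_cases hbc : b = c
  · subst hbc; simp [crossDiff]
  by_cases he : s(u, v) = s(u', v')
  · rw [he]; simp [crossDiff]
  -- Without a fourth vertex the clique is the triangle `abc`, and `bc` is its only edge besides
  -- `ab` and `ac`.
  obtain ⟨x, hx, hxa, hxb, hxc⟩ : ∃ x ∈ S, x ≠ a ∧ x ≠ b ∧ x ≠ c := by
    by_contra hcon
    push Not at hcon
    have cov : ∀ t ∈ S, t = a ∨ t = b ∨ t = c := fun t ht => by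
      have := hcon t ht
      tauto
    exact he ((sym2_eq_of_mem_triple huv (cov u hu) (cov v hv) h1 h2).trans
      (sym2_eq_of_mem_triple huv' (cov u' hu') (cov v' hv') h3 h4).symm)
  exact crossDiff_trans_left
    (crossDiff_clique_pivot hG hQ hlin hS ha hb hcS hx hab hac hbc hxa hxb hxc hu hv huv h1 h2)
    (crossDiff_symm_left (crossDiff_clique_pivot hG hQ hlin hS ha hb hcS hx hab hac hbc hxa hxb
      hxc hu' hv' huv' h3 h4))

/-- Disjoint edges `ab` and `cd` are linked by an edge adjacent to both. Of the three candidates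
`ac`, `ad`, `bc` at most two coincide with `uv` or `u'v'`. -/
theorem crossDiff_clique (hG : G.Connected) (hQ : Q.IsSymm) (hlin : IsLinearizable Q)
    {S : Set V} (hS : ∀ u ∈ S, ∀ v ∈ S, u ≠ v → G.Adj u v) {a b c d u v u' v' : V} (ha : a ∈ S)
    (hb : b ∈ S) (hcS : c ∈ S) (hd : d ∈ S) (hab : a ≠ b) (hcd : c ≠ d)
    (hu : u ∈ S) (hv : v ∈ S) (hu' : u' ∈ S) (hv' : v' ∈ S) (huv : u ≠ v) (huv' : u' ≠ v')
    (h1 : s(u, v) ≠ s(a, b)) (h2 : s(u, v) ≠ s(c, d)) (h3 : s(u', v') ≠ s(a, b))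
    (h4 : s(u', v') ≠ s(c, d)) : crossDiff Q s(u, v) s(u', v') s(a, b) s(c, d) = 0 := by
  have adj : ∀ {a b c : V}, a ∈ S → b ∈ S → c ∈ S → a ≠ b → a ≠ c → s(u, v) ≠ s(a, b) →
      s(u, v) ≠ s(a, c) → s(u', v') ≠ s(a, b) → s(u', v') ≠ s(a, c) →
      crossDiff Q s(u, v) s(u', v') s(a, b) s(a, c) = 0 :=
    fun ha hb hc hab hac h1 h2 h3 h4 => crossDiff_clique_adjacent hG hQ hlin hS ha hb hc hab hac
      hu hv hu' hv' huv huv' h1 h2 h3 h4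
  have via : ∀ {a b c d : V}, a ∈ S → b ∈ S → c ∈ S → d ∈ S → a ≠ b → c ≠ d → a ≠ c →
      s(u, v) ≠ s(a, b) → s(u, v) ≠ s(c, d) → s(u', v') ≠ s(a, b) → s(u', v') ≠ s(c, d) →
      s(u, v) ≠ s(a, c) → s(u', v') ≠ s(a, c) →
      crossDiff Q s(u, v) s(u', v') s(a, b) s(c, d) = 0 := by
    intro a b c d ha hb hc hd hab hcd hac h1 h2 h3 h4 h5 h6
    refine crossDiff_trans_right (adj ha hb hc hab hac h1 h5 h3 h6) ?_
    rw [Sym2.eq_swap (a := a)] at h5 h6 ⊢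
    exact adj hc ha hd hac.symm hcd h5 h2 h6 h4
  by_cases hac : a = c
  · subst hac
    exact adj ha hb hd hab hcd h1 h2 h3 h4
  by_cases had : a = d
  · subst had
    rw [Sym2.eq_swap (a := c)] at h2 h4 ⊢
    exact adj ha hb hcS hab hac h1 h2 h3 h4
  by_cases hbc : b = c
  · subst hbc
    rw [Sym2.eq_swap (a := a)] at h1 h3 ⊢
    exact adj hb ha hd hab.symm hcd h1 h2 h3 h4
  by_cases h5 : s(u, v) ≠ s(a, c) ∧ s(u', v') ≠ s(a, c)
  · exact via ha hb hcS hd hab hcd hac h1 h2 h3 h4 h5.1 h5.2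
  by_cases h6 : s(u, v) ≠ s(a, d) ∧ s(u', v') ≠ s(a, d)
  · rw [Sym2.eq_swap (a := c)] at h2 h4 ⊢
    exact via ha hb hd hcS hab hcd.symm had h1 h2 h3 h4 h6.1 h6.2
  have h7 : s(u, v) ≠ s(b, c) ∧ s(u', v') ≠ s(b, c) := by
    simp only [ne_eq, Sym2.eq_iff] at h5 h6 ⊢
    grind
  rw [Sym2.eq_swap (a := a)] at h1 h3 ⊢
  exact via hb ha hcS hd hab.symm hcd hbc h1 h2 h3 h4 h7.1 h7.2

end Clique

/-! ### Cross differences in a biclique. -/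

section Biclique

variable {V : Type*} [Fintype V] {G : SimpleGraph V} {Q : Matrix G.edgeSet G.edgeSet ℝ}

/-- `X` and `Y` are the sides of a biclique of `G` with at least three vertices on each side. -/
structure IsBigBiclique (G : SimpleGraph V) (X Y : Set V) : Prop where
  adj : ∀ x ∈ X, ∀ y ∈ Y, G.Adj x y
  left : ∀ p q, ∃ r ∈ X, r ≠ p ∧ r ≠ q
  right : ∀ p q, ∃ r ∈ Y, r ≠ p ∧ r ≠ q
  disj : ∀ t ∈ X, t ∉ Y

theorem IsBigBiclique.symm {X Y : Set V} (h : IsBigBiclique G X Y) : IsBigBiclique G Y X :=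
  ⟨fun y hy x hx => (h.adj x hx y hy).symm, h.right, h.left, fun t hy hx => h.disj t hx hy⟩

theorem IsBigBiclique.ne {X Y : Set V} (h : IsBigBiclique G X Y) {x y : V} (hx : x ∈ X)
    (hy : y ∈ Y) : x ≠ y := fun hxy => h.disj x hx (hxy ▸ hy)

-- The classes are `{a}`, the star `{y, y', x₁}` with a suitable centre `x₁ ∈ X`, and the rest of
-- the biclique. Then `ay`, `ay'` join the classes `1` and `2`, while `ay₀` and `xz` lead into the
-- class `3`.
open Classical in
theorem crossDiff_biclique_pivot (hG : G.Connected) (hQ : Q.IsSymm) (hlin : IsLinearizable Q)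
    {X Y : Set V} (h : IsBigBiclique G X Y) {a y y' y₀ x z : V} (ha : a ∈ X) (hy : y ∈ Y)
    (hy' : y' ∈ Y) (hy₀ : y₀ ∈ Y) (h₀ : y₀ ≠ y) (h₀' : y₀ ≠ y') (hx : x ∈ X)
    (hz : z ∈ Y) (hne : ¬ (x = a ∧ (z = y ∨ z = y'))) :
    crossDiff Q s(x, z) s(a, y₀) s(a, y) s(a, y') = 0 := by
  -- If `z` is `y` or `y'`, then `x` has to stay in the class `3`, so `x₁ ≠ x`; otherwise `z` is in
  -- the class `3` and `x` has to be `a` or `x₁`.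
  obtain ⟨x₁, hx₁, hx₁a, hzx₁⟩ : ∃ x₁ ∈ X, x₁ ≠ a ∧
      ((z = y ∨ z = y') ∧ x ≠ x₁ ∨ ¬ (z = y ∨ z = y') ∧ (x = a ∨ x = x₁)) := by
    by_cases hzy : z = y ∨ z = y'
    · obtain ⟨r, hr, h1, h2⟩ := h.left a x
      exact ⟨r, hr, h1, Or.inl ⟨hzy, h2.symm⟩⟩
    · by_cases hxa : x = a
      · obtain ⟨r, hr, h1, -⟩ := h.left a a
        exact ⟨r, hr, h1, Or.inr ⟨hzy, Or.inl hxa⟩⟩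
      · exact ⟨x, hx, hxa, Or.inr ⟨hzy, Or.inr rfl⟩⟩
  -- Third vertices on both sides, `x₂` and `y₀`, remain in the class `3` and keep it connected;
  -- this is the use of the size of the parts.
  obtain ⟨x₂, hx₂, hx₂a, hx₂x₁⟩ := h.left a x₁
  obtain ⟨c, hc⟩ : ∃ c : V → ℕ, c = fun t => if t = a then 1 else
    if t = y ∨ t = y' ∨ t = x₁ then 2 else if t ∈ X ∨ t ∈ Y then 3 else 0 := ⟨_, rfl⟩
  have c1 : ∀ t, c t = 1 ↔ t = a := by
    intro t; rw [hc]; simp only; split_ifs <;> simp_all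
  have hay : a ≠ y := h.ne ha hy
  have hay' : a ≠ y' := h.ne ha hy'
  have c2 : ∀ t, c t = 2 ↔ t = y ∨ t = y' ∨ t = x₁ := by
    intro t; rw [hc]; simp only; split_ifs with h1 h2 h3
    · subst h1; simp [hay, hay', hx₁a.symm]
    all_goals simp [h2]
  have c3X : ∀ t ∈ X, t ≠ a → t ≠ x₁ → c t = 3 := by
    intro t ht h1 h2
    rw [hc]; simp [h1, h2, h.ne ht hy, h.ne ht hy', ht]
  have c3Y : ∀ t ∈ Y, t ≠ y → t ≠ y' → c t = 3 := by
    intro t ht h1 h2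
    rw [hc]; simp [h1, h2, (h.ne ha ht).symm, (h.ne hx₁ ht).symm, ht]
  have c3 : ∀ t, c t = 3 → (t ∈ X ∨ t ∈ Y) := by
    intro t ht
    by_contra hn
    rw [hc] at ht
    simp only [hn, if_false] at ht
    split_ifs at ht <;> omega
  have cle : ∀ t, c t ≤ 3 := by
    intro t; rw [hc]; simp only; split_ifs <;> simp
  have e2 : ∀ t, c t = 2 → (mono G c).Reachable t x₁ := by
    intro t ht
    rcases (c2 t).1 ht with rfl | rfl | rfl
    · exact Adj.reachable ⟨(h.adj x₁ hx₁ _ hy).symm, ht.trans ((c2 x₁).2 (by simp)).symm⟩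
    · exact Adj.reachable ⟨(h.adj x₁ hx₁ _ hy').symm, ht.trans ((c2 x₁).2 (by simp)).symm⟩
    · exact Reachable.refl _
  have e3Y : ∀ t ∈ Y, c t = 3 → (mono G c).Reachable t x₂ := fun t ht h3 =>
    Adj.reachable ⟨(h.adj x₂ hx₂ t ht).symm, h3.trans (c3X x₂ hx₂ hx₂a hx₂x₁).symm⟩
  have e3 : ∀ t, c t = 3 → (mono G c).Reachable t x₂ := by
    intro t ht
    have h3 := c3Y y₀ hy₀ h₀ h₀'
    rcases c3 t ht with htX | htY
    · exact (Adj.reachable (show (mono G c).Adj t y₀ from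
        ⟨h.adj t htX y₀ hy₀, ht.trans h3.symm⟩)).trans (e3Y y₀ hy₀ h3)
    · exact e3Y t htY ht
  have conn : ∀ u v, c u = c v → c u ≠ 0 → (mono G c).Reachable u v := by
    intro u v huv hu
    have hle := cle u
    obtain h' | h' | h' : c u = 1 ∨ c u = 2 ∨ c u = 3 := by omega
    · rw [(c1 u).1 h', (c1 v).1 (huv ▸ h')]
    · exact (e2 u h').trans (e2 v (huv ▸ h')).symm
    · exact (e3 u h').trans (e3 v (huv ▸ h')).symm
  rw [crossDiff_swap hQ]
  rcases hzx₁ with ⟨hzy, hxx₁⟩ | ⟨hzy, hxx₁⟩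
  · rw [Sym2.eq_swap (a := x)]
    refine crossDiff_eq_zero_of_colour hG hQ hlin c conn (h.adj a ha y hy) (h.adj a ha y' hy')
      (h.adj x hx z hz).symm (h.adj a ha y₀ hy₀) ((c1 a).2 rfl) ((c2 y).2 (by simp))
      ((c1 a).2 rfl) ((c2 y').2 (by simp)) (Or.inr ((c2 z).2 (by tauto)))
      (Or.inl ((c1 a).2 rfl)) (c3X x hx (by tauto) hxx₁) (c3Y y₀ hy₀ h₀ h₀')
  · push Not at hzy
    refine crossDiff_eq_zero_of_colour hG hQ hlin c conn (h.adj a ha y hy) (h.adj a ha y' hy')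
      (h.adj x hx z hz) (h.adj a ha y₀ hy₀) ((c1 a).2 rfl) ((c2 y).2 (by simp))
      ((c1 a).2 rfl) ((c2 y').2 (by simp)) ?_
      (Or.inl ((c1 a).2 rfl)) (c3Y z hz hzy.1 hzy.2) (c3Y y₀ hy₀ h₀ h₀')
    rcases hxx₁ with h' | h'
    exacts [Or.inl ((c1 x).2 h'), Or.inr ((c2 x).2 (by simp [h']))]

theorem crossDiff_biclique_adjacent (hG : G.Connected) (hQ : Q.IsSymm) (hlin : IsLinearizable Q)
    {X Y : Set V} (h : IsBigBiclique G X Y) {a y y' x z x' z' : V} (ha : a ∈ X) (hy : y ∈ Y)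
    (hy' : y' ∈ Y) (hx : x ∈ X) (hz : z ∈ Y) (hx' : x' ∈ X) (hz' : z' ∈ Y)
    (h1 : ¬ (x = a ∧ (z = y ∨ z = y'))) (h2 : ¬ (x' = a ∧ (z' = y ∨ z' = y'))) :
    crossDiff Q s(x, z) s(x', z') s(a, y) s(a, y') = 0 := by
  obtain ⟨y₀, hy₀, h₀, h₀'⟩ := h.right y y'
  exact crossDiff_trans_left
    (crossDiff_biclique_pivot hG hQ hlin h ha hy hy' hy₀ h₀ h₀' hx hz h1)
    (crossDiff_symm_left (crossDiff_biclique_pivot hG hQ hlin h ha hy hy' hy₀ h₀ h₀' hx' hz' h2))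

/-- The edges `ay` and `bw` are linked through `aw` or `by`, or, if these are both taken by `xz` and
`x'z'`, through `av` and `bv` with a third vertex `v`. -/
theorem crossDiff_biclique (hG : G.Connected) (hQ : Q.IsSymm) (hlin : IsLinearizable Q)
    {X Y : Set V} (h : IsBigBiclique G X Y) {a y b w x z x' z' : V} (ha : a ∈ X) (hy : y ∈ Y)
    (hb : b ∈ X) (hw : w ∈ Y) (hx : x ∈ X) (hz : z ∈ Y) (hx' : x' ∈ X) (hz' : z' ∈ Y)
    (h1 : ¬ (x = a ∧ z = y)) (h2 : ¬ (x = b ∧ z = w)) (h3 : ¬ (x' = a ∧ z' = y))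
    (h4 : ¬ (x' = b ∧ z' = w)) : crossDiff Q s(x, z) s(x', z') s(a, y) s(b, w) = 0 := by
  have adjX : ∀ {a y y'}, a ∈ X → y ∈ Y → y' ∈ Y → ¬ (x = a ∧ (z = y ∨ z = y')) →
      ¬ (x' = a ∧ (z' = y ∨ z' = y')) → crossDiff Q s(x, z) s(x', z') s(a, y) s(a, y') = 0 :=
    fun ha hy hy' h1 h2 => crossDiff_biclique_adjacent hG hQ hlin h ha hy hy' hx hz hx' hz' h1 h2
  have adjY : ∀ {a b y}, a ∈ X → b ∈ X → y ∈ Y → ¬ (z = y ∧ (x = a ∨ x = b)) →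
      ¬ (z' = y ∧ (x' = a ∨ x' = b)) → crossDiff Q s(x, z) s(x', z') s(a, y) s(b, y) = 0 := by
    intro a b y ha hb hy h1 h2
    have := crossDiff_biclique_adjacent hG hQ hlin h.symm hy ha hb hz hx hz' hx' h1 h2
    rwa [Sym2.eq_swap (a := z), Sym2.eq_swap (a := z'), Sym2.eq_swap (a := y) (b := a),
      Sym2.eq_swap (a := y) (b := b)] at this
  by_cases h5 : ¬ (x = a ∧ z = w) ∧ ¬ (x' = a ∧ z' = w)
  · exact crossDiff_trans_right (adjX ha hy hw (by tauto) (by tauto))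
      (adjY ha hb hw (by tauto) (by tauto))
  by_cases h6 : ¬ (x = b ∧ z = y) ∧ ¬ (x' = b ∧ z' = y)
  · exact crossDiff_trans_right (adjY ha hb hy (by tauto) (by tauto))
      (adjX hb hy hw (by tauto) (by tauto))
  obtain ⟨v, hv, hvy, hvw⟩ := h.right y w
  have hv' : (x = a ∨ x = b) → z ≠ v := by
    by_cases hab : x' = x <;> grind
  have hv'' : (x' = a ∨ x' = b) → z' ≠ v := by grind
  exact crossDiff_trans_right (crossDiff_trans_right (adjX ha hy hv (by grind) (by grind))
    (adjY ha hb hv (by grind) (by grind))) (adjX hb hv hw (by grind) (by grind))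

end Biclique

/-! ### Necessity of (b), and the characterization. -/

section Blocks

variable {V : Type*} [Fintype V] {G : SimpleGraph V} {Q : Matrix G.edgeSet G.edgeSet ℝ}

theorem isSymmWeakSumMatrix_of_crossDiff (hQ : Q.IsSymm) {B : G.Subgraph}
    (h : ∀ e ∈ B.edgeSet, ∀ e' ∈ B.edgeSet, ∀ f ∈ B.edgeSet, ∀ f' ∈ B.edgeSet, e ≠ f → e ≠ f' →
      e' ≠ f → e' ≠ f' → crossDiff Q e e' f f' = 0) : IsSymmWeakSumMatrix (subMatrix Q B B) := by
  have hsymm : (subMatrix Q B B).IsSymm := hQ.submatrix _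
  have hsub : ∀ e f : B.edgeSet, subMatrix Q B B e f = entry Q e f := fun e f =>
    (entry_eq Q (B.edgeSet_subset e.2) (B.edgeSet_subset f.2)).symm
  refine ⟨hsymm, isWeakSumMatrix_of_crossDiff hsymm fun e e' f f' _ _ h1 h2 h3 h4 => ?_⟩
  simp only [hsub]
  exact h e e.2 e' e'.2 f f.2 f' f'.2 (fun h => h1 (Subtype.ext h))
    (fun h => h2 (Subtype.ext h)) (fun h => h3 (Subtype.ext h)) (fun h => h4 (Subtype.ext h))

theorem isSymmWeakSumMatrix_of_isClique (hG : G.Connected) (hQ : Q.IsSymm)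
    (hlin : IsLinearizable Q) {B : G.Subgraph} (hB : IsCliqueSubgraph B) :
    IsSymmWeakSumMatrix (subMatrix Q B B) := by
  have hadj : ∀ u ∈ B.verts, ∀ v ∈ B.verts, u ≠ v → G.Adj u v := by
    intro u hu v hv huv
    have : B.coe.Adj ⟨u, hu⟩ ⟨v, hv⟩ := by
      rw [show B.coe = ⊤ from hB]
      exact fun h => huv (Subtype.mk.inj h)
    exact B.adj_sub this
  refine isSymmWeakSumMatrix_of_crossDiff hQ fun e he e' he' f hf f' hf' h1 h2 h3 h4 => ?_
  induction e with | _ u v =>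
  induction e' with | _ u' v' =>
  induction f with | _ a b =>
  induction f' with | _ c d =>
  rw [Subgraph.mem_edgeSet] at he he' hf hf'
  exact crossDiff_clique hG hQ hlin hadj (B.edge_vert hf) (B.edge_vert hf.symm)
    (B.edge_vert hf') (B.edge_vert hf'.symm) hf.ne hf'.ne (B.edge_vert he)
    (B.edge_vert he.symm) (B.edge_vert he') (B.edge_vert he'.symm) he.ne he'.ne h1 h2 h3 h4

theorem IsBigBicliqueSubgraph.exists_sides {B : G.Subgraph} (hB : IsBigBicliqueSubgraph B) :
    ∃ X Y : Set V, IsBigBiclique G X Y ∧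
      ∀ e ∈ B.edgeSet, ∃ x ∈ X, ∃ y ∈ Y, e = s(x, y) := by
  obtain ⟨p, q, hp, hq, ⟨φ⟩⟩ := hB
  have third : ∀ {r : ℕ} (f : Fin r → V), Function.Injective f → 3 ≤ r →
      ∀ s t, ∃ u ∈ Set.range f, u ≠ s ∧ u ≠ t := by
    classical
    intro r f hf hr s t
    have hcard : ({s, t} : Finset V).card < (Finset.univ.image f).card := by
      rw [Finset.card_image_of_injective _ hf, Finset.card_univ, Fintype.card_fin]
      exact lt_of_le_of_lt Finset.card_le_two hr
    obtain ⟨u, hu, hu'⟩ := Finset.exists_mem_notMem_of_card_lt_card hcard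
    refine ⟨u, by simpa using hu, ?_⟩
    simpa using hu'
  obtain ⟨f, hf⟩ : ∃ f : Fin p ⊕ Fin q → V, ∀ s, f s = (φ.symm s : V) := ⟨_, fun _ => rfl⟩
  have hinj : Function.Injective f := fun s t h => by
    rw [hf, hf] at h
    exact φ.symm.injective (Subtype.ext h)
  have hadj : ∀ s t, B.Adj (f s) (f t) ↔ (completeBipartiteGraph (Fin p) (Fin q)).Adj s t := by
    intro s t
    rw [hf, hf, ← φ.symm.map_adj_iff]
    rfl
  refine ⟨Set.range (f ∘ Sum.inl), Set.range (f ∘ Sum.inr), ⟨?_, ?_, ?_, ?_⟩, ?_⟩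
  · rintro _ ⟨i, rfl⟩ _ ⟨j, rfl⟩
    exact B.adj_sub ((hadj _ _).2 (by simp))
  · exact third _ (hinj.comp Sum.inl_injective) hp
  · exact third _ (hinj.comp Sum.inr_injective) hq
  · rintro _ ⟨i, rfl⟩ ⟨j, hj⟩
    exact absurd (hinj hj) (by simp)
  · intro e he
    induction e with | _ u v =>
    rw [Subgraph.mem_edgeSet] at he
    have hu : f (φ ⟨u, B.edge_vert he⟩) = u := by rw [hf]; simp
    have hv : f (φ ⟨v, B.edge_vert he.symm⟩) = v := by rw [hf]; simp
    generalize φ ⟨u, B.edge_vert he⟩ = s at hu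
    generalize φ ⟨v, B.edge_vert he.symm⟩ = t at hv
    rw [← hu, ← hv, hadj] at he
    subst hu hv
    rcases s with i | i <;> rcases t with j | j
    · simp at he
    · exact ⟨_, ⟨i, rfl⟩, _, ⟨j, rfl⟩, rfl⟩
    · exact ⟨_, ⟨j, rfl⟩, _, ⟨i, rfl⟩, Sym2.eq_swap⟩
    · simp at he

theorem isSymmWeakSumMatrix_of_isBigBiclique (hG : G.Connected) (hQ : Q.IsSymm)
    (hlin : IsLinearizable Q) {B : G.Subgraph} (hB : IsBigBicliqueSubgraph B) :
    IsSymmWeakSumMatrix (subMatrix Q B B) := by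
  obtain ⟨X, Y, hXY, hmem⟩ := hB.exists_sides
  refine isSymmWeakSumMatrix_of_crossDiff hQ fun e he e' he' f hf f' hf' h1 h2 h3 h4 => ?_
  obtain ⟨x, hx, z, hz, rfl⟩ := hmem e he
  obtain ⟨x', hx', z', hz', rfl⟩ := hmem e' he'
  obtain ⟨a, ha, y, hy, rfl⟩ := hmem f hf
  obtain ⟨b, hb, w, hw, rfl⟩ := hmem f' hf'
  exact crossDiff_biclique hG hQ hlin hXY ha hy hb hw hx hz hx' hz'
    (fun h => h1 (by rw [h.1, h.2])) (fun h => h2 (by rw [h.1, h.2]))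
    (fun h => h3 (by rw [h.1, h.2])) (fun h => h4 (by rw [h.1, h.2]))

theorem isLinearizable_iff (hG : G.Connected) (hnice : HasNiceComponents G) (hQ : Q.IsSymm) :
    IsLinearizable Q ↔
      (∀ I J : G.Subgraph, IsBiconnectedComponent I → IsBiconnectedComponent J → I ≠ J →
        IsSumMatrix (subMatrix Q I J)) ∧
      (∀ B : G.Subgraph, IsBiconnectedComponent B →
        (IsCliqueSubgraph B ∨ IsBigBicliqueSubgraph B) →
          IsSymmWeakSumMatrix (subMatrix Q B B)) := by
  refine ⟨fun h => ⟨fun I J hI hJ hIJ => isSumMatrix_of_isLinearizable hG hQ h hI hJ hIJ,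
    fun B _ hB => ?_⟩, fun h => isLinearizable_of_blocks hnice h.1 h.2⟩
  rcases hB with hB | hB
  exacts [isSymmWeakSumMatrix_of_isClique hG hQ h hB,
    isSymmWeakSumMatrix_of_isBigBiclique hG hQ h hB]

end Blocks

/-! ### Fundamental cycles encoded by cut functions. -/

section Fundamental

variable {V : Type*}

theorem reachable_or_of_sup_edge {S : SimpleGraph V} {a b w : V}
    (h : (S ⊔ edge a b).Reachable w a) : S.Reachable w a ∨ S.Reachable w b := by
  have := eq_of_reachable (fun t => S.Reachable t a ∨ S.Reachable t b) (fun u v huv => ?_) h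
  · exact this.mpr (Or.inl (Reachable.refl _))
  · rcases huv with huv | huv
    · exact propext ⟨Or.imp huv.symm.reachable.trans huv.symm.reachable.trans,
        Or.imp huv.reachable.trans huv.reachable.trans⟩
    · rw [edge_adj] at huv
      rcases huv.1 with ⟨rfl, rfl⟩ | ⟨rfl, rfl⟩ <;> simp

/-- A spanning tree `T` with edges `a k b k`, together with functions `φ k` on the vertices that
change along the edge `k` of `T` only. -/
structure IsCutSystem {κ : Type*} (T : SimpleGraph V) (a b : κ → V) (φ : κ → V → ℕ) : Prop where
  edgeSet_eq : T.edgeSet = Set.range fun k => s(a k, b k)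
  connected : T.Connected
  cut : ∀ k l, φ k (a l) = φ k (b l) ↔ k ≠ l

namespace IsCutSystem

variable {κ : Type*} {T : SimpleGraph V} {a b : κ → V} {φ : κ → V → ℕ}

theorem adj (h : IsCutSystem T a b φ) (k : κ) : T.Adj (a k) (b k) := by
  rw [← mem_edgeSet, h.edgeSet_eq]
  exact ⟨k, rfl⟩

theorem exists_of_adj (h : IsCutSystem T a b φ) {u v : V} (huv : T.Adj u v) :
    ∃ k, s(a k, b k) = s(u, v) := by
  rwa [← mem_edgeSet, h.edgeSet_eq] at huv

theorem edge_injective (h : IsCutSystem T a b φ) :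
    Function.Injective fun k => s(a k, b k) := by
  intro k l hkl
  by_contra hne
  have h1 := (h.cut k l).2 hne
  have h2 := fun h' => (h.cut k k).1 h' rfl
  rcases Sym2.eq_iff.1 hkl with ⟨ha, hb⟩ | ⟨ha, hb⟩
  · rw [← ha, ← hb] at h1; exact h2 h1
  · rw [← ha, ← hb] at h1; exact h2 h1.symm

theorem eq_of_reachable (h : IsCutSystem T a b φ) (k : κ) {u v : V}
    (huv : (T.deleteEdges {s(a k, b k)}).Reachable u v) : φ k u = φ k v := by
  refine QMSTP.eq_of_reachable (φ k) (fun c d hcd => ?_) huv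
  rw [deleteEdges_adj, Set.mem_singleton_iff] at hcd
  obtain ⟨l, hl⟩ := h.exists_of_adj hcd.1
  have hkl := (h.cut k l).2 fun hkl => hcd.2 (by rw [hkl, hl])
  rcases Sym2.eq_iff.1 hl with ⟨rfl, rfl⟩ | ⟨rfl, rfl⟩
  exacts [hkl, hkl.symm]

theorem isTree (h : IsCutSystem T a b φ) : T.IsTree := by
  refine ⟨h.connected, isAcyclic_iff_forall_isBridge.2 fun e he => ?_⟩
  rw [h.edgeSet_eq] at he
  obtain ⟨k, rfl⟩ := he
  exact isBridge_iff.2 fun hr => (h.cut k k).1 (h.eq_of_reachable k hr) rfl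

theorem reachable_or (h : IsCutSystem T a b φ) (k : κ) (w : V) :
    (T.deleteEdges {s(a k, b k)}).Reachable w (a k) ∨
      (T.deleteEdges {s(a k, b k)}).Reachable w (b k) := by
  refine reachable_or_of_sup_edge ?_
  rw [deleteEdges_sup_edge (h.adj k)]
  exact h.connected.preconnected _ _

/-- Deleting the edge `k` leaves two components, and `φ k` takes different values on them. Hence `φ
k u ≠ φ k v` is the test for `k` to lie on the fundamental cycle of `uv`. -/
theorem reachable_of_eq (h : IsCutSystem T a b φ) {k : κ} {u v : V} (huv : φ k u = φ k v) :
    (T.deleteEdges {s(a k, b k)}).Reachable u v := by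
  have hk := fun h' => (h.cut k k).1 h' rfl
  rcases h.reachable_or k u with hu | hu <;> rcases h.reachable_or k v with hv | hv
  · exact hu.trans hv.symm
  · exact absurd (by rw [← h.eq_of_reachable k hu, ← h.eq_of_reachable k hv, huv]) hk
  · exact absurd (by rw [← h.eq_of_reachable k hu, ← h.eq_of_reachable k hv, huv]) hk
  · exact hu.trans hv.symm

theorem isTree_exchange (h : IsCutSystem T a b φ) {k : κ} {u v : V} (huv : φ k u ≠ φ k v) :
    (T.deleteEdges {s(a k, b k)} ⊔ edge u v).IsTree := by
  have hT : (T.deleteEdges {s(a k, b k)} ⊔ edge (a k) (b k)).IsTree := by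
    rw [deleteEdges_sup_edge (h.adj k)]
    exact h.isTree
  have hn : ¬ (T.deleteEdges {s(a k, b k)}).Reachable (a k) (b k) := fun hr =>
    (h.cut k k).1 (h.eq_of_reachable k hr) rfl
  rcases h.reachable_or k u with hu | hu <;> rcases h.reachable_or k v with hv | hv
  · exact absurd (h.eq_of_reachable k (hu.trans hv.symm)) huv
  · exact isTree_sup_edge_swap hT hn hu.symm hv.symm
  · rw [edge_comm]
    exact isTree_sup_edge_swap hT hn hv.symm hu.symm
  · exact absurd (h.eq_of_reachable k (hu.trans hv.symm)) huv

/-- An edge of a spanning tree `T'` outside `T` can be replaced in `T'` by an edge of its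
fundamental cycle. -/
theorem exists_exchange (h : IsCutSystem T a b φ) {T' : SimpleGraph V} (hT' : T'.IsTree)
    {u v : V} (huv : T'.Adj u v) (huv' : ¬ T.Adj u v) :
    ∃ k, φ k u ≠ φ k v ∧ ¬ T'.Adj (a k) (b k) ∧
      (T'.deleteEdges {s(u, v)} ⊔ edge (a k) (b k)).IsTree := by
  obtain ⟨S, hS⟩ : ∃ S, S = T'.deleteEdges {s(u, v)} := ⟨_, rfl⟩
  have hSuv : S ⊔ edge u v = T' := hS ▸ deleteEdges_sup_edge huv
  have hn : ¬ S.Reachable u v := hS ▸ not_reachable_deleteEdges hT'.isAcyclic huv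
  obtain ⟨p, hp⟩ := (h.connected.preconnected u v).exists_isPath
  -- The path of `T` from `u` to `v` has an edge `cd` that leaves the component of `u` in `T' - uv`;
  -- this edge reconnects the two components.
  obtain ⟨⟨⟨c, d⟩, hcd'⟩, hdp, hc, hd⟩ :=
    p.exists_boundary_dart {t | S.Reachable u t} (Reachable.refl _) hn
  have hcd : s(c, d) ∈ p.edges := List.mem_map_of_mem (f := Dart.edge) hdp
  simp only [Set.mem_ofPred_eq] at hc hd
  obtain ⟨k, hk⟩ := h.exists_of_adj (p.adj_of_mem_edges hcd)
  have hnT' : ¬ T'.Adj c d := by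
    intro hadj
    have hS' : ¬ S.Adj c d := fun h' => hd (hc.trans h'.reachable)
    rw [hS, deleteEdges_adj, Set.mem_singleton_iff, not_and_not_right] at hS'
    have := p.adj_of_mem_edges hcd
    rw [← mem_edgeSet, hS' hadj] at this
    exact huv' this
  have hedge : edge (a k) (b k) = edge c d := by
    rw [edge, edge, hk]
  have hadj : T'.Adj (a k) (b k) ↔ T'.Adj c d := by
    rw [← mem_edgeSet, hk, mem_edgeSet]
  refine ⟨k, fun heq => ?_, by rwa [hadj], ?_⟩
  -- Otherwise a path of `T` from `u` to `v` would avoid the edge `k`, against the uniqueness of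
  -- paths in a tree.
  · obtain ⟨p', hp'⟩ := (h.reachable_of_eq heq).exists_isPath
    have := (h.isTree.isAcyclic.subsingleton_path u v).elim ⟨p, hp⟩
      ⟨p'.mapLe (deleteEdges_le _), by simpa using hp'⟩
    have hpe : p = p'.mapLe (deleteEdges_le _) := congrArg Subtype.val this
    rw [hpe] at hcd
    have hcd' : s(c, d) ∈ p'.edges := by simpa using hcd
    have := p'.edges_subset_edgeSet hcd'
    rw [edgeSet_deleteEdges, hk] at this
    exact this.2 rfl
  · rw [hedge, ← hS]
    have hd' : S.Reachable d u ∨ S.Reachable d v := reachable_or_of_sup_edge (by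
      rw [hSuv]; exact hT'.connected.preconnected _ _)
    refine isTree_sup_edge_swap (hSuv.symm ▸ hT') hn hc ?_
    rcases hd' with hd' | hd'
    exacts [absurd hd'.symm hd, hd'.symm]

end IsCutSystem

end Fundamental

/-! ### Linear costs and fundamental cycles. -/

section Linear

variable {V : Type*} [Fintype V] {G : SimpleGraph V} {κ : Type*} [Fintype κ]
  {T : SimpleGraph V} {a b : κ → V} {φ : κ → V → ℕ}

open Classical in
theorem IsCutSystem.indVec_dotProduct (h : IsCutSystem T a b φ) (hadj : ∀ k, G.Adj (a k) (b k))
    (r : G.edgeSet → ℝ) : indVec G T ⬝ᵥ r = ∑ k, r ⟨s(a k, b k), hadj k⟩ := by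
  have hinj : Function.Injective fun k => (⟨s(a k, b k), hadj k⟩ : G.edgeSet) := fun k l hkl =>
    h.edge_injective (congrArg Subtype.val hkl)
  rw [← Finset.sum_image (f := r) (s := Finset.univ) hinj.injOn, dotProduct,
    ← Finset.sum_subset (Finset.subset_univ _)]
  · refine Finset.sum_congr rfl fun e he => ?_
    obtain ⟨k, -, rfl⟩ := Finset.mem_image.1 he
    simp [indVec, h.adj k]
  · intro e _ he
    have : (e : Sym2 V) ∉ T.edgeSet := by
      rw [h.edgeSet_eq]
      rintro ⟨k, hk⟩
      exact he (Finset.mem_image.2 ⟨k, Finset.mem_univ _, Subtype.ext hk⟩)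
    simp [indVec, this]

theorem deleteEdges_not_adj (T : SimpleGraph V) (a b : V) :
    ¬ (T.deleteEdges {s(a, b)}).Adj a b := by simp

/-- The difference of the costs of two edges of a fundamental cycle in a linearization. -/
theorem IsLinearization.sub_eq (h : IsCutSystem T a b φ) (hadj : ∀ k, G.Adj (a k) (b k))
    {Q : Matrix G.edgeSet G.edgeSet ℝ} (hQ : Q.IsSymm) {C : G.edgeSet → ℝ}
    (hC : IsLinearization Q C) {u v : V} (huv : G.Adj u v) {k : κ} (hk : φ k u ≠ φ k v)
    {e g : G.edgeSet} (he : e = ⟨s(u, v), huv⟩) (hg : g = ⟨s(a k, b k), hadj k⟩) :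
    C e - C g = 2 * ∑ l, Q e ⟨s(a l, b l), hadj l⟩ - 2 * ∑ l, Q g ⟨s(a l, b l), hadj l⟩ + Q e e -
      2 * Q e g + Q g g := by
  classical
  have hTG : T ≤ G := by
    intro c d hcd
    obtain ⟨l, hl⟩ := h.exists_of_adj hcd
    rw [← mem_edgeSet, ← hl]
    exact hadj l
  rw [← h.indVec_dotProduct hadj (Q e), ← h.indVec_dotProduct hadj (Q g)]
  -- The formula is the difference of `Q = C` on the trees `S + e` and `S + g = T`, with the
  -- interactions with `S` rewritten as interactions with `T`.
  obtain ⟨S, hS⟩ : ∃ S, S = T.deleteEdges {s(a k, b k)} := ⟨_, rfl⟩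
  have hT : T = S ⊔ edge (a k) (b k) := (hS ▸ deleteEdges_sup_edge (h.adj k)).symm
  have hSg : ¬ S.Adj (a k) (b k) := hS ▸ deleteEdges_not_adj T _ _
  have hSe : ¬ S.Adj u v := fun h' => hk (h.eq_of_reachable k (hS ▸ h'.reachable))
  have e1 := hC T ⟨hTG, h.isTree⟩
  have e2 := hC (S ⊔ edge u v) ⟨sup_le (hS ▸ (deleteEdges_le _).trans hTG) (edge_le_of_adj huv),
    hS ▸ h.isTree_exchange hk⟩
  rw [quadCost_eq_dotProduct, linCost_eq_dotProduct] at e1 e2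
  rw [hT] at e1 ⊢
  rw [indVec_sup_edge (hadj k) hSg, ← hg] at e1 ⊢
  rw [indVec_sup_edge huv hSe, ← he] at e2
  simp only [Matrix.mulVec_add, dotProduct_add, add_dotProduct, single_dotProduct,
    Matrix.mulVec_single_one, one_mul, Matrix.col_apply] at e1 e2 ⊢
  have s1 : ∀ f, indVec G S ⬝ᵥ Q.col f = indVec G S ⬝ᵥ Q f := fun f => by
    congr 1
    funext i
    exact hQ.apply f i
  have s2 : ∀ f, (Q.mulVec (indVec G S)) f = indVec G S ⬝ᵥ Q f := fun f => dotProduct_comm _ _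
  rw [s1, s2] at e1 e2
  have := hQ.apply e g
  linarith

/-- A cost vector that is constant on fundamental cycles has the same value on all spanning
trees. -/
theorem IsCutSystem.linCost_eq (h : IsCutSystem T a b φ) (hadj : ∀ k, G.Adj (a k) (b k))
    {d : G.edgeSet → ℝ} (hd : ∀ u v (huv : G.Adj u v) k, φ k u ≠ φ k v →
      d ⟨s(u, v), huv⟩ = d ⟨s(a k, b k), hadj k⟩) :
    ∀ T', IsSpanningTree G T' → linCost d T' = linCost d T := by
  -- Induction on the number of edges of `T'` outside `T`, which an exchange lowers by one without
  -- changing the cost.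
  suffices H : ∀ N : ℕ, ∀ T', IsSpanningTree G T' → (T'.edgeSet \ T.edgeSet).ncard = N →
      linCost d T' = linCost d T from fun T' hT' => H _ T' hT' rfl
  intro N
  induction N with
  | zero =>
    intro T' hT' hN
    rw [Set.ncard_eq_zero, Set.sdiff_eq_empty, edgeSet_subset_edgeSet] at hN
    rw [(isTree_iff_minimal_connected.1 h.isTree).eq_of_le hT'.2.connected hN]
  | succ N ih =>
    intro T' hT' hN
    obtain ⟨e, he, heT⟩ : (T'.edgeSet \ T.edgeSet).Nonempty := by
      rw [← Set.ncard_pos]; omega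
    induction e with | _ u v =>
    rw [mem_edgeSet] at he heT
    obtain ⟨k, hk, hkT', htree⟩ := h.exists_exchange hT'.2 he heT
    obtain ⟨S, hS⟩ : ∃ S, S = T'.deleteEdges {s(u, v)} := ⟨_, rfl⟩
    have hST' : S ⊔ edge u v = T' := hS ▸ deleteEdges_sup_edge he
    have hSle : S ≤ T' := hS ▸ deleteEdges_le _
    rw [← hS] at htree
    have huv : G.Adj u v := hT'.1 he
    rw [← ih (S ⊔ edge (a k) (b k)) ⟨sup_le (hSle.trans hT'.1) (edge_le_of_adj (hadj k)), htree⟩ ?_]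
    · conv_lhs => rw [← hST']
      rw [linCost_eq_dotProduct, linCost_eq_dotProduct,
        indVec_sup_edge huv (hS ▸ deleteEdges_not_adj T' u v),
        indVec_sup_edge (hadj k) (fun h' => hkT' (hSle h'))]
      simp only [add_dotProduct, single_dotProduct, one_mul]
      rw [hd u v huv k hk]
    · have : (S ⊔ edge (a k) (b k)).edgeSet \ T.edgeSet =
          (T'.edgeSet \ T.edgeSet) \ {s(u, v)} := by
        ext f
        have hf := h.adj k
        rw [hS, edgeSet_sup, edgeSet_deleteEdges, edgeSet_edge_of_ne (hadj k).ne]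
        simp only [Set.mem_sdiff, Set.mem_union, Set.mem_singleton_iff]
        constructor
        · rintro ⟨h1 | rfl, h2⟩
          · exact ⟨⟨h1.1, h2⟩, h1.2⟩
          · exact absurd hf h2
        · rintro ⟨⟨h1, h2⟩, h3⟩
          exact ⟨Or.inl ⟨h1, h3⟩, h2⟩
      have hmem : s(u, v) ∈ T'.edgeSet \ T.edgeSet := ⟨he, heT⟩
      rw [this, Set.ncard_sdiff_singleton_of_mem hmem, hN,
        Nat.add_sub_cancel]

end Linear

namespace RealRAM

/-! ### Reasoning about programs -/

/-- The natural-number variables written by a program. -/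
def Prog.nvars : Prog → List ℕ
  | .nset x _ => [x]
  | .seq p q => p.nvars ++ q.nvars
  | .ite _ p q => p.nvars ++ q.nvars
  | .while _ p => p.nvars
  | _ => []

/-- The real variables written by a program. -/
def Prog.rvars : Prog → List ℕ
  | .rset x _ => [x]
  | .seq p q => p.rvars ++ q.rvars
  | .ite _ p q => p.rvars ++ q.rvars
  | .while _ p => p.rvars
  | _ => []

/-- The arrays of natural numbers written by a program. -/
def Prog.narrs : Prog → List ℕ
  | .nput a _ _ => [a]
  | .seq p q => p.narrs ++ q.narrs
  | .ite _ p q => p.narrs ++ q.narrs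
  | .while _ p => p.narrs
  | _ => []

/-- The arrays of reals written by a program. -/
def Prog.rarrs : Prog → List ℕ
  | .rput a _ _ => [a]
  | .seq p q => p.rarrs ++ q.rarrs
  | .ite _ p q => p.rarrs ++ q.rarrs
  | .while _ p => p.rarrs
  | _ => []

/-- `s'` agrees with `s` on everything that `p` does not write. -/
structure Unchanged (p : Prog) (s s' : Memory) : Prop where
  nvar : ∀ x, x ∉ p.nvars → s'.nvar x = s.nvar x
  rvar : ∀ x, x ∉ p.rvars → s'.rvar x = s.rvar x
  narr : ∀ a, a ∉ p.narrs → s'.narr a = s.narr a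
  rarr : ∀ a, a ∉ p.rarrs → s'.rarr a = s.rarr a

theorem Unchanged.refl (p : Prog) (s : Memory) : Unchanged p s s :=
  ⟨fun _ _ => rfl, fun _ _ => rfl, fun _ _ => rfl, fun _ _ => rfl⟩

theorem Unchanged.trans {p : Prog} {s s' s'' : Memory} (h : Unchanged p s s')
    (h' : Unchanged p s' s'') : Unchanged p s s'' :=
  ⟨fun x hx => (h'.nvar x hx).trans (h.nvar x hx), fun x hx => (h'.rvar x hx).trans (h.rvar x hx),
    fun x hx => (h'.narr x hx).trans (h.narr x hx), fun x hx => (h'.rarr x hx).trans (h.rarr x hx)⟩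

theorem Unchanged.mono {p q : Prog} {s s' : Memory} (h : Unchanged p s s')
    (h1 : p.nvars ⊆ q.nvars) (h2 : p.rvars ⊆ q.rvars) (h3 : p.narrs ⊆ q.narrs)
    (h4 : p.rarrs ⊆ q.rarrs) : Unchanged q s s' :=
  ⟨fun x hx => h.nvar x fun h => hx (h1 h), fun x hx => h.rvar x fun h => hx (h2 h),
    fun x hx => h.narr x fun h => hx (h3 h), fun x hx => h.rarr x fun h => hx (h4 h)⟩

theorem Unchanged.seq_left {p q : Prog} {s s' : Memory} (h : Unchanged p s s') :
    Unchanged (.seq p q) s s' :=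
  h.mono (List.subset_append_left _ _) (List.subset_append_left _ _)
    (List.subset_append_left _ _) (List.subset_append_left _ _)

theorem Unchanged.seq_right {p q : Prog} {s s' : Memory} (h : Unchanged q s s') :
    Unchanged (.seq p q) s s' :=
  h.mono (List.subset_append_right _ _) (List.subset_append_right _ _)
    (List.subset_append_right _ _) (List.subset_append_right _ _)

theorem Exec.unchanged {p : Prog} {s s' : Memory} {t : ℕ} (h : Exec p s s' t) :
    Unchanged p s s' := by
  induction h with
  | skip s => exact Unchanged.refl _ _
  | nset s x u =>
    refine ⟨fun z hz => ?_, fun _ _ => rfl, fun _ _ => rfl, fun _ _ => rfl⟩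
    exact Function.update_of_ne (by simpa [Prog.nvars] using hz) _ _
  | rset s x u =>
    refine ⟨fun _ _ => rfl, fun z hz => ?_, fun _ _ => rfl, fun _ _ => rfl⟩
    exact Function.update_of_ne (by simpa [Prog.rvars] using hz) _ _
  | nput s a i u =>
    refine ⟨fun _ _ => rfl, fun _ _ => rfl, fun z hz => ?_, fun _ _ => rfl⟩
    exact Function.update_of_ne (by simpa [Prog.narrs] using hz) _ _
  | rput s a i u =>
    refine ⟨fun _ _ => rfl, fun _ _ => rfl, fun _ _ => rfl, fun z hz => ?_⟩
    exact Function.update_of_ne (by simpa [Prog.rarrs] using hz) _ _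
  | seq _ _ ih ih' => exact ih.seq_left.trans ih'.seq_right
  | ite_true _ _ ih => exact ih.seq_left.mono (List.Subset.refl _) (List.Subset.refl _) (List.Subset.refl _) (List.Subset.refl _)
  | ite_false _ _ ih => exact ih.seq_right.mono (List.Subset.refl _) (List.Subset.refl _) (List.Subset.refl _) (List.Subset.refl _)
  | while_true _ _ _ ih ih' =>
    exact Unchanged.trans (p := .while _ _) (ih.mono (List.Subset.refl _) (List.Subset.refl _)
      (List.Subset.refl _) (List.Subset.refl _)) ih'
  | while_false _ => exact Unchanged.refl _ _

/-- Started in `s`, the program `p` halts within `N` steps in a memory satisfying `P`. -/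
def Runs (p : Prog) (s : Memory) (N : ℕ) (P : Memory → Prop) : Prop :=
  ∃ s' t, Exec p s s' t ∧ t ≤ N ∧ P s'

theorem Runs.mono {p : Prog} {s : Memory} {M N : ℕ} {P R : Memory → Prop} (h : Runs p s M P)
    (hMN : M ≤ N) (hPR : ∀ s', P s' → R s') : Runs p s N R := by
  obtain ⟨s', t, h1, h2, h3⟩ := h
  exact ⟨s', t, h1, h2.trans hMN, hPR s' h3⟩

theorem Runs.and_unchanged {p : Prog} {s : Memory} {N : ℕ} {P : Memory → Prop}
    (h : Runs p s N P) : Runs p s N fun s' => Unchanged p s s' ∧ P s' := by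
  obtain ⟨s', t, h1, h2, h3⟩ := h
  exact ⟨s', t, h1, h2, h1.unchanged, h3⟩

theorem Runs.seq {p q : Prog} {s : Memory} {M N K : ℕ} {P R : Memory → Prop} (h : Runs p s M P)
    (h' : ∀ s', Unchanged p s s' → P s' → Runs q s' N R) (hK : M + N ≤ K) :
    Runs (.seq p q) s K R := by
  obtain ⟨s', t, h1, h2, h3⟩ := h
  obtain ⟨s'', t', h4, h5, h6⟩ := h' s' h1.unchanged h3
  exact ⟨s'', t + t', .seq h1 h4, by omega, h6⟩

/-- A bound for the number of steps of a program without loops. -/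
def Prog.maxCost : Prog → ℕ
  | .skip => 1
  | .nset _ u => u.cost + 1
  | .rset _ u => u.cost + 1
  | .nput _ i u => i.cost + u.cost + 1
  | .rput _ i u => i.cost + u.cost + 1
  | .seq p q => p.maxCost + q.maxCost
  | .ite b p q => b.cost + 1 + (p.maxCost + q.maxCost)
  | .while _ _ => 0

/-- The weakest precondition of a program without loops. -/
def Prog.wp : Prog → Memory → (Memory → Prop) → Prop
  | .skip, s, P => P s
  | .nset x u, s, P => P { s with nvar := Function.update s.nvar x (u.eval s) }
  | .rset x u, s, P => P { s with rvar := Function.update s.rvar x (u.eval s) }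
  | .nput a i u, s, P =>
    P { s with narr :=
          Function.update s.narr a (Function.update (s.narr a) (i.eval s) (u.eval s)) }
  | .rput a i u, s, P =>
    P { s with rarr :=
          Function.update s.rarr a (Function.update (s.rarr a) (i.eval s) (u.eval s)) }
  | .seq p q, s, P => p.wp s fun s' => q.wp s' P
  | .ite b p q, s, P => (b.Holds s → p.wp s P) ∧ (¬ b.Holds s → q.wp s P)
  | .while _ _, _, _ => False

theorem Runs.of_wp {p : Prog} {s : Memory} {P : Memory → Prop} {N : ℕ} (h : p.wp s P)
    (hN : p.maxCost ≤ N) : Runs p s N P := by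
  refine Runs.mono (M := p.maxCost) ?_ hN fun _ h => h
  clear hN
  induction p generalizing s P with
  | skip => exact ⟨_, _, .skip s, le_rfl, h⟩
  | nset x u => exact ⟨_, _, .nset s x u, le_rfl, h⟩
  | rset x u => exact ⟨_, _, .rset s x u, le_rfl, h⟩
  | nput a i u => exact ⟨_, _, .nput s a i u, le_rfl, h⟩
  | rput a i u => exact ⟨_, _, .rput s a i u, le_rfl, h⟩
  | seq p q ihp ihq => exact (ihp h).seq (fun s' _ h' => ihq h') le_rfl
  | ite b p q ihp ihq =>
    by_cases hb : b.Holds s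
    · obtain ⟨s', t, h1, h2, h3⟩ := ihp (h.1 hb)
      exact ⟨s', _, .ite_true hb h1, by simp only [Prog.maxCost]; omega, h3⟩
    · obtain ⟨s', t, h1, h2, h3⟩ := ihq (h.2 hb)
      exact ⟨s', _, .ite_false hb h1, by simp only [Prog.maxCost]; omega, h3⟩
  | _ => exact h.elim

/-- The loop in which the variable `i` runs through the numbers below the variable `b`. -/
def Prog.loop (i b : ℕ) (p : Prog) : Prog :=
  .seq (.nset i (.lit 0))
    (.while (.nlt (.var i) (.var b)) (.seq p (.nset i (.add (.var i) (.lit 1)))))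

/-- Each round costs `4` for the test and `4` for the increment besides the body; the initialization
(`2`) and the last test (`4`) give the `6`. The invariant refers to the memory with the counter
already advanced. -/
theorem Runs.loop {i b : ℕ} {p : Prog} {s : Memory} {N c K : ℕ} (Inv : ℕ → Memory → Prop)
    (hib : i ∉ p.nvars ∧ b ∉ p.nvars ∧ b ≠ i) (hN : s.nvar b = N)
    (h0 : Inv 0 { s with nvar := Function.update s.nvar i 0 })
    (hstep : ∀ k < N, ∀ s', Unchanged (.loop i b p) s s' → s'.nvar i = k → Inv k s' →
      Runs p s' c fun s'' =>
        Inv (k + 1) { s'' with nvar := Function.update s''.nvar i (k + 1) })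
    (hK : N * (c + 8) + 6 ≤ K) :
    Runs (.loop i b p) s K (Inv N) := by
  obtain ⟨hi, hb, hne⟩ := hib
  have hbl : b ∉ (Prog.loop i b p).nvars := by
    simp [Prog.loop, Prog.nvars, hb, hne]
  have key : ∀ j k, k + j = N → ∀ s', Unchanged (.loop i b p) s s' → s'.nvar i = k →
      Inv k s' → Runs (.while (.nlt (.var i) (.var b)) (.seq p (.nset i (.add (.var i) (.lit 1)))))
        s' (j * (c + 8) + 4) (Inv N) := by
    intro j
    induction j with
    | zero =>
      intro k hk s' hs' hik hinv
      refine ⟨s', _, .while_false ?_, ?_, ?_⟩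
      · simp only [Test.Holds, NExp.eval, hik, hs'.nvar b hbl, hN]; omega
      · simp [Test.cost, NExp.cost]
      · obtain rfl : k = N := by omega
        exact hinv
    | succ j ih =>
      intro k hk s' hs' hik hinv
      obtain ⟨s₁, t₁, e1, e2, e3⟩ := hstep k (by omega) s' hs' hik hinv
      have hi1 : s₁.nvar i = k := (e1.unchanged.nvar i hi).trans hik
      have e4 := Exec.nset s₁ i (.add (.var i) (.lit 1))
      simp only [NExp.eval, hi1] at e4
      have e5 := Exec.seq e1 e4
      have hu : Unchanged (.loop i b p) s' _ :=
        e5.unchanged.mono (q := .loop i b p) (List.subset_append_right _ _)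
          (List.subset_append_right _ _) (List.subset_append_right _ _)
          (List.subset_append_right _ _)
      obtain ⟨s₂, t₂, e6, e7, e8⟩ := ih (k + 1) (by omega) _ (hs'.trans hu) (by simp) e3
      refine ⟨s₂, _, .while_true ?_ e5 e6, ?_, e8⟩
      · simp only [Test.Holds, NExp.eval, hik, hs'.nvar b hbl, hN]; omega
      · simp only [Test.cost, NExp.cost]
        rw [Nat.add_mul]
        omega
  refine Runs.mono (M := 2 + (N * (c + 8) + 4)) ?_ (by omega) fun _ h => h
  have e := Exec.nset s i (.lit 0)
  obtain ⟨s', t, e1, e2, e3⟩ := key N 0 (by omega) _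
    (e.unchanged.seq_left (q := .while (.nlt (.var i) (.var b))
      (.seq p (.nset i (.add (.var i) (.lit 1)))))) (by simp [NExp.eval]) h0
  exact ⟨s', _, .seq e e1, by simp only [NExp.cost]; omega, e3⟩

/-! ### Growing a spanning tree -/

/-- Entries of a two-dimensional array stored row by row do not collide. -/
theorem mul_add_inj {n a b u v : ℕ} (hu : u < n) (hv : v < n) :
    a * n + u = b * n + v ↔ a = b ∧ u = v := by
  constructor
  · intro h
    have h1 : (a * n + u) / n = a := by
      rw [mul_comm, Nat.mul_add_div (by omega), Nat.div_eq_of_lt hu, add_zero]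
    have h2 : (b * n + v) / n = b := by
      rw [mul_comm, Nat.mul_add_div (by omega), Nat.div_eq_of_lt hv, add_zero]
    have hab : a = b := by rw [← h1, h, h2]
    subst hab
    exact ⟨rfl, by omega⟩
  · rintro ⟨rfl, rfl⟩
    rfl

/-- The first `k` edges of a growing tree, their cut functions, and the set of its vertices. -/
structure Grown (n m : ℕ) (x y : ℕ → ℕ) (k : ℕ) (W t : ℕ → ℕ) (φ : ℕ → ℕ → ℕ) : Prop where
  lt : ∀ l < k, t l < m
  root : W 0 = 1
  vals : ∀ v < n, W v = 0 ∨ W v = 1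
  card : ((Finset.range n).filter fun v => W v = 1).card = k + 1
  ends : ∀ l < k, W (x (t l)) = 1 ∧ W (y (t l)) = 1
  cut : ∀ l < k, ∀ l' < k, φ l (x (t l')) = φ l (y (t l')) ↔ l ≠ l'
  zero : ∀ l, k ≤ l → ∀ v < n, φ l v = 0
  reach : ∀ v < n, W v = 1 →
    Relation.ReflTransGen (fun u v => ∃ l < k, s(x (t l), y (t l)) = s(u, v)) 0 v

section Grown

variable {n m : ℕ} {x y : ℕ → ℕ} {k : ℕ} {W t : ℕ → ℕ} {φ : ℕ → ℕ → ℕ}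

theorem Grown.init (hn : 0 < n) (hφ : ∀ l, ∀ v < n, φ l v = 0)
    (hW : ∀ v, W v = if v = 0 then 1 else 0) : Grown n m x y 0 W t φ where
  lt := by simp
  root := by simp [hW]
  vals v _ := by rw [hW]; split_ifs <;> simp
  card := by
    rw [Finset.card_eq_one]
    refine ⟨0, ?_⟩
    ext v
    simp only [hW, Finset.mem_filter, Finset.mem_range, Finset.mem_singleton]
    split_ifs with h
    · simp [h, hn]
    · simp [h]
  ends := by simp
  cut := by simp
  zero l _ := hφ l
  reach v _ hv := by
    rw [hW] at hv
    split_ifs at hv with h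
    rw [h]

/-- Connectedness of the graph enters as `hcon`: a set of vertices that contains `0` but not
everything is left by some edge. -/
theorem Grown.exists_crossing (h : Grown n m x y k W t φ)
    (hcon : ∀ S : ℕ → Prop, S 0 → (∃ v < n, ¬ S v) → ∃ e < m, ¬ (S (x e) ↔ S (y e)))
    (hk : k + 1 < n) : ∃ e < m, W (x e) ≠ W (y e) := by
  obtain ⟨e, he, hne⟩ := hcon (fun v => W v = 1) h.root (by
    by_contra hall
    push Not at hall
    have := h.card
    rw [Finset.filter_true_of_mem fun v hv => hall v (Finset.mem_range.1 hv),
      Finset.card_range] at this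
    omega)
  exact ⟨e, he, fun h' => hne (by rw [h'])⟩

/-- The new vertex `w` hangs at `u`, hence lies on the side of `u` of every old tree edge: old cut
functions take at `w` their value at `u`. The new one is `1` at `w` and `0` on the tree so far; it
acquires further ones when later vertices copy their values. -/
theorem Grown.step (h : Grown n m x y k W t φ) (hxy : ∀ e < m, x e < n ∧ y e < n) {f u w : ℕ}
    (hf : f < m) (huw : u = x f ∧ w = y f ∨ u = y f ∧ w = x f) (hu : W u = 1) (hw : W w = 0)
    {φ' : ℕ → ℕ → ℕ} (hφ' : ∀ l, ∀ v < n, φ' l v =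
      if v = w then (if l < k then φ l u else if l = k then 1 else φ l v) else φ l v) :
    Grown n m x y (k + 1) (Function.update W w 1) (Function.update t k f) φ' := by
  have hwn : w < n := by rcases huw with ⟨-, rfl⟩ | ⟨-, rfl⟩; exacts [(hxy f hf).2, (hxy f hf).1]
  have hun : u < n := by rcases huw with ⟨rfl, -⟩ | ⟨rfl, -⟩; exacts [(hxy f hf).1, (hxy f hf).2]
  have huw' : u ≠ w := fun h' => by rw [h', hw] at hu; omega
  have hsf : s(x f, y f) = s(u, w) := by
    rcases huw with ⟨rfl, rfl⟩ | ⟨rfl, rfl⟩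
    exacts [rfl, Sym2.eq_swap]
  have hx : ∀ l < k, x (t l) ≠ w ∧ y (t l) ≠ w := fun l hl =>
    ⟨fun h' => by have := (h.ends l hl).1; rw [h', hw] at this; omega,
      fun h' => by have := (h.ends l hl).2; rw [h', hw] at this; omega⟩
  have ht : ∀ l < k, Function.update t k f l = t l := fun l hl =>
    Function.update_of_ne (by omega) _ _
  have htk : Function.update t k f k = f := Function.update_self _ _ _
  have hWu : ∀ v, W v = 1 → Function.update W w 1 v = 1 := fun v hv => by
    rw [Function.update_apply]; split_ifs <;> simp [hv]
  have hold : ∀ l, ∀ l' < k, φ' l (x (t l')) = φ l (x (t l')) ∧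
      φ' l (y (t l')) = φ l (y (t l')) := fun l l' hl' => by
    have hl := hxy _ (h.lt l' hl')
    rw [hφ' l _ hl.1, hφ' l _ hl.2, if_neg (hx l' hl').1, if_neg (hx l' hl').2]
    exact ⟨rfl, rfl⟩
  have hnew : ∀ l, φ' l (x f) = φ' l (y f) ↔ φ' l u = φ' l w := fun l => by
    rcases huw with ⟨rfl, rfl⟩ | ⟨rfl, rfl⟩
    exacts [Iff.rfl, eq_comm]
  have hφu : ∀ l, φ' l u = φ l u := fun l => by rw [hφ' l u hun, if_neg huw']
  constructor
  · intro l hl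
    rcases Nat.lt_succ_iff_lt_or_eq.1 hl with hl | rfl
    · rw [ht l hl]; exact h.lt l hl
    · rwa [htk]
  · exact hWu 0 h.root
  · intro v hv
    rw [Function.update_apply]
    split_ifs
    exacts [Or.inr rfl, h.vals v hv]
  · have : ((Finset.range n).filter fun v => Function.update W w 1 v = 1) =
        insert w ((Finset.range n).filter fun v => W v = 1) := by
      ext v
      simp only [Finset.mem_filter, Finset.mem_range, Finset.mem_insert, Function.update_apply]
      by_cases hv : v = w
      · simp [hv, hwn]
      · simp [hv]
    rw [this, Finset.card_insert_of_notMem (by simp [hw]), h.card]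
  · intro l hl
    rcases Nat.lt_succ_iff_lt_or_eq.1 hl with hl | rfl
    · rw [ht l hl]
      exact ⟨hWu _ (h.ends l hl).1, hWu _ (h.ends l hl).2⟩
    · rw [htk]
      have hw1 : Function.update W w 1 w = 1 := Function.update_self _ _ _
      rcases huw with ⟨rfl, rfl⟩ | ⟨rfl, rfl⟩
      exacts [⟨hWu _ hu, hw1⟩, ⟨hw1, hWu _ hu⟩]
  · intro l hl l' hl'
    rcases Nat.lt_succ_iff_lt_or_eq.1 hl' with hl' | rfl
    · rw [ht l' hl', (hold l l' hl').1, (hold l l' hl').2]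
      rcases Nat.lt_succ_iff_lt_or_eq.1 hl with hl | rfl
      · exact h.cut l hl l' hl'
      · have hl := hxy _ (h.lt l' hl')
        rw [h.zero l le_rfl _ hl.1, h.zero l le_rfl _ hl.2]
        simp only [true_iff]
        omega
    · rw [htk, hnew, hφu, hφ' l w hwn, if_pos rfl]
      rcases Nat.lt_succ_iff_lt_or_eq.1 hl with hl | rfl
      · rw [if_pos hl]
        simp only [true_iff]
        omega
      · simp [h.zero l le_rfl u hun]
  · intro l hl v hv
    rw [hφ' l v hv, if_neg (by omega : ¬ l < k), if_neg (by omega : ¬ l = k), ite_self]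
    exact h.zero l (by omega) v hv
  · intro v hv hWv
    have hmono : ∀ v < n, W v = 1 → Relation.ReflTransGen (fun u v => ∃ l < k + 1,
        s(x (Function.update t k f l), y (Function.update t k f l)) = s(u, v)) 0 v := by
      intro v hv hWv
      refine Relation.ReflTransGen.mono (fun a b => ?_) _ _ (h.reach v hv hWv)
      rintro ⟨l, hl, h'⟩
      exact ⟨l, by omega, by rw [ht l hl]; exact h'⟩
    by_cases hvw : v = w
    · rw [hvw]
      exact (hmono u hun hu).tail ⟨k, by omega, by rw [htk, hsf]⟩
    · rw [Function.update_of_ne hvw] at hWv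
      exact hmono v hv hWv

end Grown

/-- The data of an instance in memory: `n` vertices, `m` edges with ends `x` and `y`, costs `q`,
the number `N` of tree edges, and the multiples of `m` and of `n`. -/
structure Inst (n m N : ℕ) (x y : ℕ → ℕ) (q : ℕ → ℕ → ℝ) (s : Memory) : Prop where
  n_eq : s.nvar 0 = n
  m_eq : s.nvar 1 = m
  N_eq : s.nvar 2 = N
  x_eq : s.narr 0 = x
  y_eq : s.narr 1 = y
  rowm : ∀ i ≤ m, s.narr 2 i = i * m
  rown : ∀ i ≤ N, s.narr 3 i = i * n
  q_eq : ∀ i < m, ∀ j < m, s.rarr 0 (i * m + j) = q i j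

theorem Inst.of_unchanged {n m N : ℕ} {x y : ℕ → ℕ} {q : ℕ → ℕ → ℝ} {s s' : Memory} {p : Prog}
    (h : Inst n m N x y q s) (hu : Unchanged p s s')
    (hp : (∀ i < 3, i ∉ p.nvars) ∧ (∀ i < 4, i ∉ p.narrs) ∧ 0 ∉ p.rarrs) :
    Inst n m N x y q s' := by
  obtain ⟨h1, h2, h3⟩ := hp
  constructor
  · rw [hu.nvar 0 (h1 0 (by simp))]; exact h.n_eq
  · rw [hu.nvar 1 (h1 1 (by simp))]; exact h.m_eq
  · rw [hu.nvar 2 (h1 2 (by simp))]; exact h.N_eq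
  · rw [hu.narr 0 (h2 0 (by simp))]; exact h.x_eq
  · rw [hu.narr 1 (h2 1 (by simp))]; exact h.y_eq
  · rw [hu.narr 2 (h2 2 (by simp))]; exact h.rowm
  · rw [hu.narr 3 (h2 3 (by simp))]; exact h.rown
  · rw [hu.rarr 0 h3]; exact h.q_eq

/-- Computes the number of tree edges and the multiples of `m` and of `n`. -/
def tables : Prog :=
  .seq (.nset 2 (.sub (.var 0) (.lit 1)))
    (.seq (.loop 3 1 (.nput 2 (.add (.var 3) (.lit 1)) (.add (.get 2 (.var 3)) (.var 1))))
      (.loop 3 2 (.nput 3 (.add (.var 3) (.lit 1)) (.add (.get 3 (.var 3)) (.var 0)))))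

/-- Index expressions have no multiplication, so the row offsets `i * m` and `i * n` are tabulated
by repeated addition. -/
theorem runs_tables {n m : ℕ} {x y : ℕ → ℕ} {q : ℕ → ℕ → ℝ} {s : Memory} (hnm : n ≤ m + 1)
    (hn : s.nvar 0 = n) (hm : s.nvar 1 = m) (hx : s.narr 0 = x) (hy : s.narr 1 = y)
    (h2 : s.narr 2 0 = 0) (h3 : s.narr 3 0 = 0)
    (hq : ∀ i < m, ∀ j < m, s.rarr 0 (i * m + j) = q i j) :
    Runs tables s (50 * (m + 1)) (Inst n m (n - 1) x y q) := by
  refine Runs.seq (M := 4) (N := 50 * m + 40) (P := fun s' => s'.nvar 2 = n - 1)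
    (Runs.of_wp ?_ (by decide)) (fun s₁ hu₁ hs₁ => ?_) (by omega)
  · simp [Prog.wp, NExp.eval, hn]
  have hm₁ : s₁.nvar 1 = m := (hu₁.nvar 1 (by decide)).trans hm
  refine Runs.seq (M := 20 * m + 6) (N := 20 * m + 6)
    (P := fun s' => ∀ i ≤ m, s'.narr 2 i = i * m) ?_ (fun s₂ hu₂ hs₂ => ?_) (by omega)
  · refine Runs.loop (N := m) (c := 8) (fun k s' => ∀ i ≤ k, s'.narr 2 i = i * m) (by decide) hm₁
      ?_ (fun k hk s' hu hk' hinv => Runs.of_wp ?_ (by decide)) (by omega)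
    · intro i hi
      obtain rfl : i = 0 := by omega
      simp only [hu₁.narr 2 (by decide), h2, zero_mul]
    · have := hu.nvar 1 (by decide)
      simp only [Prog.wp, NExp.eval, hk', Function.update_self]
      intro i hi
      rw [Function.update_apply]
      split_ifs with h
      · rw [h, hinv k le_rfl, this, hm₁]; ring
      · exact hinv i (by omega)
  · have hn₂ : s₂.nvar 0 = n :=
      ((hu₂.nvar 0 (by decide)).trans (hu₁.nvar 0 (by decide))).trans hn
    have h3₂ : s₂.narr 3 0 = 0 := by
      rw [hu₂.narr 3 (by decide), hu₁.narr 3 (by decide), h3]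
    refine (Runs.loop (N := n - 1) (c := 8) (fun k s' => ∀ i ≤ k, s'.narr 3 i = i * n)
      (by decide) ((hu₂.nvar 2 (by decide)).trans hs₁)
      ?_ (fun k hk s' hu hk' hinv => Runs.of_wp ?_ (by decide))
      (by omega : _ ≤ 20 * m + 6)).and_unchanged.mono le_rfl fun s₃ hs₃ => ?_
    · intro i hi
      obtain rfl : i = 0 := by omega
      simp only [h3₂, zero_mul]
    · have := hu.nvar 0 (by decide)
      simp only [Prog.wp, NExp.eval, hk', Function.update_self]
      intro i hi
      rw [Function.update_apply]
      split_ifs with h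
      · rw [h, hinv k le_rfl, this, hn₂]; ring
      · exact hinv i (by omega)
    · obtain ⟨hu₃, hs₃⟩ := hs₃
      constructor
      · rw [hu₃.nvar 0 (by decide), hn₂]
      · rw [hu₃.nvar 1 (by decide), hu₂.nvar 1 (by decide), hm₁]
      · rw [hu₃.nvar 2 (by decide), hu₂.nvar 2 (by decide), hs₁]
      · rw [hu₃.narr 0 (by decide), hu₂.narr 0 (by decide), hu₁.narr 0 (by decide), hx]
      · rw [hu₃.narr 1 (by decide), hu₂.narr 1 (by decide), hu₁.narr 1 (by decide), hy]
      · rw [hu₃.narr 2 (by decide)]; exact hs₂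
      · exact hs₃
      · rw [hu₃.rarr 0 (by decide), hu₂.rarr 0 (by decide), hu₁.rarr 0 (by decide)]; exact hq

/-- Finds an edge with one end in the tree. -/
def findEdge : Prog :=
  .loop 4 1 (.ite (.not (.neq (.get 4 (.get 0 (.var 4))) (.get 4 (.get 1 (.var 4)))))
    (.nset 5 (.var 4)) .skip)

/-- Finds the ends of that edge inside and outside the tree. -/
def orient : Prog :=
  .ite (.neq (.get 4 (.get 0 (.var 5))) (.lit 1))
    (.seq (.nset 6 (.get 0 (.var 5))) (.nset 7 (.get 1 (.var 5))))
    (.seq (.nset 6 (.get 1 (.var 5))) (.nset 7 (.get 0 (.var 5))))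

/-- Extends the old cut functions to the new vertex. -/
def copyCuts : Prog :=
  .loop 4 3 (.nput 6 (.add (.get 3 (.var 4)) (.var 7)) (.get 6 (.add (.get 3 (.var 4)) (.var 6))))

/-- Adds the new edge and its cut function. -/
def addEdge : Prog :=
  .seq (.nput 6 (.add (.get 3 (.var 3)) (.var 7)) (.lit 1))
    (.seq (.nput 4 (.var 7) (.lit 1)) (.nput 5 (.var 3) (.var 5)))

/-- Grows a spanning tree from the vertex `0`. -/
def grow : Prog :=
  .seq (.nput 4 (.lit 0) (.lit 1))
    (.loop 3 2 (.seq findEdge (.seq orient (.seq copyCuts addEdge))))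

section

variable {n m N : ℕ} {x y : ℕ → ℕ} {q : ℕ → ℕ → ℝ}

/-- The scan has no early exit; the last crossing edge is the one that is kept. -/
theorem runs_findEdge {s : Memory} (hI : Inst n m N x y q s)
    (hex : ∃ e < m, s.narr 4 (x e) ≠ s.narr 4 (y e)) :
    Runs findEdge s (30 * m + 6) fun s' =>
      s'.nvar 5 < m ∧ s.narr 4 (x (s'.nvar 5)) ≠ s.narr 4 (y (s'.nvar 5)) := by
  refine (Runs.loop (N := m) (c := 13) (fun k s' => (∃ e < k, s.narr 4 (x e) ≠ s.narr 4 (y e)) →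
      s'.nvar 5 < m ∧ s.narr 4 (x (s'.nvar 5)) ≠ s.narr 4 (y (s'.nvar 5))) (by decide) hI.m_eq
      ?_ (fun k hk s' hu hk' hinv => Runs.of_wp ?_ (by decide)) (by omega)).mono le_rfl
      fun s' h => h hex
  · rintro ⟨e, he, -⟩
    omega
  · have h4 := hu.narr 4 (by decide)
    have h0 := (hu.narr 0 (by decide)).trans hI.x_eq
    have h1 := (hu.narr 1 (by decide)).trans hI.y_eq
    simp only [Prog.wp, NExp.eval, Test.Holds, hk', h4, h0, h1]
    refine ⟨fun h _ => ?_, fun h hex' => ?_⟩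
    · simpa [Function.update_apply] using ⟨hk, h⟩
    · rw [not_not] at h
      obtain ⟨e, he, hne⟩ := hex'
      have hek : e ≠ k := fun hek => hne (by rw [hek, h])
      simpa [Function.update_apply] using hinv ⟨e, by omega, hne⟩

theorem runs_orient {s : Memory} (hI : Inst n m N x y q s)
    (hvals : ∀ v < n, s.narr 4 v = 0 ∨ s.narr 4 v = 1) (hxy : ∀ e < m, x e < n ∧ y e < n)
    {f : ℕ} (hf : s.nvar 5 = f) (hfm : f < m) (hne : s.narr 4 (x f) ≠ s.narr 4 (y f)) :
    Runs orient s 40 fun s' =>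
      (s'.nvar 6 = x f ∧ s'.nvar 7 = y f ∨ s'.nvar 6 = y f ∧ s'.nvar 7 = x f) ∧
        s.narr 4 (s'.nvar 6) = 1 ∧ s.narr 4 (s'.nvar 7) = 0 := by
  refine Runs.of_wp ?_ (by decide)
  have h1 := hvals _ (hxy f hfm).1
  have h2 := hvals _ (hxy f hfm).2
  simp only [orient, Prog.wp, NExp.eval, Test.Holds, hf, hI.x_eq, hI.y_eq]
  refine ⟨fun h => ?_, fun h => ?_⟩
  · simp [hf]
    omega
  · simp [hf]
    omega

theorem runs_copyCuts {s : Memory} (hI : Inst n m N x y q s) {k u w : ℕ} (hk : s.nvar 3 = k)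
    (hkN : k ≤ N) (hNm : N ≤ m) (hu : s.nvar 6 = u) (hw : s.nvar 7 = w) (hun : u < n)
    (hwn : w < n) (huw : u ≠ w) :
    Runs copyCuts s (30 * m + 6) fun s' => ∀ l, ∀ v < n, s'.narr 6 (l * n + v) =
      if l < k ∧ v = w then s.narr 6 (l * n + u) else s.narr 6 (l * n + v) := by
  refine Runs.loop (N := k) (c := 22) (fun j s' => ∀ l, ∀ v < n, s'.narr 6 (l * n + v) =
      if l < j ∧ v = w then s.narr 6 (l * n + u) else s.narr 6 (l * n + v)) (by decide) hk
      ?_ (fun j hj s' hs' hj' hinv => Runs.of_wp ?_ (by decide)) (by omega)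
  · intro l v _
    simp
  · have h3 : s'.narr 3 j = j * n := by
      rw [hs'.narr 3 (by decide)]; exact hI.rown j (by omega)
    have h6 := (hs'.nvar 6 (by decide)).trans hu
    have h7 := (hs'.nvar 7 (by decide)).trans hw
    simp only [Prog.wp, NExp.eval, hj', h3, h6, h7, Function.update_self]
    intro l v hv
    simp only [Function.update_apply, mul_add_inj hv hwn, hinv l v hv, hinv j u hun]
    by_cases h : l = j ∧ v = w
    · obtain ⟨rfl, rfl⟩ := h
      simp
    · rw [if_neg h]
      have : l < j + 1 ∧ v = w ↔ l < j ∧ v = w := by omega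
      simp only [this]

/-- What is known of the memory when `k` tree edges have been found. -/
def GrownIn (n m : ℕ) (x y : ℕ → ℕ) (k : ℕ) (s : Memory) : Prop :=
  Grown n m x y k (s.narr 4) (s.narr 5) (fun l v => s.narr 6 (l * n + v))

/-- There are `N ≤ m` rounds, each with one scan of the edges and one of the earlier cut functions.
-/
theorem runs_grow {s : Memory} (hI : Inst n m N x y q s) (hNn : N + 1 = n) (hNm : N ≤ m)
    (hxy : ∀ e < m, x e < n ∧ y e < n)
    (hcon : ∀ S : ℕ → Prop, S 0 → (∃ v < n, ¬ S v) → ∃ e < m, ¬ (S (x e) ↔ S (y e)))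
    (h4 : s.narr 4 = fun _ => 0) (h6 : s.narr 6 = fun _ => 0) :
    Runs grow s (300 * (m + 1) ^ 2) (GrownIn n m x y N) := by
  refine Runs.seq (M := 3) (N := 300 * (m + 1) ^ 2 - 3) (P := GrownIn n m x y 0)
    (Runs.of_wp ?_ (by decide)) (fun s₁ hu₁ hs₁ => ?_) ?_
  · refine Grown.init (by omega) ?_ ?_
    · simp [h6]
    · intro v
      simp [NExp.eval, h4, Function.update_apply]
  · have hI₁ := hI.of_unchanged hu₁ (by decide)
    refine Runs.loop (N := N) (c := 60 * m + 100) (GrownIn n m x y) (by decide) hI₁.N_eq hs₁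
      (fun k hk s₂ hu₂ hk₂ hinv => ?_) ?_
    · have hI₂ := hI₁.of_unchanged hu₂ (by decide)
      refine Runs.seq (runs_findEdge hI₂ (hinv.exists_crossing hcon (by omega)))
        (N := 30 * m + 80) (fun s₃ hu₃ hs₃ => ?_) (by omega)
      have hI₃ := hI₂.of_unchanged hu₃ (by decide)
      obtain ⟨f, hf⟩ : ∃ f, s₃.nvar 5 = f := ⟨_, rfl⟩
      have h43 : s₃.narr 4 = s₂.narr 4 := hu₃.narr 4 (by decide)
      rw [hf, ← h43] at hs₃
      refine Runs.seq (runs_orient hI₃ (by rw [h43]; exact hinv.vals) hxy hf hs₃.1 hs₃.2)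
        (N := 30 * m + 30) (fun s₄ hu₄ hs₄ => ?_) (by omega)
      have hI₄ := hI₃.of_unchanged hu₄ (by decide)
      have hk₄ : s₄.nvar 3 = k := by
        rw [hu₄.nvar 3 (by decide), hu₃.nvar 3 (by decide), hk₂]
      obtain ⟨u, hu⟩ : ∃ u, s₄.nvar 6 = u := ⟨_, rfl⟩
      obtain ⟨w, hw⟩ : ∃ w, s₄.nvar 7 = w := ⟨_, rfl⟩
      rw [hu, hw, h43] at hs₄
      obtain ⟨huw, hWu, hWw⟩ := hs₄
      have hfm := hs₃.1
      have hfn := hxy f hfm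
      have hun : u < n := by rcases huw with ⟨rfl, -⟩ | ⟨rfl, -⟩; exacts [hfn.1, hfn.2]
      have hwn : w < n := by rcases huw with ⟨-, rfl⟩ | ⟨-, rfl⟩; exacts [hfn.2, hfn.1]
      have hne : u ≠ w := fun h => by rw [h, hWw] at hWu; omega
      refine Runs.seq (runs_copyCuts hI₄ hk₄ (by omega) hNm hu hw hun hwn hne)
        (N := 20) (fun s₅ hu₅ hs₅ => Runs.of_wp ?_ (by decide)) (by omega)
      have hk₅ : s₅.nvar 3 = k := (hu₅.nvar 3 (by decide)).trans hk₄
      have hw₅ : s₅.nvar 7 = w := (hu₅.nvar 7 (by decide)).trans hw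
      have hf₅ : s₅.nvar 5 = f := by
        rw [hu₅.nvar 5 (by decide), hu₄.nvar 5 (by decide), hf]
      have hr₅ : s₅.narr 3 k = k * n :=
        (hI₄.of_unchanged hu₅ (by decide)).rown k (by omega)
      have h4₅ : s₅.narr 4 = s₂.narr 4 := by
        rw [hu₅.narr 4 (by decide), hu₄.narr 4 (by decide), h43]
      have h5₅ : s₅.narr 5 = s₂.narr 5 := by
        rw [hu₅.narr 5 (by decide), hu₄.narr 5 (by decide), hu₃.narr 5 (by decide)]
      have h6₄ : s₄.narr 6 = s₂.narr 6 := by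
        rw [hu₄.narr 6 (by decide), hu₃.narr 6 (by decide)]
      rw [h6₄] at hs₅
      have hstep := hinv.step hxy hfm huw hWu hWw (φ' := fun l v => Function.update (s₅.narr 6)
        (k * n + w) 1 (l * n + v)) fun l v hv => by
          simp only [Function.update_apply, mul_add_inj hv hwn, hs₅ l v hv]
          by_cases hvw : v = w <;> by_cases hlk : l = k <;> simp [hvw, hlk]
      rw [← h4₅, ← h5₅] at hstep
      simpa [addEdge, Prog.wp, NExp.eval, hk₅, hw₅, hf₅, hr₅, GrownIn] using hstep
    · have : N * (60 * m + 108) ≤ m * (60 * m + 108) := Nat.mul_le_mul_right _ hNm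
      rw [show 60 * m + 100 + 8 = 60 * m + 108 by omega]
      have e : 300 * (m + 1) ^ 2 = 300 * (m * m) + 600 * m + 300 := by ring
      have e' : m * (60 * m + 108) = 60 * (m * m) + 108 * m := by ring
      omega
  · have : 0 < (m + 1) ^ 2 := by positivity
    omega

end

/-! ### Propagating differences along fundamental cycles -/

/-- The cost of the pair of edges `i`, `j`. -/
def costEntry (i j : NExp) : RExp := .get 0 (.add (.get 2 i) j)

/-- Computes, for every edge, the sum of its interaction costs with the tree edges. -/
def treeSums : Prog :=
  .loop 3 1 (.seq (.rset 0 (.lit 0))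
    (.seq (.loop 4 2 (.rset 0 (.add (.var 0) (costEntry (.var 3) (.get 5 (.var 4))))))
      (.rput 2 (.var 3) (.var 0))))

/-- Gives the tree edges different labels. -/
def initLabels : Prog := .loop 3 2 (.nput 7 (.var 3) (.var 3))

/-- The current tree edge lies on the fundamental cycle of the current edge. -/
def crosses : Test :=
  .not (.neq (.get 6 (.add (.get 3 (.var 4)) (.get 0 (.var 3))))
    (.get 6 (.add (.get 3 (.var 4)) (.get 1 (.var 3)))))

/-- The change of the cost of the tree on exchanging the current tree edge for the current edge. -/
def exchangeExp : RExp :=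
  .add (.sub (.add (.sub (.mul (.lit 2) (.get 2 (.var 3))) (.mul (.lit 2) (.get 2 (.get 5 (.var 4)))))
    (costEntry (.var 3) (.var 3))) (.mul (.lit 2) (costEntry (.var 3) (.get 5 (.var 4)))))
    (costEntry (.get 5 (.var 4)) (.get 5 (.var 4)))

/-- Marks the labels on the fundamental cycle of the current edge, and computes their shifts. -/
def markCycle : Prog :=
  .loop 4 2 (.ite crosses
    (.seq (.rput 4 (.get 7 (.var 4)) (.sub (.sub (.lit 0) exchangeExp) (.get 3 (.var 4))))
      (.nput 8 (.get 7 (.var 4)) (.add (.var 3) (.lit 1)))) .skip)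

/-- Shifts the tree edges with a marked label and gives them a common new label. -/
def relabel : Prog :=
  .loop 4 2 (.ite (.neq (.get 8 (.get 7 (.var 4))) (.add (.var 3) (.lit 1)))
    (.seq (.rput 3 (.var 4) (.add (.get 3 (.var 4)) (.get 4 (.get 7 (.var 4)))))
      (.nput 7 (.var 4) (.add (.var 0) (.var 3)))) .skip)

/-- Merges the labels along all fundamental cycles. -/
def merge : Prog := .loop 3 1 (.seq markCycle relabel)

/-- Computes the costs of all edges from those of the tree edges. -/
def spread : Prog :=
  .loop 3 1 (.loop 4 2 (.ite crosses (.rput 1 (.var 3) (.add (.get 3 (.var 4)) exchangeExp)) .skip))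

/-- Sums up the defects on the tree edges, and counts them. -/
def sumDefects : Prog :=
  .seq (.rset 1 (.lit 0)) (.seq (.rset 2 (.lit 0))
    (.loop 3 2 (.seq (.rset 1 (.add (.var 1) (.sub (.get 2 (.get 5 (.var 3)))
      (.get 1 (.get 5 (.var 3)))))) (.rset 2 (.add (.var 2) (.lit 1))))))

/-- Adds a constant to all costs, so as to make the cost of the tree correct. -/
def balance : Prog :=
  .seq sumDefects (.seq (.rset 3 (.div (.var 1) (.var 2)))
    (.loop 3 1 (.rput 1 (.var 3) (.add (.get 1 (.var 3)) (.var 3)))))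

/-- The change of the cost of a tree on exchanging the edge `f` for the edge `e`. -/
def exchangeCost (q : ℕ → ℕ → ℝ) (r : ℕ → ℝ) (e f : ℕ) : ℝ :=
  2 * r e - 2 * r f + q e e - 2 * q e f + q f f

/-- The memory contains an instance, the tree edges `t`, their cut functions `φ`, and the sums
`r` of interaction costs with the tree edges. -/
structure HasTree (n m N : ℕ) (x y : ℕ → ℕ) (q : ℕ → ℕ → ℝ) (t : ℕ → ℕ) (φ : ℕ → ℕ → ℕ)
    (r : ℕ → ℝ) (s : Memory) : Prop where
  inst : Inst n m N x y q s
  t_eq : s.narr 5 = t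
  phi_eq : ∀ k v, s.narr 6 (k * n + v) = φ k v
  r_eq : ∀ e < m, s.rarr 2 e = r e

section

variable {n m N : ℕ} {x y : ℕ → ℕ} {q : ℕ → ℕ → ℝ} {t : ℕ → ℕ} {φ : ℕ → ℕ → ℕ} {r : ℕ → ℝ}
  {s : Memory}

theorem Inst.eval_costEntry (h : Inst n m N x y q s) {i j : NExp} (hi : i.eval s < m)
    (hj : j.eval s < m) : (costEntry i j).eval s = q (i.eval s) (j.eval s) := by
  rw [costEntry, RExp.eval, NExp.eval, NExp.eval, h.rowm _ hi.le, h.q_eq _ hi _ hj]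

theorem HasTree.of_unchanged {s' : Memory} {p : Prog} (h : HasTree n m N x y q t φ r s)
    (hu : Unchanged p s s')
    (hp : (∀ i < 3, i ∉ p.nvars) ∧ (∀ i < 7, i ∉ p.narrs) ∧ 0 ∉ p.rarrs ∧ 2 ∉ p.rarrs) :
    HasTree n m N x y q t φ r s' := by
  obtain ⟨h1, h2, h3, h4⟩ := hp
  refine ⟨h.inst.of_unchanged hu ⟨h1, fun i hi => h2 i (by omega), h3⟩, ?_, ?_, ?_⟩
  · rw [hu.narr 5 (h2 5 (by simp)), h.t_eq]
  · rw [hu.narr 6 (h2 6 (by simp))]; exact h.phi_eq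
  · rw [hu.rarr 2 h4]; exact h.r_eq

theorem HasTree.holds_crosses (h : HasTree n m N x y q t φ r s) {e k : ℕ} (he : s.nvar 3 = e)
    (hk : s.nvar 4 = k) (hkN : k < N) : crosses.Holds s ↔ φ k (x e) ≠ φ k (y e) := by
  simp only [crosses, Test.Holds, NExp.eval, he, hk, h.inst.x_eq, h.inst.y_eq,
    h.inst.rown k hkN.le, h.phi_eq, ne_eq]

theorem HasTree.eval_exchangeExp (h : HasTree n m N x y q t φ r s) {e k : ℕ} (he : s.nvar 3 = e)
    (hk : s.nvar 4 = k) (hem : e < m) (htm : t k < m) :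
    exchangeExp.eval s = exchangeCost q r e (t k) := by
  have e1 : (NExp.var 3).eval s = e := he
  have e2 : (NExp.get 5 (.var 4)).eval s = t k := by simp only [NExp.eval, hk, h.t_eq]
  have h1 := e1 ▸ hem
  have h2 := e2 ▸ htm
  simp only [exchangeExp, RExp.eval, h.inst.eval_costEntry h1 h1, h.inst.eval_costEntry h1 h2,
    h.inst.eval_costEntry h2 h2, e1, e2, h.r_eq e hem, h.r_eq _ htm, exchangeCost]
  norm_num

theorem runs_treeSums (hI : Inst n m N x y q s) (hNm : N ≤ m) (ht : ∀ k < N, s.narr 5 k < m) :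
    Runs treeSums s (100 * (m + 1) ^ 2) fun s' => ∀ e < m,
      s'.rarr 2 e = ∑ k ∈ Finset.range N, q e (s.narr 5 k) := by
  refine Runs.loop (N := m) (c := 20 * m + 20) (fun j s' => ∀ e < j,
    s'.rarr 2 e = ∑ k ∈ Finset.range N, q e (s.narr 5 k)) (by decide) hI.m_eq (by simp)
    (fun e he s₁ hu₁ he₁ hinv => ?_) ?_
  · have hI₁ := hI.of_unchanged hu₁ (by decide)
    have ht₁ : s₁.narr 5 = s.narr 5 := hu₁.narr 5 (by decide)
    refine Runs.seq (M := 2) (N := 20 * m + 18) (P := fun s' => s'.rvar 0 = 0)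
      (Runs.of_wp (by simp [Prog.wp, RExp.eval]) (by decide)) (fun s₂ hu₂ hs₂ => ?_) (by omega)
    have hI₂ := hI₁.of_unchanged hu₂ (by decide)
    refine Runs.seq (M := 20 * m + 6) (N := 10)
      (P := fun s' => s'.rvar 0 = ∑ k ∈ Finset.range N, q e (s.narr 5 k)) ?_
      (fun s₃ hu₃ hs₃ => Runs.of_wp ?_ (by decide)) (by omega)
    · refine Runs.loop (N := N) (c := 12) (fun j s' => s'.rvar 0 =
        ∑ k ∈ Finset.range j, q e (s.narr 5 k)) (by decide) hI₂.N_eq (by simpa using hs₂)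
        (fun k hk s₃ hu₃ hk₃ hinv₃ => Runs.of_wp ?_ (by decide)) (by omega)
      have hI₃ := hI₂.of_unchanged hu₃ (by decide)
      have e1 : (NExp.var 3).eval s₃ = e := by
        simp only [NExp.eval]
        rw [hu₃.nvar 3 (by decide), hu₂.nvar 3 (by decide), he₁]
      have e2 : (NExp.get 5 (.var 4)).eval s₃ = s.narr 5 k := by
        simp only [NExp.eval]
        rw [hk₃, hu₃.narr 5 (by decide), hu₂.narr 5 (by decide), ht₁]
      simp only [Prog.wp, RExp.eval, hI₃.eval_costEntry (e1 ▸ he) (e2 ▸ ht k hk), hinv₃, e1, e2,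
        Finset.sum_range_succ, Function.update_self]
    · have e1 : s₃.nvar 3 = e := by
        rw [hu₃.nvar 3 (by decide), hu₂.nvar 3 (by decide), he₁]
      have e2 : s₃.rarr 2 = s₁.rarr 2 := by
        rw [hu₃.rarr 2 (by decide), hu₂.rarr 2 (by decide)]
      simp only [Prog.wp, RExp.eval, NExp.eval, hs₃, Function.update_self, e1, e2]
      intro e' he'
      rw [Function.update_apply]
      split_ifs with hee
      · rw [hee]
      · exact hinv e' (by omega)
  · have e1 : 100 * (m + 1) ^ 2 = 100 * (m * m) + 200 * m + 100 := by ring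
    have e2 : m * (20 * m + 20 + 8) = 20 * (m * m) + 28 * m := by ring
    omega

theorem runs_initLabels (hI : Inst n m N x y q s) (hNm : N ≤ m) :
    Runs initLabels s (20 * m + 6) fun s' => ∀ k < N, s'.narr 7 k = k := by
  refine Runs.loop (N := N) (c := 12) (fun j s' => ∀ k < j, s'.narr 7 k = k) (by decide) hI.N_eq
    (by simp) (fun e he s₁ hu₁ he₁ hinv => Runs.of_wp ?_ (by decide)) (by omega)
  simp only [Prog.wp, NExp.eval, he₁, Function.update_self]
  intro k hk
  rw [Function.update_apply]
  split_ifs with h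
  · exact h.symm
  · exact hinv k (by omega)

/-- By `hlab` all tree edges with a given label need the same shift, so it does not matter which
edge of the cycle writes it last. The mark `e + 1` is a time stamp: marks of earlier rounds are
smaller and need not be erased. -/
theorem runs_markCycle (hs : HasTree n m N x y q t φ r s) (hNm : N ≤ m) (ht : ∀ k < N, t k < m)
    {C : ℕ → ℝ} (hC : ∀ e < m, ∀ k < N, φ k (x e) ≠ φ k (y e) →
      exchangeCost q r e (t k) = C e - C (t k)) {e : ℕ} (hem : e < m) (he : s.nvar 3 = e)
    (hmark : ∀ l, s.narr 8 l ≤ e) (hlab : ∀ k < N, ∀ k' < N, s.narr 7 k = s.narr 7 k' →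
      s.rarr 3 k - C (t k) = s.rarr 3 k' - C (t k')) :
    Runs markCycle s (100 * m + 6) fun s' => (∀ l, s'.narr 8 l ≤ e + 1) ∧
      (∀ l, s'.narr 8 l = e + 1 ↔ ∃ k < N, φ k (x e) ≠ φ k (y e) ∧ s.narr 7 k = l) ∧
      ∀ k < N, s'.narr 8 (s.narr 7 k) = e + 1 →
        s'.rarr 4 (s.narr 7 k) = C (t k) - C e - s.rarr 3 k := by
  refine Runs.loop (N := N) (c := 90) (fun j s' => (∀ l, s'.narr 8 l ≤ e + 1) ∧
      (∀ l, s'.narr 8 l = e + 1 ↔ ∃ k < j, φ k (x e) ≠ φ k (y e) ∧ s.narr 7 k = l) ∧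
      ∀ k < N, s'.narr 8 (s.narr 7 k) = e + 1 →
        s'.rarr 4 (s.narr 7 k) = C (t k) - C e - s.rarr 3 k) (by decide) hs.inst.N_eq
    ?_ (fun j hj s₁ hu₁ hj₁ hinv => Runs.of_wp ?_ (by decide)) (by omega)
  · refine ⟨fun l => (hmark l).trans (by omega), fun l => ?_, fun k _ h => ?_⟩
    · have := hmark l
      simp only [not_lt_zero, false_and, exists_false, iff_false]
      omega
    · have := hmark (s.narr 7 k)
      simp only at h
      omega
  · have hs₁ := hs.of_unchanged hu₁ (by decide)
    have he₁ : s₁.nvar 3 = e := (hu₁.nvar 3 (by decide)).trans he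
    have h7 : s₁.narr 7 = s.narr 7 := hu₁.narr 7 (by decide)
    have h3 : s₁.rarr 3 = s.rarr 3 := hu₁.rarr 3 (by decide)
    obtain ⟨hi1, hi2, hi3⟩ := hinv
    simp only [Prog.wp, NExp.eval, RExp.eval, hs₁.holds_crosses he₁ hj₁ hj,
      hs₁.eval_exchangeExp he₁ hj₁ hem (ht j hj), hj₁, he₁, h7, h3, Function.update_self]
    refine ⟨fun hcr => ⟨fun l => ?_, fun l => ?_, fun k hk => ?_⟩, fun hcr => ⟨hi1, fun l => ?_, hi3⟩⟩
    · rw [Function.update_apply]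
      split_ifs
      exacts [le_rfl, hi1 l]
    · rw [Function.update_apply]
      split_ifs with h
      · exact ⟨fun _ => ⟨j, by omega, hcr, h.symm⟩, fun _ => rfl⟩
      · rw [hi2]
        refine ⟨fun ⟨k, hk, h1, h2⟩ => ⟨k, by omega, h1, h2⟩, fun ⟨k, hk, h1, h2⟩ =>
          ⟨k, ?_, h1, h2⟩⟩
        have : k ≠ j := fun hkj => h (by rw [← h2, hkj])
        omega
    · rw [Function.update_apply, Function.update_apply]
      split_ifs with h
      · intro _
        rw [hC e hem j hj hcr]
        have := hlab k hk j hj h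
        push_cast
        linarith
      · exact hi3 k hk
    · rw [hi2]
      refine ⟨fun ⟨k, hk, h1, h2⟩ => ⟨k, by omega, h1, h2⟩, fun ⟨k, hk, h1, h2⟩ =>
          ⟨k, ?_, h1, h2⟩⟩
      have : k ≠ j := fun hkj => hcr (by rw [← hkj]; exact h1)
      omega

theorem runs_relabel (hI : Inst n m N x y q s) (hNm : N ≤ m) {e : ℕ} (he : s.nvar 3 = e) :
    Runs relabel s (100 * m + 6) fun s' => ∀ k < N,
      if s.narr 8 (s.narr 7 k) = e + 1 then
        s'.narr 7 k = n + e ∧ s'.rarr 3 k = s.rarr 3 k + s.rarr 4 (s.narr 7 k)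
      else s'.narr 7 k = s.narr 7 k ∧ s'.rarr 3 k = s.rarr 3 k := by
  refine Runs.mono (Runs.loop (N := N) (c := 90) (fun j s' => ∀ k < N,
      if k < j ∧ s.narr 8 (s.narr 7 k) = e + 1 then
        s'.narr 7 k = n + e ∧ s'.rarr 3 k = s.rarr 3 k + s.rarr 4 (s.narr 7 k)
      else s'.narr 7 k = s.narr 7 k ∧ s'.rarr 3 k = s.rarr 3 k) (by decide) hI.N_eq
    ?_ (fun j hj s₁ hu₁ hj₁ hinv => Runs.of_wp ?_ (by decide)) (by omega : _ ≤ 100 * m + 6)) le_rfl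
    fun s' h k hk => ?_
  · simp
  · have he₁ : s₁.nvar 3 = e := (hu₁.nvar 3 (by decide)).trans he
    have hn₁ : s₁.nvar 0 = n := (hu₁.nvar 0 (by decide)).trans hI.n_eq
    have h8 : s₁.narr 8 = s.narr 8 := hu₁.narr 8 (by decide)
    have h4 : s₁.rarr 4 = s.rarr 4 := hu₁.rarr 4 (by decide)
    obtain ⟨hj7, hj3⟩ : s₁.narr 7 j = s.narr 7 j ∧ s₁.rarr 3 j = s.rarr 3 j := by
      simpa using hinv j hj
    simp only [Prog.wp, NExp.eval, RExp.eval, Test.Holds, hj₁, he₁, hn₁, h8, h4, hj7, hj3,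
      Function.update_self]
    refine ⟨fun hm k hk => ?_, fun hm k hk => ?_⟩
    · rw [Function.update_apply, Function.update_apply]
      by_cases hkj : k = j
      · subst hkj
        simp [hm]
      · have : k < j + 1 ↔ k < j := by omega
        simpa [hkj, this] using hinv k hk
    · by_cases hkj : k = j
      · subst hkj
        simpa [hm] using hinv k hk
      · have : k < j + 1 ↔ k < j := by omega
        simpa [this] using hinv k hk
  · simpa [hk] using h k hk

/-- After treating the first `e` edges: tree edges with the same label have the same difference
between their value and `C`, and each fundamental cycle carries a single label. -/
structure Merged (n m N : ℕ) (x y : ℕ → ℕ) (t : ℕ → ℕ) (φ : ℕ → ℕ → ℕ) (C : ℕ → ℝ) (e : ℕ)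
    (s : Memory) : Prop where
  mark : ∀ l, s.narr 8 l ≤ e
  lt : ∀ k < N, s.narr 7 k < n + e
  diff : ∀ k < N, ∀ k' < N, s.narr 7 k = s.narr 7 k' →
    s.rarr 3 k - C (t k) = s.rarr 3 k' - C (t k')
  cycle : ∀ e' < e, ∀ k < N, ∀ k' < N, φ k (x e') ≠ φ k (y e') → φ k' (x e') ≠ φ k' (y e') →
    s.narr 7 k = s.narr 7 k'

/-- After the shift a marked edge `t k` has the value `C (t k) - C e`, so all marked classes can be
united. The label `n + e` is larger than all labels in use, hence the new class is disjoint from the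
unmarked ones. A round is two scans of the tree edges. -/
theorem runs_merge (hs : HasTree n m N x y q t φ r s) (hNm : N ≤ m) (hNn : N ≤ n)
    (ht : ∀ k < N, t k < m)
    {C : ℕ → ℝ} (hC : ∀ e < m, ∀ k < N, φ k (x e) ≠ φ k (y e) →
      exchangeCost q r e (t k) = C e - C (t k))
    (h7 : ∀ k < N, s.narr 7 k = k) (h8 : s.narr 8 = fun _ => 0) :
    Runs merge s (300 * (m + 1) ^ 2) fun s' => ∀ e < m, ∀ k < N, ∀ k' < N,
      φ k (x e) ≠ φ k (y e) → φ k' (x e) ≠ φ k' (y e) →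
        s'.rarr 3 k - C (t k) = s'.rarr 3 k' - C (t k') := by
  refine Runs.mono (Runs.loop (N := m) (c := 200 * m + 12) (Merged n m N x y t φ C) (by decide)
    hs.inst.m_eq ?_ (fun e he s₁ hu₁ he₁ hinv => ?_) ?_) le_rfl
    fun s' h e he k hk k' hk' hc hc' => h.diff k hk k' hk' (h.cycle e he k hk k' hk' hc hc')
  · refine ⟨by simp [h8], fun k hk => ?_, fun k hk k' hk' h => ?_, by simp⟩
    · simp only [h7 k hk]; omega
    · simp only [h7 k hk, h7 k' hk'] at h
      rw [h]
  · have hs₁ := hs.of_unchanged hu₁ (by decide)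
    refine Runs.seq (runs_markCycle hs₁ hNm ht hC he he₁ hinv.mark hinv.diff)
      (N := 100 * m + 6) (fun s₂ hu₂ hs₂ => ?_) (by omega)
    have hs' := hs₁.of_unchanged hu₂ (by decide)
    have he₂ : s₂.nvar 3 = e := (hu₂.nvar 3 (by decide)).trans he₁
    have h7₂ : s₂.narr 7 = s₁.narr 7 := hu₂.narr 7 (by decide)
    have h3₂ : s₂.rarr 3 = s₁.rarr 3 := hu₂.rarr 3 (by decide)
    obtain ⟨hm1, hm2, hm3⟩ := hs₂
    refine (runs_relabel hs'.inst hNm he₂).and_unchanged.mono le_rfl fun s₃ ⟨hu₃, hs₃⟩ => ?_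
    rw [h7₂, h3₂] at hs₃
    have key : ∀ k < N, (s₂.narr 8 (s₁.narr 7 k) = e + 1 ∧ s₃.narr 7 k = n + e ∧
        s₃.rarr 3 k = C (t k) - C e) ∨ (s₂.narr 8 (s₁.narr 7 k) ≠ e + 1 ∧
        s₃.narr 7 k = s₁.narr 7 k ∧ s₃.rarr 3 k = s₁.rarr 3 k) := by
      intro k hk
      have h1 := hs₃ k hk
      split_ifs at h1 with hm
      · refine Or.inl ⟨hm, h1.1, ?_⟩
        rw [h1.2, hm3 k hk hm]
        ring
      · exact Or.inr ⟨hm, h1⟩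
    refine ⟨?_, fun k hk => ?_, fun k hk k' hk' => ?_, fun e' he' k hk k' hk' hc hc' => ?_⟩
    · simp only
      rw [hu₃.narr 8 (by decide)]
      exact hm1
    · have := hinv.lt k hk
      rcases key k hk with ⟨-, h, -⟩ | ⟨-, h, -⟩ <;> simp only [h] <;> omega
    · have l1 := hinv.lt k hk
      have l2 := hinv.lt k' hk'
      rcases key k hk with ⟨-, h, g⟩ | ⟨-, h, g⟩ <;>
        rcases key k' hk' with ⟨-, h', g'⟩ | ⟨-, h', g'⟩ <;> simp only [h, h', g, g']
      · intro _; ring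
      · intro _; omega
      · intro _; omega
      · exact hinv.diff k hk k' hk'
    · rcases Nat.lt_succ_iff_lt_or_eq.1 he' with he' | rfl
      · have h1 := hinv.cycle e' he' k hk k' hk' hc hc'
        rcases key k hk with ⟨h2, h, g⟩ | ⟨h2, h, g⟩ <;>
          rcases key k' hk' with ⟨h2', h', g'⟩ | ⟨h2', h', g'⟩ <;> simp only [h, h']
        · rw [h1] at h2; exact absurd h2 h2'
        · rw [h1] at h2; exact absurd h2' h2
        · exact h1
      · rcases key k hk with ⟨h2, h, g⟩ | ⟨h2, h, g⟩
        · rcases key k' hk' with ⟨h2', h', g'⟩ | ⟨h2', h', g'⟩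
          · simp only [h, h']
          · exact absurd ((hm2 _).2 ⟨k', hk', hc', rfl⟩) h2'
        · exact absurd ((hm2 _).2 ⟨k, hk, hc, rfl⟩) h2
  · have e1 : 300 * (m + 1) ^ 2 = 300 * (m * m) + 600 * m + 300 := by ring
    have e2 : m * (200 * m + 12 + 8) = 200 * (m * m) + 20 * m := by ring
    omega

/-- By `h3` every tree edge on the fundamental cycle of `e` yields the same value for `e`, so
overwriting is harmless; `hex` ensures that some value is written. -/
theorem runs_spread (hs : HasTree n m N x y q t φ r s) (hNm : N ≤ m) (ht : ∀ k < N, t k < m)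
    {C : ℕ → ℝ} (hC : ∀ e < m, ∀ k < N, φ k (x e) ≠ φ k (y e) →
      exchangeCost q r e (t k) = C e - C (t k))
    (hex : ∀ e < m, ∃ k < N, φ k (x e) ≠ φ k (y e))
    (h3 : ∀ e < m, ∀ k < N, ∀ k' < N, φ k (x e) ≠ φ k (y e) → φ k' (x e) ≠ φ k' (y e) →
        s.rarr 3 k - C (t k) = s.rarr 3 k' - C (t k')) :
    Runs spread s (300 * (m + 1) ^ 2) fun s' => ∀ e < m, ∀ k < N, φ k (x e) ≠ φ k (y e) →
      s'.rarr 1 e - C e = s.rarr 3 k - C (t k) := by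
  refine Runs.loop (N := m) (c := 100 * m + 6) (fun j s' => ∀ e < j, ∀ k < N,
    φ k (x e) ≠ φ k (y e) → s'.rarr 1 e - C e = s.rarr 3 k - C (t k)) (by decide)
    hs.inst.m_eq (by simp) (fun e he s₁ hu₁ he₁ hinv => ?_) ?_
  · have hs₁ := hs.of_unchanged hu₁ (by decide)
    have h3₁ : s₁.rarr 3 = s.rarr 3 := hu₁.rarr 3 (by decide)
    refine Runs.mono (Runs.loop (N := N) (c := 90) (fun j s' =>
      (∀ e' ≠ e, s'.rarr 1 e' = s₁.rarr 1 e') ∧ ((∃ k < j, φ k (x e) ≠ φ k (y e)) →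
        ∀ k < N, φ k (x e) ≠ φ k (y e) → s'.rarr 1 e - C e = s.rarr 3 k - C (t k))) (by decide)
      hs₁.inst.N_eq (by simp) (fun j hj s₂ hu₂ hj₂ hinv₂ => Runs.of_wp ?_ (by decide))
      (by omega : _ ≤ 100 * m + 6)) le_rfl fun s₂ ⟨h1, h2⟩ e' he' k hk hc => ?_
    · have hs₂ := hs₁.of_unchanged hu₂ (by decide)
      have he₂ : s₂.nvar 3 = e := (hu₂.nvar 3 (by decide)).trans he₁
      have h3₂ : s₂.rarr 3 = s.rarr 3 := (hu₂.rarr 3 (by decide)).trans h3₁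
      simp only [Prog.wp, NExp.eval, RExp.eval, hs₂.holds_crosses he₂ hj₂ hj,
        hs₂.eval_exchangeExp he₂ hj₂ he (ht j hj), hj₂, he₂, h3₂, Function.update_self]
      refine ⟨fun hcr => ⟨fun e' he' => ?_, fun _ k hk hc => ?_⟩, fun hcr => ⟨hinv₂.1, fun h => ?_⟩⟩
      · rw [Function.update_of_ne he']
        exact hinv₂.1 e' he'
      · rw [hC e he j hj hcr, ← h3 e he j hj k hk hcr hc]
        ring
      · obtain ⟨k, hk, hc⟩ := h
        have : k ≠ j := fun hkj => hcr (by rw [← hkj]; exact hc)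
        exact hinv₂.2 ⟨k, by omega, hc⟩
    · rcases Nat.lt_succ_iff_lt_or_eq.1 he' with he' | rfl
      · simp only
        rw [h1 e' (by omega)]
        exact hinv e' he' k hk hc
      · exact h2 (hex e' he) k hk hc
  · have e1 : 300 * (m + 1) ^ 2 = 300 * (m * m) + 600 * m + 300 := by ring
    have e2 : m * (100 * m + 6 + 8) = 100 * (m * m) + 14 * m := by ring
    omega

/-- The number `N` is recomputed in a real variable, since real expressions cannot read counters. -/
theorem runs_sumDefects (hs : HasTree n m N x y q t φ r s) (hNm : N ≤ m)
    (ht : ∀ k < N, t k < m) :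
    Runs sumDefects s (30 * m + 10) fun s' => s'.rvar 2 = N ∧
      s'.rvar 1 = ∑ k ∈ Finset.range N, (r (t k) - s.rarr 1 (t k)) := by
  refine Runs.seq (M := 2) (N := 30 * m + 8) (P := fun s' => s'.rvar 1 = 0)
      (Runs.of_wp (by simp [Prog.wp, RExp.eval]) (by decide)) (fun s₁ hu₁ h₁ => ?_) (by omega)
  refine Runs.seq (M := 2) (N := 30 * m + 6) (P := fun s' => s'.rvar 2 = 0)
      (Runs.of_wp (by simp [Prog.wp, RExp.eval]) (by decide)) (fun s₂ hu₂ h₂ => ?_) (by omega)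
  have hs₂ := (hs.of_unchanged hu₁ (by decide)).of_unchanged hu₂ (by decide)
  have h1₂ : s₂.rarr 1 = s.rarr 1 := (hu₂.rarr 1 (by decide)).trans (hu₁.rarr 1 (by decide))
  have hr₂ : s₂.rvar 1 = 0 := (hu₂.rvar 1 (by decide)).trans h₁
  refine Runs.loop (N := N) (c := 20) (fun j s' => s'.rvar 2 = j ∧
      s'.rvar 1 = ∑ k ∈ Finset.range j, (r (t k) - s.rarr 1 (t k))) (by decide)
    hs₂.inst.N_eq (by simp [h₂, hr₂]) (fun k hk s₃ hu₃ hk₃ hinv => Runs.of_wp ?_ (by decide))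
    (by omega)
  have hs₃ := hs₂.of_unchanged hu₃ (by decide)
  have h1₃ : s₃.rarr 1 = s.rarr 1 := (hu₃.rarr 1 (by decide)).trans h1₂
  simp [Prog.wp, NExp.eval, RExp.eval, hk₃, hs₃.t_eq, hs₃.r_eq _ (ht k hk), h1₃, hinv.1, hinv.2,
    Finset.sum_range_succ]
  ring

theorem runs_balance (hs : HasTree n m N x y q t φ r s) (hNm : N ≤ m)
    (ht : ∀ k < N, t k < m) :
    Runs balance s (60 * m + 30) fun s' => ∀ e < m, s'.rarr 1 e = s.rarr 1 e +
      (∑ k ∈ Finset.range N, (r (t k) - s.rarr 1 (t k))) / N := by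
  refine Runs.seq (runs_sumDefects hs hNm ht) (N := 30 * m + 20) (fun s₁ hu₁ h₁ => ?_) (by omega)
  have hs₁ := hs.of_unchanged hu₁ (by decide)
  have h1₁ : s₁.rarr 1 = s.rarr 1 := hu₁.rarr 1 (by decide)
  refine Runs.seq (M := 4) (N := 30 * m + 6) (P := fun s' => s'.rvar 3 =
      (∑ k ∈ Finset.range N, (r (t k) - s.rarr 1 (t k))) / N)
      (Runs.of_wp (by simp [Prog.wp, RExp.eval, h₁.1, h₁.2]) (by decide))
      (fun s₂ hu₂ h₂ => ?_) (by omega)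
  have hs₂ := hs₁.of_unchanged hu₂ (by decide)
  have h1₂ : s₂.rarr 1 = s.rarr 1 := (hu₂.rarr 1 (by decide)).trans h1₁
  refine Runs.mono (Runs.loop (N := m) (c := 20) (fun j s' => ∀ e, s'.rarr 1 e = s.rarr 1 e +
      if e < j then (∑ k ∈ Finset.range N, (r (t k) - s.rarr 1 (t k))) / N else 0) (by decide)
    hs₂.inst.m_eq (by simp [h1₂]) (fun j hj s₃ hu₃ hj₃ hinv => Runs.of_wp ?_ (by decide))
    (by omega : _ ≤ 30 * m + 6)) le_rfl fun s' h e he => by rw [h e, if_pos he]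
  have h3₃ := (hu₃.rvar 3 (by decide)).trans h₂
  simp only [Prog.wp, NExp.eval, RExp.eval, hj₃, h3₃, Function.update_self]
  intro e
  rw [Function.update_apply]
  split_ifs with hej hlt hlt
  · rw [hej, hinv j, if_neg (by omega), add_zero]
  · omega
  · rw [hinv e, if_pos (by omega)]
  · rw [hinv e, if_neg (by omega)]

end

end RealRAM

/-! ### A criterion for linearizations. -/

section CutSystem

variable {V : Type*}

/-- The first edge of the path of `T` from `u` to `v` separates them, because paths in a tree are
unique. So no fundamental cycle is without tree edges. -/
theorem IsCutSystem.exists_ne {κ : Type*} {T : SimpleGraph V} {a b : κ → V} {φ : κ → V → ℕ}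
    (h : IsCutSystem T a b φ) {u v : V} (huv : u ≠ v) : ∃ k, φ k u ≠ φ k v := by
  by_contra hall
  push Not at hall
  obtain ⟨p, hp⟩ := (h.connected.preconnected u v).exists_isPath
  cases p with
  | nil => exact huv rfl
  | cons hadj p =>
    obtain ⟨k, hk⟩ := h.exists_of_adj hadj
    obtain ⟨p', hp'⟩ := (h.reachable_of_eq (hall k)).exists_isPath
    have := (h.isTree.isAcyclic.subsingleton_path u v).elim ⟨_, hp⟩
      ⟨p'.mapLe (deleteEdges_le _), by simpa using hp'⟩
    have hpe := congrArg (fun p : T.Path u v => (p : T.Walk u v).edges) this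
    have hmem : s(a k, b k) ∈ p'.edges := by
      have : s(a k, b k) ∈ (p'.mapLe (deleteEdges_le {s(a k, b k)} : _ ≤ T)).edges := by
        rw [← hpe, hk]
        simp
      simpa using this
    have := p'.edges_subset_edgeSet hmem
    rw [edgeSet_deleteEdges] at this
    exact this.2 rfl

/-- By `hc` the vector `c - C` has the same cost on all spanning trees, and by `hsum` this cost is
zero on `T`. -/
theorem IsCutSystem.isLinearization [Fintype V] {G : SimpleGraph V} {κ : Type*} [Fintype κ]
    {T : SimpleGraph V} {a b : κ → V} {φ : κ → V → ℕ} (h : IsCutSystem T a b φ)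
    (hadj : ∀ k, G.Adj (a k) (b k)) {Q : Matrix G.edgeSet G.edgeSet ℝ} {C c : G.edgeSet → ℝ}
    (hC : IsLinearization Q C)
    (hc : ∀ u v (huv : G.Adj u v) k, φ k u ≠ φ k v → c ⟨s(u, v), huv⟩ - C ⟨s(u, v), huv⟩ =
      c ⟨s(a k, b k), hadj k⟩ - C ⟨s(a k, b k), hadj k⟩)
    (hsum : ∑ k, c ⟨s(a k, b k), hadj k⟩ =
      ∑ k, ∑ l, Q ⟨s(a k, b k), hadj k⟩ ⟨s(a l, b l), hadj l⟩) : IsLinearization Q c := by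
  classical
  have hTG : T ≤ G := by
    intro u v huv
    obtain ⟨l, hl⟩ := h.exists_of_adj huv
    rw [← mem_edgeSet, ← hl]
    exact hadj l
  have hT : quadCost Q T = linCost c T := by
    rw [quadCost_eq_dotProduct, linCost_eq_dotProduct, h.indVec_dotProduct hadj,
      h.indVec_dotProduct hadj, hsum]
    refine Finset.sum_congr rfl fun k _ => ?_
    rw [← h.indVec_dotProduct hadj (Q ⟨s(a k, b k), hadj k⟩), dotProduct_comm]
    rfl
  intro T' hT'
  have h1 := h.linCost_eq hadj (d := c - C) hc T' hT'
  have h2 := hC T' hT'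
  have h3 := hC T ⟨hTG, h.isTree⟩
  simp only [linCost_eq_dotProduct, dotProduct_sub] at h1 h2 h3 hT ⊢
  linarith

end CutSystem

/-! ### The complete program and its correctness. -/

namespace RealRAM

/-- Computes a linearization. -/
def linearize : Prog :=
  .seq tables (.seq grow (.seq treeSums (.seq initLabels (.seq merge (.seq spread balance)))))

/-- Extension by zero. -/
def extendZero {α : Type*} [Zero α] {m : ℕ} (f : Fin m → α) (k : ℕ) : α :=
  if h : k < m then f ⟨k, h⟩ else 0

theorem extendZero_apply {α : Type*} [Zero α] {m : ℕ} (f : Fin m → α) {k : ℕ} (h : k < m) :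
    extendZero f k = f ⟨k, h⟩ := dif_pos h

/-- With `n - 1` edges the tree has `n` vertices, hence all of them. -/
theorem Grown.isCutSystem {n m : ℕ} {x y : Fin m → Fin n} {W t : ℕ → ℕ} {φ : ℕ → ℕ → ℕ}
    (hn : 0 < n) (hne : ∀ i, x i ≠ y i)
    (h : Grown n m (extendZero fun i => (x i : ℕ)) (extendZero fun i => (y i : ℕ)) (n - 1) W t φ) :
    IsCutSystem (fromEdgeSet (Set.range fun k : Fin (n - 1) =>
        s(x ⟨t k, h.lt k k.2⟩, y ⟨t k, h.lt k k.2⟩)))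
      (fun k : Fin (n - 1) => x ⟨t k, h.lt k k.2⟩)
      (fun k : Fin (n - 1) => y ⟨t k, h.lt k k.2⟩) (fun k v => φ k v) := by
  refine ⟨?_, ?_, fun k l => ?_⟩
  · rw [edgeSet_fromEdgeSet, sdiff_eq_left, Set.disjoint_left]
    rintro _ ⟨k, rfl⟩ hk
    exact hne _ (by simpa using hk)
  · have hW : ∀ v < n, W v = 1 := by
      have : (Finset.range n).filter (fun v => W v = 1) = Finset.range n :=
        Finset.eq_of_subset_of_card_le (Finset.filter_subset _ _) (by
          rw [h.card, Finset.card_range]; omega)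
      intro v hv
      have hv' := Finset.mem_range.2 hv
      rw [← this] at hv'
      exact (Finset.mem_filter.1 hv').2
    have key : ∀ v, Relation.ReflTransGen (fun u v => ∃ l < n - 1,
        s(extendZero (fun i => (x i : ℕ)) (t l), extendZero (fun i => (y i : ℕ)) (t l)) = s(u, v))
        0 v → ∀ hv : v < n, (fromEdgeSet (Set.range fun k : Fin (n - 1) =>
        s(x ⟨t k, h.lt k k.2⟩, y ⟨t k, h.lt k k.2⟩))).Reachable ⟨0, hn⟩ ⟨v, hv⟩ := by
      intro v hv
      induction hv with
      | refl => exact fun _ => Reachable.refl _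
      | tail _ hbc ih =>
        rename_i b c _
        intro hc
        obtain ⟨l, hl, hs⟩ := hbc
        rw [extendZero_apply _ (h.lt l hl), extendZero_apply _ (h.lt l hl)] at hs
        have hb : b < n := by
          rcases Sym2.eq_iff.1 hs with ⟨rfl, -⟩ | ⟨-, rfl⟩
          exacts [Fin.isLt _, Fin.isLt _]
        refine (ih hb).trans (Adj.reachable ?_)
        have hs' : s(x ⟨t l, h.lt l hl⟩, y ⟨t l, h.lt l hl⟩) = s(⟨b, hb⟩, ⟨c, hc⟩) := by
          rcases Sym2.eq_iff.1 hs with ⟨h1, h2⟩ | ⟨h1, h2⟩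
          · exact Sym2.eq_iff.2 (Or.inl ⟨Fin.ext h1, Fin.ext h2⟩)
          · exact Sym2.eq_iff.2 (Or.inr ⟨Fin.ext h1, Fin.ext h2⟩)
        rw [fromEdgeSet_adj]
        refine ⟨⟨⟨l, hl⟩, hs'⟩, fun hbc => ?_⟩
        rw [hbc] at hs'
        apply hne ⟨t l, h.lt l hl⟩
        rcases Sym2.eq_iff.1 hs' with ⟨h1, h2⟩ | ⟨h1, h2⟩ <;> rw [h1, h2]
    have : Nonempty (Fin n) := ⟨⟨0, hn⟩⟩
    refine ⟨fun u v => ?_⟩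
    exact (key u (h.reach u u.2 (hW u u.2)) u.2).symm.trans (key v (h.reach v v.2 (hW v v.2)) v.2)
  · have := h.cut k k.2 l l.2
    rw [extendZero_apply _ (h.lt l l.2), extendZero_apply _ (h.lt l l.2)] at this
    rw [this, ne_eq, ne_eq, Fin.ext_iff]

/-- The tree is found only during the run, so `hC` is required of every tree that may have been
grown. -/
theorem runs_linearize {n m : ℕ} {x y : ℕ → ℕ} {q : ℕ → ℕ → ℝ} {s : Memory} (hn0 : 0 < n)
    (hnm : n ≤ m + 1)
    (hn : s.nvar 0 = n) (hm : s.nvar 1 = m) (hx : s.narr 0 = x) (hy : s.narr 1 = y)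
    (h0 : ∀ i, 2 ≤ i → s.narr i = fun _ => 0)
    (hq : ∀ i < m, ∀ j < m, s.rarr 0 (i * m + j) = q i j)
    (hxy : ∀ e < m, x e < n ∧ y e < n)
    (hcon : ∀ S : ℕ → Prop, S 0 → (∃ v < n, ¬ S v) → ∃ e < m, ¬ (S (x e) ↔ S (y e)))
    {C : ℕ → ℝ} (hC : ∀ W t φ, Grown n m x y (n - 1) W t φ → ∀ e < m,
      (∃ k < n - 1, φ k (x e) ≠ φ k (y e)) ∧ ∀ k < n - 1, φ k (x e) ≠ φ k (y e) →
        exchangeCost q (fun e => ∑ k ∈ Finset.range (n - 1), q e (t k)) e (t k) = C e - C (t k)) :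
    Runs linearize s (2000 * (m + 1) ^ 2) fun s' => ∃ W t φ, Grown n m x y (n - 1) W t φ ∧
      (∀ e < m, ∀ k < n - 1, φ k (x e) ≠ φ k (y e) →
        s'.rarr 1 e - C e = s'.rarr 1 (t k) - C (t k)) ∧
      ∑ k ∈ Finset.range (n - 1), s'.rarr 1 (t k) =
        ∑ k ∈ Finset.range (n - 1), ∑ l ∈ Finset.range (n - 1), q (t k) (t l) := by
  have hsq : m + 1 ≤ (m + 1) ^ 2 := Nat.le_self_pow (by omega) _
  have hNm : n - 1 ≤ m := by omega
  refine Runs.seq (runs_tables hnm hn hm hx hy (by simp [h0 2]) (by simp [h0 3]) hq)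
    (N := 1500 * (m + 1) ^ 2) (fun s₁ hu₁ hI => ?_) (by omega)
  refine Runs.seq (runs_grow hI (by omega) hNm hxy hcon ?_ ?_)
    (N := 1200 * (m + 1) ^ 2) (fun s₂ hu₂ hg => ?_) (by omega)
  · rw [hu₁.narr 4 (by decide), h0 4 (by omega)]
  · rw [hu₁.narr 6 (by decide), h0 6 (by omega)]
  have hI₂ := hI.of_unchanged hu₂ (by decide)
  have ht : ∀ k < n - 1, s₂.narr 5 k < m := hg.lt
  obtain ⟨t, ht₂⟩ : ∃ t, s₂.narr 5 = t := ⟨_, rfl⟩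
  obtain ⟨φ, hφ₂⟩ : ∃ φ : ℕ → ℕ → ℕ, (fun l v => s₂.narr 6 (l * n + v)) = φ := ⟨_, rfl⟩
  rw [GrownIn, ht₂, hφ₂] at hg
  have hCg := hC _ _ _ hg
  refine Runs.seq (runs_treeSums hI₂ hNm ht) (N := 1000 * (m + 1) ^ 2) (fun s₃ hu₃ hr => ?_)
    (by omega)
  have hT : HasTree n m (n - 1) x y q t φ (fun e => ∑ k ∈ Finset.range (n - 1), q e (t k)) s₃ := by
    refine ⟨hI₂.of_unchanged hu₃ (by decide), ?_, ?_, ?_⟩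
    · rw [hu₃.narr 5 (by decide), ht₂]
    · rw [hu₃.narr 6 (by decide), ← hφ₂]; simp
    · rw [← ht₂]; exact hr
  rw [ht₂] at ht
  refine Runs.seq (runs_initLabels hT.inst hNm) (N := 900 * (m + 1) ^ 2) (fun s₄ hu₄ hl => ?_)
    (by omega)
  have hT₄ := hT.of_unchanged hu₄ (by decide)
  have h8 : s₄.narr 8 = fun _ => 0 := by
    rw [hu₄.narr 8 (by decide), hu₃.narr 8 (by decide), hu₂.narr 8 (by decide),
      hu₁.narr 8 (by decide), h0 8 (by omega)]
  refine Runs.seq (runs_merge hT₄ hNm (by omega) ht (fun e he => (hCg e he).2) hl h8)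
    (N := 600 * (m + 1) ^ 2) (fun s₅ hu₅ h₅ => ?_) (by omega)
  have hT₅ := hT₄.of_unchanged hu₅ (by decide)
  refine Runs.seq (runs_spread hT₅ hNm ht (fun e he => (hCg e he).2) (fun e he => (hCg e he).1) h₅)
    (N := 90 * (m + 1) ^ 2) (fun s₆ hu₆ h₆ => ?_) (by omega)
  have hT₆ := hT₅.of_unchanged hu₆ (by decide)
  refine (runs_balance hT₆ hNm ht).mono (by omega) fun s₇ h₇ => ⟨_, t, φ, hg, ?_, ?_⟩
  · intro e he k hk hc
    rw [h₇ e he, h₇ _ (ht k hk)]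
    have h1 := h₆ e he k hk hc
    -- The fundamental cycle of a tree edge is the edge itself, so `spread` also treats the tree
    -- edges.
    have h2 := h₆ (t k) (ht k hk) k hk fun h => (hg.cut k hk k hk).1 h rfl
    linarith
  · rw [Finset.sum_congr rfl fun k hk => h₇ (t k) (ht k (Finset.mem_range.1 hk)),
      Finset.sum_add_distrib, Finset.sum_const, Finset.card_range, nsmul_eq_mul,
      Finset.sum_sub_distrib]
    -- For a single vertex the program divides by zero, but then there are no tree edges to correct.
    rcases Nat.eq_zero_or_pos (n - 1) with h | h
    · simp [h]
    · have : ((n - 1 : ℕ) : ℝ) ≠ 0 := by positivity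
      rw [mul_div_cancel₀ _ this]
      ring

theorem runs_linearize_input {n m : ℕ} {G : SimpleGraph (Fin n)}
    {num : Fin m ≃ G.edgeSet} {x y : Fin m → Fin n} (hG : G.Connected)
    (hnum : ∀ i, (num i : Sym2 (Fin n)) = s(x i, y i)) {Q : Matrix G.edgeSet G.edgeSet ℝ}
    (hQ : Q.IsSymm) (hlin : IsLinearizable Q) :
    Runs linearize (input x y (Q.submatrix num num)) (4000 * (m ^ 2 + 1)) fun s =>
      IsLinearization Q fun e => s.rarr 1 (num.symm e) := by
  classical
  obtain ⟨C, hC⟩ := hlin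
  have hadj : ∀ i, G.Adj (x i) (y i) := fun i => by
    rw [← mem_edgeSet, ← hnum]; exact (num i).2
  have hnum' : ∀ i, num i = ⟨s(x i, y i), hadj i⟩ := fun i => Subtype.ext (hnum i)
  have hn0 : 0 < n := by
    obtain ⟨v⟩ := hG.nonempty
    exact v.pos
  have hcard : Nat.card G.edgeSet = m := by
    rw [← Nat.card_congr num, Nat.card_eq_fintype_card, Fintype.card_fin]
  have hnm : n ≤ m + 1 := by
    have := hG.card_vert_le_card_edgeSet_add_one
    rwa [hcard, Nat.card_eq_fintype_card, Fintype.card_fin] at this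
  obtain ⟨q, hq⟩ : ∃ q : ℕ → ℕ → ℝ, ∀ i (hi : i < m) j (hj : j < m),
      q i j = Q (num ⟨i, hi⟩) (num ⟨j, hj⟩) :=
    ⟨fun i j => if h : i < m ∧ j < m then Q (num ⟨i, h.1⟩) (num ⟨j, h.2⟩) else 0,
      fun i hi j hj => dif_pos ⟨hi, hj⟩⟩
  have hne : ∀ i, x i ≠ y i := fun i => (hadj i).ne
  -- This is `(m + 1) ^ 2 ≤ 2 * (m ^ 2 + 1)`.
  have hcost : 2000 * (m + 1) ^ 2 ≤ 4000 * (m ^ 2 + 1) := by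
    have := add_sq_le (a := m) (b := 1)
    omega
  refine (runs_linearize (x := extendZero fun i => (x i : ℕ)) (y := extendZero fun i => (y i : ℕ))
    (q := q) (C := extendZero fun i => C (num i)) hn0 hnm ?_ ?_ ?_ ?_ ?_ ?_ ?_
    ?_ ?_).mono hcost ?_
  · simp [input]
  · simp [input]
  · funext k
    simp [input, extendZero]
  · funext k
    simp [input, extendZero]
  · intro i hi
    funext k
    have h1 : i ≠ 0 := by omega
    have h2 : i ≠ 1 := by omega
    simp [input, h1, h2]
  · intro i hi j hj
    have hlt : i * m + j < m * m := by nlinarith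
    have hd : (i * m + j) / m = i := by
      rw [mul_comm, Nat.mul_add_div (by omega), Nat.div_eq_of_lt hj, add_zero]
    have hm : (i * m + j) % m = j := by
      rw [mul_comm, Nat.mul_add_mod, Nat.mod_eq_of_lt hj]
    rw [hq i hi j hj]
    simp [input, hlt, Fin.divNat, Fin.modNat, hd, hm]
  · intro e he
    rw [extendZero_apply _ he, extendZero_apply _ he]
    exact ⟨Fin.isLt _, Fin.isLt _⟩
  · rintro S h0 ⟨v, hv, hSv⟩
    by_contra hall
    push Not at hall
    refine hSv ((eq_of_reachable (fun v : Fin n => S v) (fun u w huw => ?_)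
      (hG.preconnected ⟨0, hn0⟩ ⟨v, hv⟩)).mp h0)
    obtain ⟨i, hi⟩ := num.surjective ⟨s(u, w), huw⟩
    have h1 := hall i i.2
    rw [extendZero_apply _ i.2, extendZero_apply _ i.2] at h1
    have h2 := hnum i
    rw [hi] at h2
    rcases Sym2.eq_iff.1 h2 with ⟨h3, h4⟩ | ⟨h3, h4⟩ <;>
      rw [h3, h4]
    exacts [propext h1, propext h1.symm]
  · intro W t φ h e he
    have hc := h.isCutSystem hn0 hne
    rw [extendZero_apply _ he, extendZero_apply _ he, extendZero_apply _ he]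
    refine ⟨?_, fun k hk hne => ?_⟩
    · obtain ⟨k, hk⟩ := hc.exists_ne (hadj ⟨e, he⟩).ne
      exact ⟨k, k.2, hk⟩
    · have htk := h.lt k hk
      rw [extendZero_apply _ htk]
      have := hC.sub_eq hc (fun _ => hadj _) hQ (hadj ⟨e, he⟩) (k := ⟨k, hk⟩) hne (hnum' ⟨e, he⟩)
        (hnum' ⟨t k, htk⟩)
      rw [this, exchangeCost]
      simp only [Finset.sum_range, hq e he e he, hq e he _ htk, hq _ htk _ htk, ← hnum']
      congr 4 <;> congr 1 <;> refine Finset.sum_congr rfl fun l _ => ?_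
      exacts [hq e he _ (h.lt l l.2), hq _ htk _ (h.lt l l.2)]
  · rintro s ⟨W, t, φ, h, h1, h2⟩
    have hc := h.isCutSystem hn0 hne
    refine hc.isLinearization (fun _ => hadj _) hC (fun u v huv k hk => ?_) ?_
    · obtain ⟨i, hi⟩ := num.surjective ⟨s(u, v), huv⟩
      have hk' : φ k (x i) ≠ φ k (y i) := by
        have h2 := hnum i
        rw [hi] at h2
        rcases Sym2.eq_iff.1 h2 with ⟨h3, h4⟩ | ⟨h3, h4⟩
        · rw [← h3, ← h4]; exact hk
        · rw [← h3, ← h4]; exact hk.symm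
      have := h1 i i.2 k k.2 (by rwa [extendZero_apply _ i.2, extendZero_apply _ i.2])
      rw [extendZero_apply _ i.2, extendZero_apply _ (h.lt k k.2)] at this
      rw [← hi, ← hnum']
      simpa using this
    · simp only [Finset.sum_range] at h2
      simp only [← hnum', Equiv.symm_apply_apply]
      rw [h2]
      exact Finset.sum_congr rfl fun k _ => Finset.sum_congr rfl fun l _ =>
        hq _ (h.lt k k.2) _ (h.lt l l.2)

end RealRAM

end QMSTP

theorem mainTheorem1 :
    (∀ (V : Type*) [Fintype V] (G : SimpleGraph V), G.Connected → QMSTP.HasNiceComponents G →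
      ∀ Q : Matrix G.edgeSet G.edgeSet ℝ, Q.IsSymm →
        (QMSTP.IsLinearizable Q ↔
          (∀ I J : G.Subgraph, QMSTP.IsBiconnectedComponent I →
            QMSTP.IsBiconnectedComponent J → I ≠ J →
              QMSTP.IsSumMatrix (QMSTP.subMatrix Q I J)) ∧
          (∀ B : G.Subgraph, QMSTP.IsBiconnectedComponent B →
            (QMSTP.IsCliqueSubgraph B ∨ QMSTP.IsBigBicliqueSubgraph B) →
              QMSTP.IsSymmWeakSumMatrix (QMSTP.subMatrix Q B B)))) ∧
    (∃ (P : QMSTP.RealRAM.Prog) (K : ℕ),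
      ∀ (n m : ℕ) (G : SimpleGraph (Fin n)) (num : Fin m ≃ G.edgeSet) (x y : Fin m → Fin n),
        G.Connected → QMSTP.HasNiceComponents G →
        (∀ i, (num i : Sym2 (Fin n)) = s(x i, y i)) →
        ∀ Q : Matrix G.edgeSet G.edgeSet ℝ, Q.IsSymm → QMSTP.IsLinearizable Q →
          ∃ (s : QMSTP.RealRAM.Memory) (t : ℕ),
            QMSTP.RealRAM.Exec P (QMSTP.RealRAM.input x y (Q.submatrix num num)) s t ∧
            t ≤ K * (m ^ 2 + 1) ∧
            QMSTP.IsLinearization Q (fun e => s.rarr 1 (num.symm e))) := by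
  exact ⟨fun V _ G hG hn Q hQ => QMSTP.isLinearizable_iff hG hn hQ,
    QMSTP.RealRAM.linearize, 4000, fun _ _ _ _ _ _ hG _ hnum _ hQ hlin =>
      QMSTP.RealRAM.runs_linearize_input hG hnum hQ hlin⟩
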